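/- **Setting.** Let $D\subset\mathbb R^d$ be a bounded convex domain (nonempty and open; its boundary is then Lipschitz), let $\mathscr L$ be Lebesgue measure on the compact set $\bar D$, and let $\delta>0$. Let $\mathscr M^+(\cdot)$, $\mathscr M(\cdot)$, $\mathscr M(\cdot;\mathbb R^d)$ denote the finite non-negative, signed, and $\mathbb R^d$-valued Borel measures on a compact space, with weak$^*$ convergence in duality with continuous functions on that space. Let $r:\mathbb R\to\mathbb R$ be non-negative and convex with $r(0)=0$, and let $r^\infty(y)=\sup_{s>0} r(sy)/s$ be its recession function; assume linear growth, i.e. $r^\infty(1),r^\infty(-1)\in(0,\infty)$. *Continuity equation.* Let $\mu_A,\mu_B\in\mathscr M^+(\bar D)$. A triple $(\mu,\nu,\zeta)\in\mathscr M^+([0,1]\times\bar D)\times\mathscr M([0,1]\times\bar D;\mathbb R^d)\times\mathscr M([0,1]\times\bar D)$ belongs to $\mathcal{CE}[0,1]$ with boundary values $\mu_A,\mu_B$ if (i) there are a weak$^*$-continuous map $t\mapsto\mu_t\in\mathscr M^+(\bar D)$ and Borel measurable maps $t\mapsto\nu_t\in\mathscr M(\bar D;\mathbb R^d)$, $t\mapsto\zeta_t\in\mathscr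 M(\bar D)$, defined on $[0,1]$, with $\int_0^1|\nu_t|(\bar D)\,dt<\infty$ and $\int_0^1|\zeta_t|(\bar D)\,dt<\infty$, such that $\int\eta\,d\mu=\int_0^1\int_{\bar D}\eta(t,x)\,d\mu_t(x)\,dt$ for all $\eta\in L^1(\mu)$, and likewise for $\nu$ and $\zeta$; (ii) for every $\eta\in C^1([0,1]\times\bar D)$ (the restriction of a $C^1$ function on $\mathbb R\times\mathbb R^d$), $$0=\int_0^1\Big[\int_{\bar D}\partial_t\eta\,d\mu_t+\int_{\bar D}\nabla\eta\cdot d\nu_t+\int_{\bar D}\eta\,d\zeta_t\Big]dt-\int_{\bar D}\eta(1,x)\,d\mu_B(x)+\int_{\bar D}\eta(0,x)\,d\mu_A(x).$$ *Energy.* Let $\Phi(u,m)=|m|^2/u$ if $u>0$, $\Phi(0,0)=0$, and $\Phi=+\infty$ otherwise. For $(\mu_t,\nu_t,\zeta_t)\in\mathscr M^+(\bar D)\times\mathscr M(\bar D;\mathbb R^d)\times\mathscr M(\bar D)$ write the Lebesgue decompositions $\mu_t=u_t\mathscr L+\mu_t^\perp$, $\nu_t=m_t\mathscr L+\nu_t^\perp$,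 $\zeta_t=z_t\mathscr L+\zeta_t^\perp$, put $\mathscr L_t^\perp=\mu_t^\perp+|\nu_t^\perp|+|\zeta_t^\perp|$, and let $u_t^\perp,m_t^\perp,z_t^\perp$ be the densities of $\mu_t^\perp,\nu_t^\perp,\zeta_t^\perp$ with respect to $\mathscr L_t^\perp$. Put $$\mathcal D_\delta[\mu_t,\nu_t,\zeta_t]=\int_{\bar D}\Phi(u_t,m_t)\,d\mathscr L+\int_{\bar D}\Phi(u_t^\perp,m_t^\perp)\,d\mathscr L_t^\perp+\frac1\delta\Big(\int_{\bar D}r(z_t)\,d\mathscr L+\int_{\bar D}r^\infty(z_t^\perp)\,d\mathscr L_t^\perp\Big)^2$$ (here $r^\infty(z)=|z|$ whenever $r(s)/|s|\to1$ as $|s|\to\infty$, e.g. for $r=|\cdot|$ or a Huber function), and $\mathcal E_\delta(\mu,\nu,\zeta)=\int_0^1\mathcal D_\delta[\mu_t,\nu_t,\zeta_t]\,dt$ for $(\mu,\nu,\zeta)\in\mathcal{CE}[0,1]$. **Proposition (compactness).** Let $(\mu^n,\nu^n,\zeta^n)_{n\in\mathbb N}$ be a sequence in $\mathcal{CE}[0,1]$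 with boundary values $\mu_A$ and $\mu_B$ (the same for all $n$) and $\sup_n\mathcal E_\delta(\mu^n,\nu^n,\zeta^n)\le C$ for some $C<\infty$. Then there are a subsequence (again indexed by $n$) and a triple $(\mu,\nu,\zeta)\in\mathcal{CE}[0,1]$ with boundary values $\mu_A,\mu_B$ such that $\mu^n_t\rightharpoonup^*\mu_t$ in $\mathscr M^+(\bar D)$ for every $t\in[0,1]$, $\nu^n\rightharpoonup^*\nu$ in $\mathscr M([0,1]\times\bar D;\mathbb R^d)$, $\zeta^n\rightharpoonup^*\zeta$ in $\mathscr M([0,1]\times\bar D)$, and $$\int_0^1\mathcal D_\delta[\mu_t,\nu_t,\zeta_t]\,dt\le\liminf_{n\to\infty}\int_0^1\mathcal D_\delta[\mu^n_t,\nu^n_t,\zeta^n_t]\,dt .$$ -/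

import Mathlib

open MeasureTheory Set Filter Topology
open scoped ENNReal unitInterval

namespace SourceTransport

noncomputable section

/-- The ambient space `ℝ^d` with its Euclidean structure. -/
abbrev Vec (d : ℕ) : Type := EuclideanSpace ℝ (Fin d)

/-- A bounded convex domain of `ℝ^d` (a nonempty open bounded convex set). The boundary of such a
set is automatically Lipschitz. -/
structure IsBoundedConvexDomain {d : ℕ} (D : Set (Vec d)) : Prop where
  isOpen : IsOpen D
  nonempty : D.Nonempty
  convex : Convex ℝ D
  isBounded : Bornology.IsBounded D

/-- The closed domain `D̄`, as a (compact) space. -/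
abbrev Cl {d : ℕ} (D : Set (Vec d)) : Type := ↥(closure D)

/-- Lebesgue measure on `D̄`. -/
def leb {d : ℕ} (D : Set (Vec d)) : Measure (Cl D) := Measure.comap Subtype.val volume

/-- The space-time cylinder `[0,1] × D̄`. -/
abbrev Cyl {d : ℕ} (D : Set (Vec d)) : Type := I × Cl D

/-- Mass `μ ∈ M⁺([0,1] × D̄)`, momentum `ν ∈ M([0,1] × D̄; ℝ^d)`, source `ζ ∈ M([0,1] × D̄)`. -/
structure Triple {d : ℕ} (D : Set (Vec d)) where
  mass : FiniteMeasure (Cyl D)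
  momentum : VectorMeasure (Cyl D) (Vec d)
  source : SignedMeasure (Cyl D)

/-- Families `t ↦ μ_t ∈ M⁺(D̄)`, `t ↦ ν_t ∈ M(D̄; ℝ^d)`, `t ↦ ζ_t ∈ M(D̄)`, `t ∈ [0,1]`. -/
structure Curve {d : ℕ} (D : Set (Vec d)) where
  mass : I → FiniteMeasure (Cl D)
  momentum : I → VectorMeasure (Cl D) (Vec d)
  source : I → SignedMeasure (Cl D)

/-- `c` disintegrates the space-time measures `T` with respect to Lebesgue measure in time.
The topology of `FiniteMeasure (Cl D)` is the weak-* topology, as `D̄` is compact. -/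
structure IsDisintegration {d : ℕ} {D : Set (Vec d)} (T : Triple D) (c : Curve D) : Prop where
  continuous_mass : Continuous c.mass
  measurable_momentum : ∀ B : Set (Cl D), MeasurableSet B → Measurable fun t => c.momentum t B
  finite_momentum : ∫⁻ t, (c.momentum t).variation univ < ∞
  measurable_source : ∀ B : Set (Cl D), MeasurableSet B → Measurable fun t => c.source t B
  finite_source : ∫⁻ t, (c.source t).variation univ < ∞
  mass_eq : ∀ η : Cyl D → ℝ, Integrable η (T.mass : Measure (Cyl D)) →
    ∫ p, η p ∂(T.mass : Measure (Cyl D)) =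
      ∫ t : I, ∫ x, η (t, x) ∂(c.mass t : Measure (Cl D))
  momentum_eq : ∀ η : Cyl D → ℝ, T.momentum.Integrable η →
    ∫ᵛ p, η p ∂•T.momentum = ∫ t : I, ∫ᵛ x, η (t, x) ∂•(c.momentum t)
  source_eq : ∀ η : Cyl D → ℝ, T.source.Integrable η →
    ∫ᵛ p, η p ∂•T.source = ∫ t : I, ∫ᵛ x, η (t, x) ∂•(c.source t)

/-- The triple `T`, with disintegration `c`, is a weak solution of `∂_t μ + div ν = ζ` with boundary
values `μ_0 = μA` and `μ_1 = μB`. The test functions are the restrictions to `[0,1] × D̄` of `C^1`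
functions on `ℝ × ℝ^d`; they need not vanish on the boundary of the cylinder. -/
structure IsWeakSolution {d : ℕ} {D : Set (Vec d)} (μA μB : FiniteMeasure (Cl D))
    (T : Triple D) (c : Curve D) : Prop where
  disintegration : IsDisintegration T c
  equation : ∀ η : ℝ × Vec d → ℝ, ContDiff ℝ 1 η →
    0 = (∫ t : I,
          ((∫ x : Cl D, deriv (fun s : ℝ => η (s, (x : Vec d))) (t : ℝ)
              ∂(c.mass t : Measure (Cl D)))
            + (∫ᵛ x : Cl D, gradient (fun y : Vec d => η ((t : ℝ), y)) (x : Vec d)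
                ∂[innerSL ℝ; c.momentum t])
            + (∫ᵛ x : Cl D, η ((t : ℝ), (x : Vec d)) ∂•(c.source t))))
        - (∫ x : Cl D, η (1, (x : Vec d)) ∂(μB : Measure (Cl D)))
        + (∫ x : Cl D, η (0, (x : Vec d)) ∂(μA : Measure (Cl D)))

/-- The transport integrand: `Φ(ρ, m) = |m|² / ρ` if `ρ > 0`, `0` if `(ρ, m) = 0`, `+∞` otherwise. -/
def Phi {d : ℕ} (ρ : ℝ) (m : Vec d) : ℝ≥0∞ :=
  open Classical in
  if 0 < ρ then ENNReal.ofReal (‖m‖ ^ 2 / ρ) else if ρ = 0 ∧ m = 0 then 0 else ∞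

/-- The recession function `r^∞(y) = sup_{s > 0} r(s y) / s`. -/
def recession (r : ℝ → ℝ) (y : ℝ) : ℝ≥0∞ :=
  ⨆ (s : ℝ) (_ : 0 < s), ENNReal.ofReal (r (s * y) / s)

/-- Source penalties: non-negative, convex, vanishing at `0`, with linear growth on both sides. -/
structure IsSourcePenalty (r : ℝ → ℝ) : Prop where
  nonneg : ∀ s, 0 ≤ r s
  convex : ConvexOn ℝ univ r
  zero : r 0 = 0
  growth_pos : 0 < recession r 1 ∧ recession r 1 < ∞
  growth_neg : 0 < recession r (-1) ∧ recession r (-1) < ∞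

section Decomposition

variable {d : ℕ} {X : Type*} [MeasurableSpace X]

/-- The density of the absolutely continuous part of an `ℝ^d`-valued measure with respect to `l`,
computed coordinate by coordinate. -/
def vecDensity (ν : VectorMeasure X (Vec d)) (l : Measure X) (x : X) : Vec d :=
  WithLp.toLp 2 fun i =>
    SignedMeasure.rnDeriv
      (ν.mapRange (EuclideanSpace.proj (𝕜 := ℝ) i).toLinearMap.toAddMonoidHom
        (EuclideanSpace.proj (𝕜 := ℝ) i).continuous) l x

/-- The singular part `ν^⊥ = ν - m l` of an `ℝ^d`-valued measure with respect to `l`. -/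
def vecSingularPart (ν : VectorMeasure X (Vec d)) (l : Measure X) : VectorMeasure X (Vec d) :=
  ν - l.withDensityᵥ (vecDensity ν l)

/-- The measure `l^⊥ = μ^⊥ + |ν^⊥| + |ζ^⊥|`. -/
def perp (l : Measure X) (μ : FiniteMeasure X) (ν : VectorMeasure X (Vec d))
    (ζ : SignedMeasure X) : Measure X :=
  (μ : Measure X).singularPart l + (vecSingularPart ν l).variation + (ζ.singularPart l).variation

/-- `∫ Φ(u, m) dl + ∫ Φ(u^⊥, m^⊥) dl^⊥`. -/
def transportAction (l : Measure X) (μ : FiniteMeasure X) (ν : VectorMeasure X (Vec d))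
    (ζ : SignedMeasure X) : ℝ≥0∞ :=
  ∫⁻ x, Phi ((μ : Measure X).rnDeriv l x).toReal (vecDensity ν l x) ∂l
  + ∫⁻ x, Phi (((μ : Measure X).singularPart l).rnDeriv (perp l μ ν ζ) x).toReal
      (vecDensity (vecSingularPart ν l) (perp l μ ν ζ) x) ∂(perp l μ ν ζ)

/-- `(∫ r(z) dl + ∫ r^∞(z^⊥) dl^⊥)²`. The integrand `r^∞(z^⊥)` is `|z^⊥|` if `r(s)/|s| → 1`
as `|s| → ∞`, see `recession_eq_abs`. -/
def sourceAction (r : ℝ → ℝ) (l : Measure X) (μ : FiniteMeasure X) (ν : VectorMeasure X (Vec d))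
    (ζ : SignedMeasure X) : ℝ≥0∞ :=
  (∫⁻ x, ENNReal.ofReal (r (ζ.rnDeriv l x)) ∂l
  + ∫⁻ x, recession r ((ζ.singularPart l).rnDeriv (perp l μ ν ζ) x) ∂(perp l μ ν ζ)) ^ 2

/-- The energy density `D_δ[μ, ν, ζ]`, relative to the reference measure `l`. -/
def energyDensity (δ : ℝ) (r : ℝ → ℝ) (l : Measure X) (μ : FiniteMeasure X)
    (ν : VectorMeasure X (Vec d)) (ζ : SignedMeasure X) : ℝ≥0∞ :=
  transportAction l μ ν ζ + ENNReal.ofReal (1 / δ) * sourceAction r l μ ν ζ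

end Decomposition

/-- The path energy `∫₀¹ D_δ[μ_t, ν_t, ζ_t] dt`. For a solution of the continuity equation this is
the energy `E_δ` of the space-time triple: disintegrations are unique up to null sets of times. -/
def pathEnergy {d : ℕ} {D : Set (Vec d)} (δ : ℝ) (r : ℝ → ℝ) (c : Curve D) : ℝ≥0∞ :=
  ∫⁻ t : I, energyDensity δ r (leb D) (c.mass t) (c.momentum t) (c.source t)

/-- For a convex penalty with `r 0 = 0` and `r(s)/|s| → 1` at `±∞`, the recession function is the
absolute value. -/
theorem recession_eq_abs {r : ℝ → ℝ} (hc : ConvexOn ℝ univ r) (h0 : r 0 = 0)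
    (hp : Tendsto (fun s : ℝ => r s / s) atTop (𝓝 1))
    (hn : Tendsto (fun s : ℝ => r (-s) / s) atTop (𝓝 1)) (y : ℝ) :
    recession r y = ENNReal.ofReal |y| := by
  have mono : ∀ s t : ℝ, 0 < s → s ≤ t → r (s * y) / s ≤ r (t * y) / t := by
    intro s t hs hst
    have ht : 0 < t := hs.trans_le hst
    have h := hc.2 (mem_univ (t * y)) (mem_univ 0) 
      (show 0 ≤ s / t by positivity)
      (show 0 ≤ 1 - s / t by rw [sub_nonneg, div_le_one ht]; exact hst) (by ring)
    simp only [smul_eq_mul, mul_zero, add_zero, h0] at h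
    rw [show s / t * (t * y) = s * y by field_simp] at h
    rw [div_le_div_iff₀ hs ht]
    rw [div_mul_eq_mul_div, le_div_iff₀ ht] at h
    linarith
  have lim : Tendsto (fun s : ℝ => r (s * y) / s) atTop (𝓝 |y|) := by
    rcases lt_trichotomy y 0 with hy | hy | hy
    · have h := (hn.comp (tendsto_id.atTop_mul_const (neg_pos.2 hy))).const_mul (-y)
      rw [mul_one] at h
      rw [abs_of_neg hy]
      refine h.congr' ?_
      filter_upwards [eventually_gt_atTop 0] with s hs
      have : y ≠ 0 := hy.ne
      simp only [Function.comp, id]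
      rw [show -(s * -y) = s * y by ring]
      field_simp
    · subst hy; simp [h0]
    · have h := (hp.comp (tendsto_id.atTop_mul_const hy)).const_mul y
      rw [mul_one] at h
      rw [abs_of_pos hy]
      refine h.congr' ?_
      filter_upwards [eventually_gt_atTop 0] with s hs
      have : y ≠ 0 := hy.ne'
      simp only [Function.comp, id]
      field_simp
  apply le_antisymm
  · refine iSup₂_le fun s hs => ENNReal.ofReal_le_ofReal ?_
    refine ge_of_tendsto lim ?_
    filter_upwards [eventually_ge_atTop s] with t ht using mono s t hs ht
  · refine le_of_tendsto (ENNReal.tendsto_ofReal lim) ?_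
    filter_upwards [eventually_gt_atTop 0] with s hs
    exact le_iSup₂ (f := fun (s : ℝ) (_ : 0 < s) => ENNReal.ofReal (r (s * y) / s)) s hs

end

end SourceTransport

/-! The proof is the direct method. The work lies in bounds that are uniformly integrable in time
and in writing the energy as a supremum of weak-* continuous functionals.

Coercivity. Young's inequality gives |m| ≤ ε Φ(u,m) + u/ε; linear growth of r together with the
outer square gives |ζ_t|(D̄) ≤ ε D_δ + b(ε). Testing the equation with the constant 1 bounds all
masses through the source alone, after which |ν_t|(D̄) also obeys a bound ε D_δ + b(ε). Since ε is
arbitrary, bounded energy makes the time marginals of |ν^n| and |ζ^n| uniformly absolutely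
continuous (`UniformlyAC`). Beyond weak-* compactness this has two effects: the limits have time
marginals absolutely continuous with respect to dt, hence disintegrate, and weak-* convergence may
be tested against functions that jump in time (`tendsto_integral_indicator`).

Masses. For g of class C^1 the equation reads ∫ g dμ_t = ∫ g dμ_A + ∫_0^t (∫ ∇g·dν_s + ∫ g dζ_s) ds
(`IsWeakSolution.integral_mass_eq`). The last term pairs the space-time measures with functions cut
off by 1_{[0,t]}, so it converges for every t along one and the same subsequence. As C^1 functions
are dense in C(D̄) and masses are bounded, μ^n_t converges for every t, and the limit formula shows
that t ↦ μ_t is continuous (`exists_subseq_convergesTo`).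

Lower semicontinuity. Φ, r and r^∞ are countable suprema of affine functions. For such suprema, ∫
sup_k f_k^+ is the supremum of ∑ ∫ φ_k f_k over finite families of continuous weights φ_k ≥ 0 with ∑
φ_k ≤ 1 (`lintegral_iSup_eq`). Used in space, this recombines the Lebesgue decompositions into
pairings with the measures themselves (`exists_energyDensity_eq_iSup`). Used again in time, it
reduces the path energy to functionals that converge along the sequence and lie below its energies
(`ConvergesTo.pathEnergy_le_liminf`). -/

namespace SourceTransport
noncomputable section

/-! ### Integration against vector measures given by a density -/

section Integration

variable {X E F G : Type*} [MeasurableSpace X]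
  [NormedAddCommGroup E] [NormedSpace ℝ E] [NormedAddCommGroup F] [NormedSpace ℝ F]
  [NormedAddCommGroup G] [NormedSpace ℝ G]

instance isFiniteMeasure_variation_signed (τ : SignedMeasure X) : IsFiniteMeasure τ.variation := by
  rw [← SignedMeasure.totalVariation_eq_variation]
  unfold SignedMeasure.totalVariation
  infer_instance

/-- Since `f` is only measurable modulo the weighted measure, nothing is known about it where `h`
vanishes. Moving the factor ‖h‖ from the second argument to the first cures this, and leaves a
second argument of norm at most 1. -/
theorem integrable_pairing {l : Measure X} {h : X → F} (hh : Integrable h l)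
    (B : E →L[ℝ] F →L[ℝ] G) {f : X → E}
    (hf : Integrable f (l.withDensity fun x => ‖h x‖ₑ)) :
    Integrable (fun x => B (f x) (h x)) l := by
  have hm : AEMeasurable (fun x => ‖h x‖₊) l := hh.1.nnnorm.aemeasurable
  have hf' : Integrable (fun x => ‖h x‖₊ • f x) l :=
    (integrable_withDensity_iff_integrable_smul₀ hm).1 hf
  have key : ∀ x, B (f x) (h x) = B (‖h x‖₊ • f x) (‖h x‖⁻¹ • h x) := by
    intro x
    by_cases hx : h x = 0
    · simp [hx]
    · have : ‖h x‖ ≠ 0 := norm_ne_zero_iff.2 hx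
      rw [NNReal.smul_def, coe_nnnorm, map_smul, map_smul, _root_.smul_apply,
        smul_smul, inv_mul_cancel₀ this, one_smul]
  simp_rw [key]
  have hu : AEStronglyMeasurable (fun x => ‖h x‖⁻¹ • h x) l :=
    (hh.1.norm.aemeasurable.inv.aestronglyMeasurable).smul hh.1
  refine Integrable.mono' (hf'.norm.const_mul ‖B‖) ?_ (ae_of_all _ fun x => ?_)
  · exact B.aestronglyMeasurable_comp₂ hf'.1 hu
  · refine (B.le_opNorm₂ _ _).trans ?_
    have : ‖‖h x‖⁻¹ • h x‖ ≤ 1 := by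
      rw [norm_smul, norm_inv, norm_norm]
      exact inv_mul_le_one
    exact mul_le_of_le_one_right (by positivity) this

/-- Integration against a vector measure with a density. -/
theorem integral_withDensityᵥ [CompleteSpace F] [CompleteSpace G] {l : Measure X} {h : X → F}
    (hh : Integrable h l) (B : E →L[ℝ] F →L[ℝ] G) {f : X → E}
    (hf : (l.withDensityᵥ h).Integrable f) :
    ∫ᵛ x, f x ∂[B; l.withDensityᵥ h] = ∫ x, B (f x) (h x) ∂l := by
  have hvar := Measure.variation_withDensityᵥ hh
  have hfin : IsFiniteMeasure (l.withDensityᵥ h).variation := by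
    rw [hvar]
    exact isFiniteMeasure_withDensity hh.2.ne
  have hint : ∀ g : X → E, (l.withDensityᵥ h).Integrable g →
      Integrable (fun x => B (g x) (h x)) l := fun g hg =>
    integrable_pairing hh B (by rwa [VectorMeasure.Integrable, hvar] at hg)
  have hcongr : ∀ f g : X → E, f =ᵐ[(l.withDensityᵥ h).variation] g →
      ∫ x, B (f x) (h x) ∂l = ∫ x, B (g x) (h x) ∂l := by
    intro f g hfg
    rw [hvar] at hfg
    refine integral_congr_ae ?_
    have := (ae_withDensity_iff' hh.1.enorm).1 hfg
    filter_upwards [this] with x hx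
    by_cases h0 : h x = 0
    · simp [h0]
    · rw [hx (by simpa using h0)]
  -- Both sides are continuous for the L^1 norm of the variation measure, so indicators suffice.
  refine Integrable.induction (P := fun f => ∫ᵛ x, f x ∂[B; l.withDensityᵥ h] =
    ∫ x, B (f x) (h x) ∂l) ?_ ?_ ?_ ?_ hf
  · intro c s hs hs'
    rw [VectorMeasure.integral_indicator_const _ hs, withDensityᵥ_apply hh hs,
      ← ContinuousLinearMap.integral_comp_comm _ hh.integrableOn, ← integral_indicator hs]
    congr 1 with x
    by_cases hx : x ∈ s <;> simp [hx]
  · intro f g _ hf hg h1 h2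
    rw [VectorMeasure.integral_add hf hg, h1, h2, ← integral_add (hint f hf) (hint g hg)]
    simp
  · refine isClosed_eq VectorMeasure.continuous_integral ?_
    refine (LipschitzWith.of_dist_le_mul (K := ‖B‖₊) fun f g => ?_).continuous
    have hi := hint _ (L1.integrable_coeFn f)
    have hj := hint _ (L1.integrable_coeFn g)
    rw [dist_eq_norm, ← integral_sub hi hj, dist_eq_norm, L1.norm_eq_integral_norm]
    have hfg : Integrable (fun x => ‖f x - g x‖) (l.withDensityᵥ h).variation :=
      ((L1.integrable_coeFn f).sub (L1.integrable_coeFn g)).norm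
    have e1 : ∫ a, ‖(f - g : X →₁[(l.withDensityᵥ h).variation] E) a‖ ∂(l.withDensityᵥ h).variation
        = ∫ a, ‖f a - g a‖ ∂(l.withDensityᵥ h).variation := by
      refine integral_congr_ae ?_
      filter_upwards [Lp.coeFn_sub f g] with x hx
      rw [hx]; rfl
    rw [e1]
    have e2 : ∀ u : X → ℝ, ∫ a, u a ∂(l.withDensityᵥ h).variation = ∫ a, ‖h a‖ * u a ∂l := by
      intro u
      rw [hvar]
      exact integral_withDensity_eq_integral_smul₀ (μ := l) (f := fun x => ‖h x‖₊)
        hh.1.nnnorm.aemeasurable u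
    have e3 : ∀ u : X → ℝ, Integrable u (l.withDensityᵥ h).variation →
        Integrable (fun a => ‖h a‖ * u a) l := by
      intro u hu
      rw [hvar] at hu
      exact (integrable_withDensity_iff_integrable_smul₀ (μ := l) (f := fun x => ‖h x‖₊)
        hh.1.nnnorm.aemeasurable).1 hu
    rw [e2, ← integral_const_mul]
    refine norm_integral_le_of_norm_le ?_ (ae_of_all _ fun x => ?_)
    · exact (e3 _ hfg).const_mul _
    · rw [← _root_.sub_apply, ← map_sub]
      refine (B.le_opNorm₂ _ _).trans (le_of_eq ?_)
      simp only [coe_nnnorm]; ring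
  · intro f g hfg hf h1
    rw [← VectorMeasure.integral_congr_ae hfg, h1, hcongr f g hfg]

theorem withDensityᵥ_rnDeriv_variation (τ : SignedMeasure X) {l : Measure X} [SigmaFinite l]
    (h : τ.variation ≪ l) : l.withDensityᵥ (τ.rnDeriv l) = τ := by
  refine SignedMeasure.withDensityᵥ_rnDeriv_eq τ l ?_
  refine VectorMeasure.AbsolutelyContinuous.mk fun s hs hs0 => ?_
  rw [Measure.toENNRealVectorMeasure_apply_measurable hs] at hs0
  have := τ.enorm_measure_le_variation s
  rw [h hs0] at this
  simpa using this

end Integration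

/-! ### Coordinates of vector-valued measures -/

section Components

variable {d : ℕ} {X : Type*} [MeasurableSpace X]

/-- The `i`-th component of an `ℝ^d`-valued measure. -/
def component (ν : VectorMeasure X (Vec d)) (i : Fin d) : SignedMeasure X :=
  ν.mapRange (EuclideanSpace.proj (𝕜 := ℝ) i).toLinearMap.toAddMonoidHom
        (EuclideanSpace.proj (𝕜 := ℝ) i).continuous

theorem component_apply (ν : VectorMeasure X (Vec d)) (i : Fin d) (s : Set X) :
    component ν i s = ν s i := by
  rfl

theorem vecDensity_apply (ν : VectorMeasure X (Vec d)) (l : Measure X) (x : X) (i : Fin d) :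
    vecDensity ν l x i = (component ν i).rnDeriv l x := rfl

theorem ext_component {ν ν' : VectorMeasure X (Vec d)} (h : ∀ i, component ν i = component ν' i) :
    ν = ν' := by
  ext s hs i
  rw [← component_apply, ← component_apply, h]

theorem variation_component_le (ν : VectorMeasure X (Vec d)) (i : Fin d) :
    (component ν i).variation ≤ ν.variation := by
  refine VectorMeasure.variation_le_of_forall_enorm_le fun s _ => ?_
  refine le_trans ?_ (ν.enorm_measure_le_variation s)
  rw [component_apply, enorm_le_iff_norm_le]
  exact PiLp.norm_apply_le _ _

theorem variation_le_sum_component (ν : VectorMeasure X (Vec d)) :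
    ν.variation ≤ ∑ i, (component ν i).variation := by
  refine VectorMeasure.variation_le_of_forall_enorm_le fun s _ => ?_
  have h1 : ν s = ∑ i, EuclideanSpace.single i (ν s i) := by
    ext j
    simp [Finset.sum_apply, Pi.single_apply]
  rw [h1]
  refine (enorm_sum_le _ _).trans ?_
  rw [Measure.finsetSum_apply]
  refine Finset.sum_le_sum fun i _ => ?_
  refine le_trans (le_of_eq ?_) ((component ν i).enorm_measure_le_variation s)
  rw [component_apply, ← ofReal_norm, ← ofReal_norm, PiLp.norm_single]

instance isFiniteMeasure_variation_vec (ν : VectorMeasure X (Vec d)) :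
    IsFiniteMeasure ν.variation :=
  ⟨(Measure.le_iff'.1 (variation_le_sum_component ν) univ).trans_lt <| by
    rw [Measure.finsetSum_apply]
    exact ENNReal.sum_lt_top.2 fun i _ => measure_lt_top _ _⟩

theorem integrable_vecDensity (ν : VectorMeasure X (Vec d)) (l : Measure X) :
    Integrable (vecDensity ν l) l :=
  Integrable.of_eval_piLp fun i => SignedMeasure.integrable_rnDeriv (component ν i) l

theorem measurable_vecDensity (ν : VectorMeasure X (Vec d)) (l : Measure X) :
    Measurable (vecDensity ν l) := by
  refine (WithLp.measurable_toLp 2 _).comp (measurable_pi_lambda _ fun i => ?_)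
  exact SignedMeasure.measurable_rnDeriv _ _

theorem component_withDensityᵥ {l : Measure X} {h : X → Vec d} (hh : Integrable h l) (i : Fin d) :
    component (l.withDensityᵥ h) i = l.withDensityᵥ fun x => h x i := by
  have hi : Integrable (fun x => h x i) l :=
    (EuclideanSpace.proj (𝕜 := ℝ) i).integrable_comp hh
  ext s hs
  rw [component_apply, withDensityᵥ_apply hh hs, withDensityᵥ_apply hi hs]
  exact ((EuclideanSpace.proj (𝕜 := ℝ) i).integral_comp_comm hh.integrableOn).symm

theorem withDensityᵥ_vecDensity (ν : VectorMeasure X (Vec d)) {l : Measure X} [SigmaFinite l]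
    (h : ν.variation ≪ l) : l.withDensityᵥ (vecDensity ν l) = ν := by
  refine ext_component fun i => ?_
  rw [component_withDensityᵥ (integrable_vecDensity ν l)]
  exact withDensityᵥ_rnDeriv_variation _
    ((Measure.absolutelyContinuous_of_le (variation_component_le ν i)).trans h)

theorem integrable_component {E : Type*} [NormedAddCommGroup E] {ν : VectorMeasure X (Vec d)}
    {f : X → E} (hf : ν.Integrable f) (i : Fin d) : (component ν i).Integrable f :=
  hf.mono_measure (variation_component_le ν i)

/-- Writing `ν` as a density times its variation turns both sides into Bochner integrals, where the
coordinate projection commutes with integration. -/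
theorem integral_component {ν : VectorMeasure X (Vec d)} {f : X → ℝ} (hf : ν.Integrable f)
    (i : Fin d) : (∫ᵛ x, f x ∂•ν) i = ∫ᵛ x, f x ∂•(component ν i) := by
  set l := ν.variation with hl
  set h := vecDensity ν l with hhdef
  have hh : Integrable h l := integrable_vecDensity ν l
  have hν : l.withDensityᵥ h = ν := withDensityᵥ_vecDensity ν Measure.AbsolutelyContinuous.rfl
  have hi : Integrable (fun x => h x i) l :=
    (EuclideanSpace.proj (𝕜 := ℝ) i).integrable_comp hh
  have hf1 : (l.withDensityᵥ h).Integrable f := by rwa [hν]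
  have hf2 : (l.withDensityᵥ fun x => h x i).Integrable f := by
    rw [← component_withDensityᵥ hh, hν]; exact integrable_component hf i
  have e1 := integral_withDensityᵥ hh (ContinuousLinearMap.lsmul ℝ ℝ) hf1
  have e2 := integral_withDensityᵥ hi (ContinuousLinearMap.lsmul ℝ ℝ) hf2
  rw [← component_withDensityᵥ hh] at e2
  rw [hν] at e1 e2
  rw [e1, e2]
  have h3 : Integrable (fun x => ContinuousLinearMap.lsmul ℝ ℝ (f x) (h x)) l := by
    refine integrable_pairing hh (ContinuousLinearMap.lsmul ℝ ℝ) ?_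
    rwa [← Measure.variation_withDensityᵥ hh]
  exact ((EuclideanSpace.proj (𝕜 := ℝ) i).integral_comp_comm h3).symm

theorem integral_inner_eq_sum {ν : VectorMeasure X (Vec d)} {f : X → Vec d} (hf : ν.Integrable f) :
    ∫ᵛ x, f x ∂[innerSL ℝ; ν] = ∑ i, ∫ᵛ x, f x i ∂•(component ν i) := by
  set l := ν.variation with hl
  set h := vecDensity ν l with hhdef
  have hh : Integrable h l := integrable_vecDensity ν l
  have hν : l.withDensityᵥ h = ν := withDensityᵥ_vecDensity ν Measure.AbsolutelyContinuous.rfl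
  have hi : ∀ i, Integrable (fun x => h x i) l := fun i =>
    (EuclideanSpace.proj (𝕜 := ℝ) i).integrable_comp hh
  have hfi : ∀ i, ν.Integrable (fun x => f x i) := fun i =>
    (EuclideanSpace.proj (𝕜 := ℝ) i).integrable_comp hf
  have hf1 : (l.withDensityᵥ h).Integrable f := by rwa [hν]
  have hf2 : ∀ i, (l.withDensityᵥ fun x => h x i).Integrable fun x => f x i := fun i => by
    rw [← component_withDensityᵥ hh, hν]; exact integrable_component (hfi i) i
  have e1 := integral_withDensityᵥ hh (innerSL ℝ) hf1
  rw [hν] at e1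
  rw [e1]
  have e2 : ∀ i, ∫ᵛ x, f x i ∂•(component ν i) = ∫ x, f x i * h x i ∂l := fun i => by
    have e2 := integral_withDensityᵥ (hi i) (ContinuousLinearMap.lsmul ℝ ℝ) (hf2 i)
    rw [← component_withDensityᵥ hh, hν] at e2
    simpa using e2
  simp_rw [e2]
  rw [← integral_finsetSum]
  · refine integral_congr_ae (ae_of_all _ fun x => ?_)
    change inner ℝ (f x) (h x) = _
    rw [PiLp.inner_apply]
    exact Finset.sum_congr rfl fun i _ => mul_comm _ _
  · intro i _
    have := integrable_pairing (hi i) (ContinuousLinearMap.lsmul ℝ ℝ) (f := fun x => f x i)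
      (by rw [← Measure.variation_withDensityᵥ (hi i)]; exact hf2 i)
    simpa using this

end Components

/-! ### Running maxima of a sequence of functions -/

section RunMax

variable {X : Type*}

/-- The running maxima `max (0, f 0, …, f (N - 1))`. -/
def runMax (f : ℕ → X → ℝ) : ℕ → X → ℝ
  | 0 => fun _ => 0
  | N + 1 => fun x => max (runMax f N x) (f N x)

theorem runMax_nonneg (f : ℕ → X → ℝ) (N : ℕ) (x : X) : 0 ≤ runMax f N x := by
  induction N with
  | zero => exact le_rfl
  | succ N ih => exact ih.trans (le_max_left _ _)

theorem iSup_ofReal_runMax (f : ℕ → X → ℝ) (x : X) :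
    ⨆ N, ENNReal.ofReal (runMax f N x) = ⨆ k, ENNReal.ofReal (f k x) := by
  refine le_antisymm (iSup_le fun N => ?_) (iSup_le fun k => ?_)
  · induction N with
    | zero => simp [runMax]
    | succ N ih =>
      simp only [runMax, ENNReal.ofReal_max]
      exact max_le ih (le_iSup (fun k => ENNReal.ofReal (f k x)) N)
  · refine le_trans ?_ (le_iSup _ (k + 1))
    exact ENNReal.ofReal_le_ofReal (le_max_right _ _)

theorem measurable_runMax [MeasurableSpace X] {f : ℕ → X → ℝ} (hf : ∀ k, Measurable (f k)) (N : ℕ) :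
    Measurable (runMax f N) := by
  induction N with
  | zero => exact measurable_const
  | succ N ih => exact ih.max (hf N)

theorem integrable_runMax [MeasurableSpace X] {l : Measure X} {f : ℕ → X → ℝ} (hf : ∀ k, Integrable (f k) l) (N : ℕ) :
    Integrable (runMax f N) l := by
  induction N with
  | zero => exact integrable_zero _ _ _
  | succ N ih => exact ih.sup (hf N)

end RunMax

/-! ### Finite families of continuous weights -/

section Weights

variable {X : Type*} [TopologicalSpace X]

/-- Continuous families of `N` non-negative weights with sum at most one. -/
abbrev Weights (X : Type*) [TopologicalSpace X] (N : ℕ) : Type _ :=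
  {φ : Fin N → C(X, ℝ) // (∀ k x, 0 ≤ φ k x) ∧ ∀ x, ∑ k, φ k x ≤ 1}

instance (N : ℕ) : Nonempty (Weights X N) := ⟨⟨0, by simp⟩⟩

theorem weights_le_one {N : ℕ} (φ : Weights X N) (k : Fin N) (x : X) : φ.1 k x ≤ 1 :=
  (Finset.single_le_sum (f := fun k => φ.1 k x) (fun k _ => φ.2.1 k x) (Finset.mem_univ k)).trans
    (φ.2.2 x)

theorem sum_weights_mul_le {f : ℕ → X → ℝ} {N : ℕ} (φ : Weights X N) (x : X) :
    ENNReal.ofReal (∑ k, φ.1 k x * f k x) ≤ ⨆ k, ENNReal.ofReal (f k x) := by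
  by_cases htop : ⨆ k, ENNReal.ofReal (f k x) = ∞
  · rw [htop]; exact le_top
  refine ENNReal.ofReal_le_of_le_toReal ?_
  set s := (⨆ k, ENNReal.ofReal (f k x)).toReal
  have hs : ∀ k, f k x ≤ s := fun k =>
    (ENNReal.ofReal_le_iff_le_toReal htop).1 (le_iSup (fun k => ENNReal.ofReal (f k x)) k)
  calc ∑ k, φ.1 k x * f k x ≤ ∑ k, φ.1 k x * s :=
        Finset.sum_le_sum fun k _ => mul_le_mul_of_nonneg_left (hs k) (φ.2.1 k x)
    _ = (∑ k, φ.1 k x) * s := by rw [Finset.sum_mul]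
    _ ≤ s := mul_le_of_le_one_left ENNReal.toReal_nonneg (φ.2.2 x)

end Weights

/-! ### Integrals of suprema as suprema over continuous weights -/

section Duality

variable {X : Type*} [MetricSpace X] [MeasurableSpace X] [BorelSpace X]

theorem exists_continuous_tendsto_indicator [CompactSpace X] (l : Measure X) [IsFiniteMeasure l] {B : Set X}
    (hB : MeasurableSet B) :
    ∃ ψ : ℕ → C(X, ℝ), (∀ n x, 0 ≤ ψ n x) ∧ (∀ n x, ψ n x ≤ 1) ∧
      ∀ᵐ x ∂l, Tendsto (fun n => ψ n x) atTop (𝓝 (B.indicator 1 x)) := by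
  have hmem : MemLp (B.indicator (1 : X → ℝ)) 1 l :=
    (memLp_indicator_const 1 hB (1 : ℝ) (Or.inr (measure_ne_top _ _)))
  have hex : ∀ n : ℕ, ∃ g : BoundedContinuousFunction X ℝ,
      eLpNorm (B.indicator (1 : X → ℝ) - ⇑g) 1 l ≤ ENNReal.ofReal (1 / (n + 1)) ∧ MemLp g 1 l :=
    fun n => hmem.exists_boundedContinuous_eLpNorm_sub_le ENNReal.one_ne_top
      (by rw [Ne, ENNReal.ofReal_eq_zero, not_le]; positivity)
  choose g hg hgm using hex
  have hL : Tendsto (fun n => eLpNorm (⇑(g n) - B.indicator (1 : X → ℝ)) 1 l) atTop (𝓝 0) := by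
    have h0 : Tendsto (fun n : ℕ => ENNReal.ofReal (1 / ((n : ℝ) + 1))) atTop (𝓝 0) := by
      have := ENNReal.tendsto_ofReal (tendsto_one_div_add_atTop_nhds_zero_nat (𝕜 := ℝ))
      rwa [ENNReal.ofReal_zero] at this
    refine tendsto_of_tendsto_of_tendsto_of_le_of_le tendsto_const_nhds h0 (fun _ => zero_le)
      fun n => ?_
    rw [eLpNorm_sub_comm]
    exact hg n
  obtain ⟨ns, -, hns⟩ := (tendstoInMeasure_of_tendsto_eLpNorm one_ne_zero
    (fun n => (hgm n).1) hmem.1 hL).exists_seq_tendsto_ae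
  refine ⟨fun n => ⟨fun x => max 0 (min 1 (g (ns n) x)), by fun_prop⟩, fun n x => le_max_left _ _,
    fun n x => max_le zero_le_one (min_le_left _ _), ?_⟩
  filter_upwards [hns] with x hx
  have : Continuous fun y : ℝ => max 0 (min 1 y) := by fun_prop
  have h2 := (this.tendsto _).comp hx
  refine h2.trans (le_of_eq ?_)
  by_cases hxB : x ∈ B <;> simp [hxB]

/-- The ideal weights are indicators selecting the index that realises the maximum, and no index
where the maximum is 0. Inductively, the new index receives a continuous approximation ψ of the
indicator of {f_N > max of the previous ones}, and the old weights are multiplied by 1 - ψ, which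
keeps the sum at most 1. -/
theorem exists_weights_tendsto_runMax [CompactSpace X] (l : Measure X) [IsFiniteMeasure l]
    {f : ℕ → X → ℝ}
    (hf : ∀ k, Measurable (f k)) (N : ℕ) :
    ∃ φ : ℕ → Weights X N, ∀ᵐ x ∂l,
      Tendsto (fun j => ∑ k, (φ j).1 k x * f k x) atTop (𝓝 (runMax f N x)) := by
  induction N with
  | zero => exact ⟨fun _ => ⟨0, by simp⟩, ae_of_all _ fun x => by simp [runMax]⟩
  | succ N ih =>
    obtain ⟨φ, hφ⟩ := ih
    obtain ⟨ψ, hψ0, hψ1, hψ⟩ := exists_continuous_tendsto_indicator l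
      (measurableSet_lt (measurable_runMax hf N) (hf N))
    have hsum : ∀ (j : ℕ) (x : X) (u : ℕ → ℝ),
        ∑ k : Fin (N + 1), (Fin.snoc (α := fun _ => C(X, ℝ))
          (fun k => (1 - ψ j) * (φ j).1 k) (ψ j) k) x * u k =
        (1 - ψ j x) * ∑ k : Fin N, (φ j).1 k x * u k + ψ j x * u N := by
      intro j x u
      rw [Fin.sum_univ_castSucc, Finset.mul_sum]
      simp [mul_assoc]
    refine ⟨fun j => ⟨Fin.snoc (α := fun _ => C(X, ℝ)) (fun k => (1 - ψ j) * (φ j).1 k) (ψ j),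
      fun k x => ?_, fun x => ?_⟩, ?_⟩
    · induction k using Fin.lastCases with
      | last => simpa using hψ0 j x
      | cast k =>
        simp only [Fin.snoc_castSucc]
        exact mul_nonneg (by simpa using hψ1 j x) ((φ j).2.1 k x)
    · have := hsum j x fun _ => 1
      simp only [mul_one] at this
      rw [this]
      have h1 := (φ j).2.2 x
      nlinarith [hψ1 j x, hψ0 j x]
    · filter_upwards [hφ, hψ] with x hx hx'
      rw [show (fun j => ∑ k : Fin (N + 1), (Fin.snoc (α := fun _ => C(X, ℝ))
          (fun k => (1 - ψ j) * (φ j).1 k) (ψ j) k) x * f k x) = _ from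
          funext fun j => hsum j x fun k => f k x]
      have := ((tendsto_const_nhds (x := (1 : ℝ))).sub hx').mul hx |>.add (hx'.mul_const (f N x))
      refine this.trans (le_of_eq ?_)
      by_cases hxA : runMax f N x < f N x
      · simp [runMax, hxA, hxA.le]
      · simp [runMax, hxA, not_lt.1 hxA]

theorem integrable_continuousMap_mul [CompactSpace X] {l : Measure X} {f : X → ℝ}
    (hf : Integrable f l) (φ : C(X, ℝ)) : Integrable (fun x => φ x * f x) l :=
  hf.bdd_mul φ.continuous.measurable.aestronglyMeasurable
    (ae_of_all _ fun x => φ.norm_coe_le_norm x)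

/-- Monotone convergence reduces the supremum to the running maxima, and dominated convergence
replaces each of these by continuously weighted sums. -/
theorem lintegral_iSup_le_of_weights [CompactSpace X] {l : Measure X} [IsFiniteMeasure l]
    {f : ℕ → X → ℝ} (hfm : ∀ k, Measurable (f k)) (hf : ∀ k, Integrable (f k) l) {M : ℝ≥0∞}
    (H : ∀ (N : ℕ) (φ : Weights X N), ENNReal.ofReal (∑ k, ∫ x, φ.1 k x * f k x ∂l) ≤ M) :
    ∫⁻ x, ⨆ k, ENNReal.ofReal (f k x) ∂l ≤ M := by
  rw [show (fun x => ⨆ k, ENNReal.ofReal (f k x)) = _ from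
    funext fun x => (iSup_ofReal_runMax f x).symm]
  rw [lintegral_iSup (fun N => (measurable_runMax hfm N).ennreal_ofReal)
    (monotone_nat_of_le_succ fun N x => ENNReal.ofReal_le_ofReal (le_max_left _ _))]
  refine iSup_le fun N => ?_
  rw [← ofReal_integral_eq_lintegral_ofReal (integrable_runMax hf N)
    (ae_of_all _ fun x => runMax_nonneg f N x)]
  obtain ⟨φ, hφ⟩ := exists_weights_tendsto_runMax l hfm N
  have hlim : Tendsto (fun j => ∫ x, ∑ k, (φ j).1 k x * f k x ∂l) atTop
      (𝓝 (∫ x, runMax f N x ∂l)) := by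
    refine tendsto_integral_of_dominated_convergence (fun x => ∑ k : Fin N, |f k x|) ?_ ?_ ?_ hφ
    · intro j
      exact (integrable_finsetSum Finset.univ fun (k : Fin N) _ =>
        integrable_continuousMap_mul (hf k) ((φ j).1 k)).1
    · exact integrable_finsetSum _ fun k _ => (hf k).abs
    · refine fun j => ae_of_all _ fun x => (norm_sum_le _ _).trans
        (Finset.sum_le_sum fun k _ => ?_)
      rw [norm_mul, Real.norm_eq_abs, Real.norm_eq_abs, abs_of_nonneg ((φ j).2.1 k x)]
      exact mul_le_of_le_one_left (abs_nonneg _) (weights_le_one _ _ _)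
  refine le_of_tendsto (ENNReal.tendsto_ofReal hlim) (Eventually.of_forall fun j => ?_)
  rw [integral_finsetSum _ fun (k : Fin N) _ =>
    integrable_continuousMap_mul (hf k) ((φ j).1 k)]
  exact H N (φ j)

theorem ofReal_integral_le_lintegral {Y : Type*} [MeasurableSpace Y] {l : Measure Y} (f : Y → ℝ) :
    ENNReal.ofReal (∫ x, f x ∂l) ≤ ∫⁻ x, ENNReal.ofReal (f x) ∂l := by
  by_cases hf : Integrable f l
  · calc ENNReal.ofReal (∫ x, f x ∂l) ≤ ENNReal.ofReal (∫ x, max (f x) 0 ∂l) :=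
          ENNReal.ofReal_le_ofReal (integral_mono hf hf.pos_part fun x => le_max_left _ _)
      _ = ∫⁻ x, ENNReal.ofReal (max (f x) 0) ∂l :=
          ofReal_integral_eq_lintegral_ofReal hf.pos_part (ae_of_all _ fun x => le_max_right _ _)
      _ = _ := by simp
  · simp [integral_undef hf]

theorem sum_integral_weights_le [CompactSpace X] {l : Measure X} {f : ℕ → X → ℝ}
    (hf : ∀ k, Integrable (f k) l) {N : ℕ} (φ : Weights X N) :
    ENNReal.ofReal (∑ k, ∫ x, φ.1 k x * f k x ∂l) ≤ ∫⁻ x, ⨆ k, ENNReal.ofReal (f k x) ∂l := by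
  rw [← integral_finsetSum _ fun (k : Fin N) _ =>
    integrable_continuousMap_mul (hf k) (φ.1 k)]
  exact (ofReal_integral_le_lintegral _).trans (lintegral_mono fun x => sum_weights_mul_le φ x)

theorem continuous_integral_mul [CompactSpace X] {l : Measure X} {f : X → ℝ}
    (hf : Integrable f l) : Continuous fun φ : C(X, ℝ) => ∫ x, φ x * f x ∂l := by
  refine (LipschitzWith.of_dist_le_mul (K := (∫ x, |f x| ∂l).toNNReal) fun φ ψ => ?_).continuous
  rw [dist_eq_norm, ← integral_sub (integrable_continuousMap_mul hf _)
    (integrable_continuousMap_mul hf _), Real.coe_toNNReal _ (integral_nonneg fun _ => abs_nonneg _),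
    mul_comm, ← integral_const_mul]
  refine norm_integral_le_of_norm_le (hf.abs.const_mul _) (ae_of_all _ fun x => ?_)
  rw [← sub_mul, norm_mul]
  refine mul_le_mul_of_nonneg_right ?_ (norm_nonneg _)
  rw [← dist_eq_norm]
  exact ContinuousMap.dist_apply_le_dist x

/-- A countable dense sequence of weights. -/
def denseWeights (X : Type*) [MetricSpace X] [CompactSpace X] (N j : ℕ) : Weights X N :=
  TopologicalSpace.denseSeq (Weights X N) j

/-- A dense sequence of weights suffices because the pairing is continuous in the weights.
Countability matters: the resulting functionals, indexed by time, form the sequence to which the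
duality is applied a second time. -/
theorem lintegral_iSup_eq [CompactSpace X] {l : Measure X} [IsFiniteMeasure l]
    {f : ℕ → X → ℝ} (hfm : ∀ k, Measurable (f k)) (hf : ∀ k, Integrable (f k) l) :
    ∫⁻ x, ⨆ k, ENNReal.ofReal (f k x) ∂l =
      ⨆ N, ⨆ j, ENNReal.ofReal (∑ k, ∫ x, (denseWeights X N j).1 k x * f k x ∂l) := by
  refine le_antisymm (lintegral_iSup_le_of_weights hfm hf fun N φ => ?_)
    (iSup₂_le fun N j => sum_integral_weights_le hf _)
  have hc : Continuous fun φ : Weights X N =>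
      ENNReal.ofReal (∑ k, ∫ x, φ.1 k x * f k x ∂l) := by
    refine ENNReal.continuous_ofReal.comp (continuous_finsetSum _ fun k _ => ?_)
    exact (continuous_integral_mul (hf k)).comp
      ((continuous_apply k).comp continuous_subtype_val)
  refine (isClosed_le hc continuous_const).closure_subset_iff.2 ?_
    ((TopologicalSpace.denseRange_denseSeq (Weights X N)) φ)
  rintro _ ⟨j, rfl⟩
  exact le_iSup₂ (f := fun N j => ENNReal.ofReal
    (∑ k, ∫ x, (denseWeights X N j).1 k x * f k x ∂l)) N j

/-- Mutual singularity allows `f` and `g` to be glued into one family integrated against `l + p`, so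
the same continuous weights serve both integrals. -/
theorem lintegral_iSup_add_eq [CompactSpace X] {l p : Measure X} [IsFiniteMeasure l]
    [IsFiniteMeasure p] (hlp : p ⟂ₘ l)
    {f g : ℕ → X → ℝ} (hfm : ∀ k, Measurable (f k)) (hf : ∀ k, Integrable (f k) l)
    (hgm : ∀ k, Measurable (g k)) (hg : ∀ k, Integrable (g k) p) :
    ∫⁻ x, ⨆ k, ENNReal.ofReal (f k x) ∂l + ∫⁻ x, ⨆ k, ENNReal.ofReal (g k x) ∂p =
      ⨆ N, ⨆ j, ENNReal.ofReal (∑ k, (∫ x, (denseWeights X N j).1 k x * f k x ∂l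
        + ∫ x, (denseWeights X N j).1 k x * g k x ∂p)) := by
  classical
  obtain ⟨s, hs, hps, hls⟩ := hlp
  set h : ℕ → X → ℝ := fun k => s.piecewise (f k) (g k) with hh
  have hal : ∀ᵐ x ∂l, x ∈ s := by
    rw [ae_iff]; exact hls
  have hap : ∀ᵐ x ∂p, x ∉ s := by
    rw [ae_iff]; simpa using hps
  have hfl : ∀ k, h k =ᵐ[l] f k := fun k => by
    filter_upwards [hal] with x hx using by simp [hh, hx]
  have hgp : ∀ k, h k =ᵐ[p] g k := fun k => by
    filter_upwards [hap] with x hx using by simp [hh, hx]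
  have hm : ∀ k, Measurable (h k) := fun k => (hfm k).piecewise hs (hgm k)
  have hhl : ∀ k, Integrable (h k) l := fun k => (hf k).congr (hfl k).symm
  have hhp : ∀ k, Integrable (h k) p := fun k => (hg k).congr (hgp k).symm
  have key := lintegral_iSup_eq (l := l + p) hm fun k => (hhl k).add_measure (hhp k)
  rw [lintegral_add_measure] at key
  have e1 : ∫⁻ x, ⨆ k, ENNReal.ofReal (h k x) ∂l = ∫⁻ x, ⨆ k, ENNReal.ofReal (f k x) ∂l :=
    lintegral_congr_ae (by filter_upwards [hal] with x hx using by simp [hh, hx])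
  have e2 : ∫⁻ x, ⨆ k, ENNReal.ofReal (h k x) ∂p = ∫⁻ x, ⨆ k, ENNReal.ofReal (g k x) ∂p :=
    lintegral_congr_ae (by filter_upwards [hap] with x hx using by simp [hh, hx])
  rw [e1, e2] at key
  rw [key]
  congr! 6 with N j k
  rw [integral_add_measure (integrable_continuousMap_mul (hhl _) _)
    (integrable_continuousMap_mul (hhp _) _)]
  congr 1
  · exact integral_congr_ae (by filter_upwards [hfl k] with x hx using by rw [hx])
  · exact integral_congr_ae (by filter_upwards [hgp k] with x hx using by rw [hx])

end Duality

/-! ### The integrands as countable suprema of affine functions -/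

section Integrands

theorem le_iSup_of_denseRange {Y ι : Type*} [TopologicalSpace Y] {e : ι → Y} (he : DenseRange e)
    {F : Y → ℝ≥0∞} (hF : Continuous F) (y : Y) : F y ≤ ⨆ k, F (e k) := by
  refine (isClosed_le hF continuous_const).closure_subset_iff.2 ?_ (he y)
  rintro _ ⟨k, rfl⟩
  exact le_iSup (fun k => F (e k)) k

theorem two_inner_sub_le {d : ℕ} {u : ℝ} (hu : 0 < u) (b m : Vec d) :
    2 * inner ℝ b m - ‖b‖ ^ 2 * u ≤ ‖m‖ ^ 2 / u := by
  rw [le_div_iff₀ hu]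
  have h := norm_sub_sq_real m (u • b)
  rw [inner_smul_right, norm_smul, Real.norm_eq_abs, abs_of_pos hu, real_inner_comm] at h
  nlinarith [sq_nonneg ‖m - u • b‖]

/-- The transport integrand is a supremum of countably many linear functions. -/
theorem Phi_eq_iSup {d : ℕ} {u : ℝ} (hu : 0 ≤ u) (m : Vec d) :
    Phi u m = ⨆ k : ℕ, ENNReal.ofReal (2 * inner ℝ (TopologicalSpace.denseSeq (Vec d) k) m
      - ‖TopologicalSpace.denseSeq (Vec d) k‖ ^ 2 * u) := by
  have hd := TopologicalSpace.denseRange_denseSeq (Vec d)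
  have hF : Continuous fun b : Vec d => ENNReal.ofReal (2 * inner ℝ b m - ‖b‖ ^ 2 * u) :=
    ENNReal.continuous_ofReal.comp (by fun_prop)
  have hle := le_iSup_of_denseRange hd hF
  unfold Phi
  split_ifs with h1 h2
  · refine le_antisymm ?_ (iSup_le fun k => ENNReal.ofReal_le_ofReal (two_inner_sub_le h1 _ _))
    -- The maximiser of b ↦ 2⟨b, m⟩ - |b|² u is b = m / u.
    refine le_trans (ENNReal.ofReal_le_ofReal (le_of_eq ?_)) (hle (u⁻¹ • m))
    rw [real_inner_smul_left, real_inner_self_eq_norm_sq, norm_smul, Real.norm_eq_abs,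
      abs_of_pos (inv_pos.2 h1)]
    field_simp
    ring
  · obtain ⟨rfl, rfl⟩ := h2
    simp
  · have h0 : u = 0 := le_antisymm (not_lt.1 h1) hu
    have hm : m ≠ 0 := fun h => h2 ⟨h0, h⟩
    subst h0
    symm
    refine ENNReal.eq_top_of_forall_nnreal_le fun c => ?_
    -- With u = 0 the functional is linear in b, and this choice gives it the value 2c.
    refine le_trans ?_ (hle (((c : ℝ) / ‖m‖ ^ 2) • m))
    have hm' : ‖m‖ ^ 2 ≠ 0 := by positivity
    rw [real_inner_smul_left, real_inner_self_eq_norm_sq, div_mul_cancel₀ _ hm', mul_zero,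
      sub_zero, ← ENNReal.ofReal_coe_nnreal]
    exact ENNReal.ofReal_le_ofReal (by linarith [c.coe_nonneg])

theorem IsSourcePenalty.continuous {r : ℝ → ℝ} (hr : IsSourcePenalty r) : Continuous r :=
  continuousOn_univ.1 (hr.convex.continuousOn isOpen_univ)

/-- A source penalty and its recession function are suprema of countable families of affine
functions and their linear parts. -/
theorem IsSourcePenalty.exists_affine {r : ℝ → ℝ} (hr : IsSourcePenalty r) :
    ∃ p q : ℕ → ℝ, (∀ s, ENNReal.ofReal (r s) = ⨆ k, ENNReal.ofReal (p k * s - q k)) ∧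
      ∀ y, recession r y = ⨆ k, ENNReal.ofReal (p k * y) := by
  obtain ⟨L, c, hle, hsup⟩ := hr.convex.univ_sSup_of_nat_affine_eq (𝕜 := ℝ)
    hr.continuous.lowerSemicontinuous
  have hL : ∀ i s, L i s = L i 1 * s := fun i s => by
    rw [mul_comm, ← smul_eq_mul, ← map_smul, smul_eq_mul, mul_one]
  have hle' : ∀ k s, L k 1 * s - -c k ≤ r s := fun k s => by
    have := hle k s
    simp only [Pi.add_apply, Function.comp, Function.const] at this
    rw [← hL, sub_neg_eq_add]
    exact this
  -- The normalisation r(0) = 0 forces non-positive intercepts; dropping them bounds r(sy)/s by the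
  -- supremum of the slopes times y.
  have hq : ∀ k, 0 ≤ -c k := fun k => by
    have := hle' k 0
    rw [hr.zero] at this
    linarith
  have hr1 : ∀ s, ENNReal.ofReal (r s) = ⨆ k, ENNReal.ofReal (L k 1 * s - -c k) := by
    intro s
    have h1 : r s = ⨆ k, (L k 1 * s - -c k) := by
      have := congrFun hsup s
      rw [iSup_apply] at this
      rw [← this]
      congr 1 with k
      simp only [Pi.add_apply, Function.comp, Function.const]
      rw [hL, sub_neg_eq_add]
      rfl
    have hb : BddAbove (range fun k => L k 1 * s - -c k) := by
      refine ⟨r s, ?_⟩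
      rintro _ ⟨k, rfl⟩
      exact hle' k s
    rw [h1]
    exact Monotone.map_ciSup_of_continuousAt ENNReal.continuous_ofReal.continuousAt
      (fun a b => ENNReal.ofReal_le_ofReal) hb
  refine ⟨fun k => L k 1, fun k => -c k, hr1, fun y => le_antisymm ?_ (iSup_le fun k => ?_)⟩
  · refine iSup₂_le fun s hs => ?_
    rw [ENNReal.ofReal_div_of_pos hs, hr1]
    refine ENNReal.div_le_of_le_mul (iSup_le fun k => ?_)
    calc ENNReal.ofReal (L k 1 * (s * y) - -c k)
        ≤ ENNReal.ofReal (L k 1 * y * s) :=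
          ENNReal.ofReal_le_ofReal (by nlinarith [hq k])
      _ = ENNReal.ofReal (L k 1 * y) * ENNReal.ofReal s := ENNReal.ofReal_mul' hs.le
      _ ≤ _ := by
          gcongr
          exact le_iSup (fun k => ENNReal.ofReal (L k 1 * y)) k
  -- Conversely, each affine minorant evaluated at sy and divided by s loses its intercept as s → ∞.
  · have hlim : Tendsto (fun s : ℝ => L k 1 * y - -c k / s) atTop (𝓝 (L k 1 * y - 0)) :=
      tendsto_const_nhds.sub (tendsto_const_nhds.div_atTop tendsto_id)
    rw [sub_zero] at hlim
    refine le_of_tendsto (ENNReal.tendsto_ofReal hlim) ?_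
    filter_upwards [eventually_gt_atTop 0] with s hs
    refine le_trans (ENNReal.ofReal_le_ofReal ?_)
      (le_iSup₂ (f := fun (s : ℝ) (_ : 0 < s) => ENNReal.ofReal (r (s * y) / s)) s hs)
    rw [le_div_iff₀ hs, sub_mul, div_mul_cancel₀ _ hs.ne']
    have := hle' k (s * y)
    linarith

end Integrands

/-! ### Lebesgue decompositions of the three measures -/

section Decompositions

variable {d : ℕ} {X : Type*} [MeasurableSpace X]

theorem mutuallySingular_singularPart_variation (τ : SignedMeasure X) (l : Measure X) :
    (τ.singularPart l).variation ⟂ₘ l := by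
  rw [← SignedMeasure.totalVariation_eq_variation, SignedMeasure.singularPart_totalVariation]
  exact (Measure.mutuallySingular_singularPart _ _).add_left
    (Measure.mutuallySingular_singularPart _ _)

theorem component_vecSingularPart (ν : VectorMeasure X (Vec d)) (l : Measure X) [SigmaFinite l]
    (i : Fin d) : component (vecSingularPart ν l) i = (component ν i).singularPart l := by
  have h := (component ν i).singularPart_add_withDensity_rnDeriv_eq l
  have h2 : component (vecSingularPart ν l) i =
      component ν i - component (l.withDensityᵥ (vecDensity ν l)) i := by
    ext s hs
    simp [component_apply, vecSingularPart]
  rw [h2, component_withDensityᵥ (integrable_vecDensity ν l)]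
  exact sub_eq_of_eq_add h.symm

theorem mutuallySingular_vecSingularPart (ν : VectorMeasure X (Vec d)) (l : Measure X)
    [SigmaFinite l] : (vecSingularPart ν l).variation ⟂ₘ l := by
  refine Measure.MutuallySingular.mono ?_ (variation_le_sum_component _) le_rfl
  rw [← Measure.sum_fintype, Measure.MutuallySingular.sum_left]
  intro i
  rw [component_vecSingularPart]
  exact mutuallySingular_singularPart_variation _ _

variable (l : Measure X) (μ : FiniteMeasure X) (ν : VectorMeasure X (Vec d)) (ζ : SignedMeasure X)

instance isFiniteMeasure_perp : IsFiniteMeasure (perp l μ ν ζ) := by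
  unfold perp; infer_instance

theorem mutuallySingular_perp [SigmaFinite l] : perp l μ ν ζ ⟂ₘ l :=
  ((Measure.mutuallySingular_singularPart _ _).add_left
    (mutuallySingular_vecSingularPart ν l)).add_left (mutuallySingular_singularPart_variation ζ l)

theorem singularPart_mass_le_perp : (μ : Measure X).singularPart l ≤ perp l μ ν ζ := by
  unfold perp
  rw [add_assoc]
  exact Measure.le_add_right le_rfl

theorem variation_vecSingularPart_le_perp : (vecSingularPart ν l).variation ≤ perp l μ ν ζ := by
  unfold perp
  rw [add_right_comm]
  exact Measure.le_add_left le_rfl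

theorem variation_singularPart_le_perp : (ζ.singularPart l).variation ≤ perp l μ ν ζ := by
  unfold perp
  exact Measure.le_add_left le_rfl

end Decompositions

/-! ### Recombining the decompositions into pairings -/

section Pairings

variable {d : ℕ} {X : Type*} [MeasurableSpace X]

theorem integral_lsmul_withDensityᵥ {l : Measure X} {z φ : X → ℝ} (hz : Integrable z l)
    (hφ : (l.withDensityᵥ z).Integrable φ) :
    ∫ᵛ x, φ x ∂•(l.withDensityᵥ z) = ∫ x, φ x * z x ∂l := by
  simpa using integral_withDensityᵥ hz (ContinuousLinearMap.lsmul ℝ ℝ) hφ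

theorem integrable_of_measurable_bounded {E : Type*} [NormedAddCommGroup E] {l : Measure X}
    [IsFiniteMeasure l] {f : X → E} (hf : StronglyMeasurable f) {C : ℝ} (hC : ∀ x, ‖f x‖ ≤ C) :
    Integrable f l :=
  Integrable.of_bound hf.aestronglyMeasurable C (ae_of_all _ hC)

/-- Any finite `p` dominating the singular part will do, so the right-hand side forgets both the
decomposition and the choice of `p`. This is how the dual functionals become weak-* continuous. -/
theorem integral_source_decomposition (τ : SignedMeasure X) {l p : Measure X} [IsFiniteMeasure l]
    [IsFiniteMeasure p] (h : (τ.singularPart l).variation ≤ p) {φ : X → ℝ} (hφ : Measurable φ)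
    {C : ℝ} (hC : ∀ x, ‖φ x‖ ≤ C) :
    ∫ x, φ x * τ.rnDeriv l x ∂l + ∫ x, φ x * (τ.singularPart l).rnDeriv p x ∂p =
      ∫ᵛ x, φ x ∂•τ := by
  have hb : ∀ τ : SignedMeasure X, τ.Integrable φ := fun τ =>
    integrable_of_measurable_bounded hφ.stronglyMeasurable hC
  rw [← integral_lsmul_withDensityᵥ (SignedMeasure.integrable_rnDeriv _ _) (hb _),
    ← integral_lsmul_withDensityᵥ (SignedMeasure.integrable_rnDeriv _ _) (hb _),
    withDensityᵥ_rnDeriv_variation (τ.singularPart l) (Measure.absolutelyContinuous_of_le h),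
    ← VectorMeasure.integral_add_vectorMeasure (hb _) (hb _), add_comm,
    SignedMeasure.singularPart_add_withDensity_rnDeriv_eq]

theorem integral_mass_decomposition (μ : Measure X) {l p : Measure X} [IsFiniteMeasure μ]
    [IsFiniteMeasure l] [IsFiniteMeasure p] (h : μ.singularPart l ≤ p) {φ : X → ℝ}
    (hφ : Measurable φ) {C : ℝ} (hC : ∀ x, ‖φ x‖ ≤ C) :
    ∫ x, φ x * (μ.rnDeriv l x).toReal ∂l + ∫ x, φ x * ((μ.singularPart l).rnDeriv p x).toReal ∂p =
      ∫ x, φ x ∂μ := by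
  have hb : ∀ μ : Measure X, IsFiniteMeasure μ → Integrable φ μ := fun μ _ =>
    integrable_of_measurable_bounded hφ.stronglyMeasurable hC
  have e1 : ∫ x, φ x * (μ.rnDeriv l x).toReal ∂l = ∫ x, φ x ∂(l.withDensity (μ.rnDeriv l)) := by
    rw [integral_withDensity_eq_integral_toReal_smul (Measure.measurable_rnDeriv _ _)
      (Measure.rnDeriv_lt_top _ _)]
    simp [mul_comm]
  have e2 : ∫ x, φ x * ((μ.singularPart l).rnDeriv p x).toReal ∂p =
      ∫ x, φ x ∂(μ.singularPart l) := by
    rw [← integral_rnDeriv_smul (Measure.absolutelyContinuous_of_le h)]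
    simp [mul_comm]
  rw [e1, e2, ← integral_add_measure (hb _ inferInstance) (hb _ inferInstance), add_comm,
    Measure.singularPart_add_rnDeriv]

theorem integral_momentum_decomposition (ν : VectorMeasure X (Vec d)) {l p : Measure X}
    [IsFiniteMeasure l] [IsFiniteMeasure p] (h : (vecSingularPart ν l).variation ≤ p) {φ : X → ℝ}
    (hφ : Measurable φ) {C : ℝ} (hC : ∀ x, ‖φ x‖ ≤ C) (b : Vec d) :
    ∫ x, φ x * inner ℝ b (vecDensity ν l x) ∂l
      + ∫ x, φ x * inner ℝ b (vecDensity (vecSingularPart ν l) p x) ∂p =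
      ∫ᵛ x, φ x • b ∂[innerSL ℝ; ν] := by
  have hint : ν.Integrable fun x => φ x • b :=
    integrable_of_measurable_bounded (C := C * ‖b‖) (hφ.stronglyMeasurable.smul_const b) fun x => by
      rw [norm_smul]; exact mul_le_mul_of_nonneg_right (hC x) (norm_nonneg _)
  have hsum : ∀ (l : Measure X) (v : X → Vec d), Integrable v l →
      ∫ x, φ x * inner ℝ b (v x) ∂l = ∑ i, b i * ∫ x, φ x * v x i ∂l := by
    intro l v hv
    have hv' : ∀ i, Integrable (fun x => b i * (φ x * v x i)) l := fun i =>
      (((EuclideanSpace.proj (𝕜 := ℝ) i).integrable_comp hv).bdd_mul hφ.aestronglyMeasurable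
        (ae_of_all _ hC)).const_mul _
    simp_rw [← integral_const_mul]
    rw [← integral_finsetSum _ fun i _ => hv' i]
    refine integral_congr_ae (ae_of_all _ fun x => ?_)
    simp only [PiLp.inner_apply, Finset.mul_sum, RCLike.inner_apply, conj_trivial]
    exact Finset.sum_congr rfl fun i _ => by ring
  rw [hsum _ _ (integrable_vecDensity _ _), hsum _ _ (integrable_vecDensity _ _),
    integral_inner_eq_sum hint, ← Finset.sum_add_distrib]
  refine Finset.sum_congr rfl fun i _ => ?_
  have h' : ((component ν i).singularPart l).variation ≤ p := by
    rw [← component_vecSingularPart]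
    exact (variation_component_le _ i).trans h
  have key := integral_source_decomposition (component ν i) h' hφ hC
  simp only [vecDensity_apply, component_vecSingularPart]
  rw [← mul_add, key]
  have := VectorMeasure.integral_fun_smul (component ν i) (ContinuousLinearMap.lsmul ℝ ℝ) (b i) φ
  rw [smul_eq_mul] at this
  rw [← this]
  simp [mul_comm]

end Pairings

/-! ### The energy density as a supremum of weak-* continuous affine functionals -/

section StaticDuality

variable {d : ℕ} {X : Type*} [MetricSpace X] [CompactSpace X] [MeasurableSpace X] [BorelSpace X]

theorem integrable_continuousMap {E : Type*} [NormedAddCommGroup E] {l : Measure X}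
    [IsFiniteMeasure l] [SecondCountableTopologyEither X E] (f : C(X, E)) : Integrable f l :=
  Integrable.of_bound f.continuous.aestronglyMeasurable ‖f‖ (ae_of_all _ f.norm_coe_le_norm)

/-- Duality in space, applied to the linear functions (u, m) ↦ 2⟨e_k, m⟩ - |e_k|² u with (e_k)
dense. The index (0,0) has no weights and gives the zero functional, which is needed later to add
two suprema. -/
theorem exists_transportAction_eq_iSup (d : ℕ) (l : Measure X) [IsFiniteMeasure l] :
    ∃ (b : ℕ × ℕ → C(X, Vec d)) (a : ℕ × ℕ → C(X, ℝ)),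
      (∃ i, b i = 0 ∧ a i = 0) ∧
      ∀ (μ : FiniteMeasure X) (ν : VectorMeasure X (Vec d)) (ζ : SignedMeasure X),
        transportAction l μ ν ζ =
          ⨆ i, ENNReal.ofReal (∫ᵛ x, b i x ∂[innerSL ℝ; ν] - ∫ x, a i x ∂(μ : Measure X)) := by
  set e := TopologicalSpace.denseSeq (Vec d) with he
  refine ⟨fun i => ∑ k : Fin i.1, (denseWeights X i.1 i.2).1 k • (ContinuousMap.const X ((2 : ℝ) • e k)),
    fun i => ∑ k : Fin i.1, ‖e k‖ ^ 2 • (denseWeights X i.1 i.2).1 k, ⟨(0, 0), by simp, by simp⟩, ?_⟩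
  intro μ ν ζ
  set p := perp l μ ν ζ with hp
  set f : ℕ → X → ℝ := fun k x => 2 * inner ℝ (e k) (vecDensity ν l x)
    - ‖e k‖ ^ 2 * ((μ : Measure X).rnDeriv l x).toReal with hf
  set g : ℕ → X → ℝ := fun k x => 2 * inner ℝ (e k) (vecDensity (vecSingularPart ν l) p x)
    - ‖e k‖ ^ 2 * (((μ : Measure X).singularPart l).rnDeriv p x).toReal with hg
  have hintv : ∀ (l : Measure X) (v : X → Vec d), Integrable v l → ∀ k,
      Integrable (fun x => 2 * inner ℝ (e k) (v x)) l := fun l v hv k =>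
    ((innerSL ℝ (e k)).integrable_comp hv).const_mul 2
  have hmv : ∀ (v : X → Vec d), Measurable v → ∀ k,
      Measurable (fun x => 2 * inner ℝ (e k) (v x)) := fun v hv k =>
    ((innerSL ℝ (e k)).continuous.measurable.comp hv).const_mul 2
  have hfi1 := fun k => hintv l _ (integrable_vecDensity ν l) k
  have hgi1 := fun k => hintv p _ (integrable_vecDensity (vecSingularPart ν l) p) k
  have hfi2 : ∀ k, Integrable (fun x => ‖e k‖ ^ 2 * ((μ : Measure X).rnDeriv l x).toReal) l :=
    fun k => Measure.integrable_toReal_rnDeriv.const_mul _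
  have hgi2 : ∀ k, Integrable
      (fun x => ‖e k‖ ^ 2 * (((μ : Measure X).singularPart l).rnDeriv p x).toReal) p :=
    fun k => Measure.integrable_toReal_rnDeriv.const_mul _
  have hfm : ∀ k, Measurable (f k) := fun k => (hmv _ (measurable_vecDensity _ _) k).sub
    ((Measure.measurable_rnDeriv _ _).ennreal_toReal.const_mul _)
  have hgm : ∀ k, Measurable (g k) := fun k => (hmv _ (measurable_vecDensity _ _) k).sub
    ((Measure.measurable_rnDeriv _ _).ennreal_toReal.const_mul _)
  have key := lintegral_iSup_add_eq (mutuallySingular_perp l μ ν ζ) hfm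
    (fun k => (hfi1 k).sub (hfi2 k)) hgm (fun k => (hgi1 k).sub (hgi2 k))
  unfold transportAction
  simp_rw [fun x => Phi_eq_iSup (d := d) (u := ((μ : Measure X).rnDeriv l x).toReal)
    ENNReal.toReal_nonneg (vecDensity ν l x), fun x => Phi_eq_iSup (d := d)
    (u := (((μ : Measure X).singularPart l).rnDeriv (perp l μ ν ζ) x).toReal)
    ENNReal.toReal_nonneg (vecDensity (vecSingularPart ν l) (perp l μ ν ζ) x)]
  rw [key, iSup_prod]
  congr! 5 with N j
  set φ := denseWeights X N j
  have hφ : ∀ k x, ‖φ.1 k x‖ ≤ ‖φ.1 k‖ := fun k x => (φ.1 k).norm_coe_le_norm x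
  have hν : ∀ k : Fin N, ν.Integrable fun x => φ.1 k x • ((2 : ℝ) • e k) := fun k =>
    integrable_continuousMap (φ.1 k • ContinuousMap.const X ((2 : ℝ) • e k))
  have hμ : ∀ k : Fin N, Integrable (fun x => ‖e k‖ ^ 2 * φ.1 k x) (μ : Measure X) := fun k =>
    (integrable_continuousMap (φ.1 k)).const_mul _
  have e1 : ∫ᵛ x, (∑ k : Fin N, φ.1 k • ContinuousMap.const X ((2 : ℝ) • e k)) x ∂[innerSL ℝ; ν]
      = ∑ k : Fin N, ∫ᵛ x, φ.1 k x • ((2 : ℝ) • e k) ∂[innerSL ℝ; ν] := by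
    rw [← VectorMeasure.integral_finsetSum _ fun k _ => hν k]
    congr 1 with x
    simp
  have e2 : ∫ x, (∑ k : Fin N, ‖e k‖ ^ 2 • φ.1 k) x ∂(μ : Measure X)
      = ∑ k : Fin N, ‖e k‖ ^ 2 * ∫ x, φ.1 k x ∂(μ : Measure X) := by
    simp_rw [← integral_const_mul]
    rw [← integral_finsetSum _ fun k _ => hμ k]
    congr 1 with x
    simp
  rw [e1, e2, ← Finset.sum_sub_distrib]
  refine Finset.sum_congr rfl fun k _ => ?_
  have hm := integral_mass_decomposition (μ : Measure X) (l := l)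
    (singularPart_mass_le_perp l μ ν ζ) (φ.1 k).continuous.measurable (hφ k)
  have hv := integral_momentum_decomposition ν (l := l) (variation_vecSingularPart_le_perp l μ ν ζ)
    (φ.1 k).continuous.measurable (hφ k) ((2 : ℝ) • e k)
  rw [← hv, ← hm]
  have s1 : ∫ x, φ.1 k x * f k x ∂l = ∫ x, φ.1 k x * inner ℝ ((2 : ℝ) • e k) (vecDensity ν l x) ∂l
      - ‖e k‖ ^ 2 * ∫ x, φ.1 k x * ((μ : Measure X).rnDeriv l x).toReal ∂l := by
    rw [← integral_const_mul, ← integral_sub]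
    · congr 1 with x
      simp only [hf, real_inner_smul_left]; ring
    · simpa only [real_inner_smul_left] using integrable_continuousMap_mul (hfi1 k) (φ.1 k)
    · refine (integrable_continuousMap_mul (hfi2 k) (φ.1 k)).congr (ae_of_all _ fun x => ?_)
      ring
  have s2 : ∫ x, φ.1 k x * g k x ∂p
      = ∫ x, φ.1 k x * inner ℝ ((2 : ℝ) • e k) (vecDensity (vecSingularPart ν l) p x) ∂p
      - ‖e k‖ ^ 2 * ∫ x, φ.1 k x * (((μ : Measure X).singularPart l).rnDeriv p x).toReal ∂p := by
    rw [← integral_const_mul, ← integral_sub]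
    · congr 1 with x
      simp only [hg, real_inner_smul_left]; ring
    · simpa only [real_inner_smul_left] using integrable_continuousMap_mul (hgi1 k) (φ.1 k)
    · refine (integrable_continuousMap_mul (hgi2 k) (φ.1 k)).congr (ae_of_all _ fun x => ?_)
      ring
  rw [s1, s2]
  ring

theorem exists_sourceAction_eq_iSup (d : ℕ) {r : ℝ → ℝ} (hr : IsSourcePenalty r) (l : Measure X)
    [IsFiniteMeasure l] :
    ∃ (g : ℕ × ℕ → C(X, ℝ)) (q : ℕ × ℕ → ℝ), (∃ i, g i = 0 ∧ q i = 0) ∧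
      ∀ (μ : FiniteMeasure X) (ν : VectorMeasure X (Vec d)) (ζ : SignedMeasure X),
        sourceAction r l μ ν ζ = (⨆ i, ENNReal.ofReal (∫ᵛ x, g i x ∂•ζ - q i)) ^ 2 := by
  obtain ⟨α, β, hr1, hr2⟩ := hr.exists_affine
  refine ⟨fun i => ∑ k : Fin i.1, α k • (denseWeights X i.1 i.2).1 k,
    fun i => ∑ k : Fin i.1, β k * ∫ x, (denseWeights X i.1 i.2).1 k x ∂l, ⟨(0, 0), by simp, by simp⟩, ?_⟩
  intro μ ν ζ
  set p := perp l μ ν ζ with hp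
  set f : ℕ → X → ℝ := fun k x => α k * ζ.rnDeriv l x - β k with hf
  set g : ℕ → X → ℝ := fun k x => α k * (ζ.singularPart l).rnDeriv p x with hg
  have hfi1 : ∀ k, Integrable (fun x => α k * ζ.rnDeriv l x) l := fun k =>
    (SignedMeasure.integrable_rnDeriv _ _).const_mul _
  have hgi : ∀ k, Integrable (g k) p := fun k => (SignedMeasure.integrable_rnDeriv _ _).const_mul _
  have hfm : ∀ k, Measurable (f k) := fun k =>
    ((SignedMeasure.measurable_rnDeriv _ _).const_mul _).sub_const _
  have hgm : ∀ k, Measurable (g k) := fun k => (SignedMeasure.measurable_rnDeriv _ _).const_mul _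
  have key := lintegral_iSup_add_eq (mutuallySingular_perp l μ ν ζ) hfm
    (fun k => (hfi1 k).sub (integrable_const _)) hgm hgi
  unfold sourceAction
  simp_rw [hr1, hr2]
  rw [key, iSup_prod]
  congr! 6 with N j
  set φ := denseWeights X N j
  have hζ : ∀ k : Fin N, ζ.Integrable fun x => α k • φ.1 k x := fun k =>
    integrable_continuousMap (α k • φ.1 k)
  have e1 : ∫ᵛ x, (∑ k : Fin N, α k • φ.1 k) x ∂•ζ = ∑ k : Fin N, α k * ∫ᵛ x, φ.1 k x ∂•ζ := by
    have : ∀ k : Fin N, α k * ∫ᵛ x, φ.1 k x ∂•ζ = ∫ᵛ x, α k • φ.1 k x ∂•ζ := fun k => by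
      rw [VectorMeasure.integral_fun_smul, smul_eq_mul]
    simp_rw [this]
    rw [← VectorMeasure.integral_finsetSum _ fun k _ => hζ k]
    congr 1 with x
    simp
  rw [e1, ← Finset.sum_sub_distrib]
  refine Finset.sum_congr rfl fun k _ => ?_
  rw [← integral_source_decomposition ζ (l := l) (variation_singularPart_le_perp l μ ν ζ)
    (φ.1 k).continuous.measurable fun x => (φ.1 k).norm_coe_le_norm x]
  have s1 : ∫ x, φ.1 k x * f k x ∂l = α k * ∫ x, φ.1 k x * ζ.rnDeriv l x ∂l
      - β k * ∫ x, φ.1 k x ∂l := by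
    rw [← integral_const_mul, ← integral_const_mul, ← integral_sub]
    · congr 1 with x
      simp only [hf]; ring
    · exact (integrable_continuousMap_mul (SignedMeasure.integrable_rnDeriv _ _) _).const_mul _
    · exact (integrable_continuousMap (φ.1 k)).const_mul _
  have s2 : ∫ x, φ.1 k x * g k x ∂p = α k * ∫ x, φ.1 k x * (ζ.singularPart l).rnDeriv p x ∂p := by
    rw [← integral_const_mul]
    congr 1 with x
    simp only [hg]; ring
  rw [s1, s2]
  ring

/-- Linearises the square in the source term. The absolute value makes every term non-positive when
s ≤ 0, so the supremum is the square of the positive part rather than s². -/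
theorem ofReal_sq_eq_iSup (s : ℝ) :
    ENNReal.ofReal s ^ 2 = ⨆ c : ℚ, ENNReal.ofReal (2 * |(c : ℝ)| * s - (c : ℝ) ^ 2) := by
  have hF : Continuous fun c : ℝ => ENNReal.ofReal (2 * |c| * s - c ^ 2) :=
    ENNReal.continuous_ofReal.comp (by fun_prop)
  rcases le_or_gt s 0 with hs | hs
  · rw [ENNReal.ofReal_of_nonpos hs]
    symm
    rw [zero_pow two_ne_zero]
    refine ENNReal.iSup_eq_zero.2 fun c => ENNReal.ofReal_of_nonpos ?_
    nlinarith [abs_nonneg (c : ℝ), sq_nonneg (c : ℝ)]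
  · rw [← ENNReal.ofReal_pow hs.le]
    refine le_antisymm ?_ (iSup_le fun c => ENNReal.ofReal_le_ofReal ?_)
    · refine le_trans (ENNReal.ofReal_le_ofReal ?_) (le_iSup_of_denseRange Rat.denseRange_cast hF s)
      rw [abs_of_pos hs]; linarith [sq_nonneg s]
    · nlinarith [sq_nonneg (|(c : ℝ)| - s), sq_abs (c : ℝ)]

/-- Positive parts are not additive: a negative x_i would eat into y_j. A vanishing member in each
family allows such an x_i to be replaced by 0. -/
theorem iSup_ofReal_add_iSup_ofReal {ι κ : Type*} {x : ι → ℝ} {y : κ → ℝ} (hx : ∃ i, x i = 0)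
    (hy : ∃ j, y j = 0) :
    (⨆ i, ENNReal.ofReal (x i)) + ⨆ j, ENNReal.ofReal (y j) =
      ⨆ ij : ι × κ, ENNReal.ofReal (x ij.1 + y ij.2) := by
  obtain ⟨i₀, hi₀⟩ := hx
  obtain ⟨j₀, hj₀⟩ := hy
  have : Nonempty ι := ⟨i₀⟩
  have : Nonempty κ := ⟨j₀⟩
  refine le_antisymm (ENNReal.iSup_add_iSup_le fun i j => ?_) (iSup_le fun ij => ?_)
  · have hle := le_iSup fun ij : ι × κ => ENNReal.ofReal (x ij.1 + y ij.2)
    rcases le_total (x i) 0 with h | h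
    · rw [ENNReal.ofReal_of_nonpos h, zero_add]
      simpa [hi₀] using hle (i₀, j)
    · rcases le_total (y j) 0 with h' | h'
      · rw [ENNReal.ofReal_of_nonpos h', add_zero]
        simpa [hj₀] using hle (i, j₀)
      · rw [← ENNReal.ofReal_add h h']
        exact hle (i, j)
  · exact ENNReal.ofReal_add_le.trans
      (add_le_add (le_iSup (fun i => ENNReal.ofReal (x i)) ij.1)
        (le_iSup (fun j => ENNReal.ofReal (y j)) ij.2))

/-- The energy density is the supremum of a sequence of affine weak-* continuous functionals. -/
theorem exists_energyDensity_eq_iSup (d : ℕ) {r : ℝ → ℝ} (hr : IsSourcePenalty r) {δ : ℝ}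
    (hδ : 0 < δ) (l : Measure X) [IsFiniteMeasure l] :
    ∃ (b : ℕ → C(X, Vec d)) (a g : ℕ → C(X, ℝ)) (q : ℕ → ℝ),
      ∀ (μ : FiniteMeasure X) (ν : VectorMeasure X (Vec d)) (ζ : SignedMeasure X),
        energyDensity δ r l μ ν ζ = ⨆ i, ENNReal.ofReal (∫ᵛ x, b i x ∂[innerSL ℝ; ν]
          - ∫ x, a i x ∂(μ : Measure X) + ∫ᵛ x, g i x ∂•ζ - q i) := by
  obtain ⟨b, a, ⟨i₀, hb₀, ha₀⟩, hA⟩ := exists_transportAction_eq_iSup d l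
  obtain ⟨g, q, ⟨j₀, hg₀, hq₀⟩, hS⟩ := exists_sourceAction_eq_iSup d hr l
  obtain ⟨e, he⟩ := exists_surjective_nat ((ℕ × ℕ) × ((ℕ × ℕ) × ℚ))
  refine ⟨fun n => b (e n).1, fun n => a (e n).1,
    fun n => (1 / δ * (2 * |((e n).2.2 : ℝ)|)) • g (e n).2.1,
    fun n => 1 / δ * (2 * |((e n).2.2 : ℝ)| * q (e n).2.1 + ((e n).2.2 : ℝ) ^ 2), ?_⟩
  intro μ ν ζ
  have hsq : ENNReal.ofReal (1 / δ) * sourceAction r l μ ν ζ = ⨆ jc : (ℕ × ℕ) × ℚ,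
      ENNReal.ofReal (1 / δ * (2 * |(jc.2 : ℝ)| * (∫ᵛ x, g jc.1 x ∂•ζ - q jc.1)
        - (jc.2 : ℝ) ^ 2)) := by
    rw [hS μ ν ζ, ENNReal.iSup_pow_of_ne_zero two_ne_zero, ENNReal.mul_iSup,
      iSup_prod (f := fun jc : (ℕ × ℕ) × ℚ => _)]
    refine iSup_congr fun j => ?_
    rw [ofReal_sq_eq_iSup, ENNReal.mul_iSup]
    congr 1 with c
    rw [ENNReal.ofReal_mul (by positivity)]
  rw [energyDensity, hA, hsq, iSup_ofReal_add_iSup_ofReal ⟨i₀, by simp [hb₀, ha₀]⟩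
    ⟨(j₀, 0), by simp⟩, ← he.iSup_comp]
  congr 1 with n
  congr 1
  have : ∫ᵛ x, ((1 / δ * (2 * |((e n).2.2 : ℝ)|)) • g (e n).2.1) x ∂•ζ =
      1 / δ * (2 * |((e n).2.2 : ℝ)|) * ∫ᵛ x, g (e n).2.1 x ∂•ζ := by
    exact VectorMeasure.integral_fun_smul ζ (ContinuousLinearMap.lsmul ℝ ℝ) _ _
  rw [this]
  ring

end StaticDuality

/-! ### Coercivity of the energy density -/

section Bounds

variable {d : ℕ} {X : Type*} [MeasurableSpace X]

theorem enorm_le_Phi {ε : ℝ} (hε : 0 < ε) {u : ℝ} (hu : 0 ≤ u) (m : Vec d) :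
    ‖m‖ₑ ≤ ENNReal.ofReal ε * Phi u m + ENNReal.ofReal (1 / ε) * ENNReal.ofReal u := by
  unfold Phi
  split_ifs with h1 h2
  · rw [← ENNReal.ofReal_mul hε.le, ← ENNReal.ofReal_mul (by positivity),
      ← ENNReal.ofReal_add (by positivity) (by positivity), ← ofReal_norm]
    refine ENNReal.ofReal_le_ofReal ?_
    -- Young's inequality by completing the square; the constant is not optimal.
    have : ε * (‖m‖ ^ 2 / u) + 1 / ε * u - ‖m‖ =
        ((ε * ‖m‖ - u / 2) ^ 2 + 3 / 4 * u ^ 2) / (ε * u) := by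
      field_simp
      ring
    have h0 : 0 ≤ ((ε * ‖m‖ - u / 2) ^ 2 + 3 / 4 * u ^ 2) / (ε * u) := by positivity
    linarith
  · obtain ⟨rfl, rfl⟩ := h2
    simp
  · rw [ENNReal.mul_top (by simpa using hε)]
    simp

theorem lintegral_enorm_le_Phi {ε : ℝ} (hε : 0 < ε) {l μ : Measure X} [SigmaFinite μ]
    [SigmaFinite l] {M : ℝ≥0∞} (hμ : μ univ ≤ M) (m : X → Vec d) :
    ∫⁻ x, ‖m x‖ₑ ∂l ≤ ENNReal.ofReal ε * ∫⁻ x, Phi (μ.rnDeriv l x).toReal (m x) ∂l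
      + ENNReal.ofReal (1 / ε) * M := by
  have hm : Measurable fun x => ENNReal.ofReal (1 / ε) * ENNReal.ofReal (μ.rnDeriv l x).toReal :=
    (Measure.measurable_rnDeriv _ _).ennreal_toReal.ennreal_ofReal.const_mul _
  calc ∫⁻ x, ‖m x‖ₑ ∂l ≤ ∫⁻ x, (ENNReal.ofReal ε * Phi (μ.rnDeriv l x).toReal (m x)
        + ENNReal.ofReal (1 / ε) * ENNReal.ofReal (μ.rnDeriv l x).toReal) ∂l :=
        lintegral_mono fun x => enorm_le_Phi hε ENNReal.toReal_nonneg _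
    _ = ENNReal.ofReal ε * ∫⁻ x, Phi (μ.rnDeriv l x).toReal (m x) ∂l
        + ENNReal.ofReal (1 / ε) * ∫⁻ x, ENNReal.ofReal (μ.rnDeriv l x).toReal ∂l := by
        rw [lintegral_add_right _ hm, lintegral_const_mul' _ _ ENNReal.ofReal_ne_top,
          lintegral_const_mul' _ _ ENNReal.ofReal_ne_top]
    _ ≤ _ := by
        gcongr
        exact (lintegral_mono fun x => ENNReal.ofReal_toReal_le).trans
          (Measure.lintegral_rnDeriv_le.trans hμ)

/-- The absolutely continuous and the singular part each cost at most the full mass of `μ` divided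
by ε, whence 2 / ε. The free small factor in front of the action is what gives equi-integrability in
time. -/
theorem variation_le_transportAction {ε : ℝ} (hε : 0 < ε) (l : Measure X) [IsFiniteMeasure l]
    (μ : FiniteMeasure X) (ν : VectorMeasure X (Vec d)) (ζ : SignedMeasure X) :
    ν.variation univ ≤ ENNReal.ofReal ε * transportAction l μ ν ζ
      + ENNReal.ofReal (2 / ε) * (μ : Measure X) univ := by
  have h1 : ν.variation ≤ (l.withDensityᵥ (vecDensity ν l)).variation
      + (vecSingularPart ν l).variation := by
    refine le_trans (le_of_eq ?_) VectorMeasure.variation_add_le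
    congr 1
    simp [vecSingularPart]
  have h2 := withDensityᵥ_vecDensity (vecSingularPart ν l)
    (Measure.absolutelyContinuous_of_le (variation_vecSingularPart_le_perp l μ ν ζ))
  rw [← h2, Measure.variation_withDensityᵥ (integrable_vecDensity _ _),
    Measure.variation_withDensityᵥ (integrable_vecDensity _ _)] at h1
  refine (Measure.le_iff'.1 h1 univ).trans ?_
  rw [Measure.add_apply, withDensity_apply _ MeasurableSet.univ,
    withDensity_apply _ MeasurableSet.univ, Measure.restrict_univ, Measure.restrict_univ]
  refine (add_le_add (lintegral_enorm_le_Phi hε (μ := (μ : Measure X)) le_rfl _)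
    (lintegral_enorm_le_Phi hε (μ := (μ : Measure X).singularPart l) (M := (μ : Measure X) univ)
      (Measure.le_iff'.1 (Measure.singularPart_le _ _) univ) _)).trans (le_of_eq ?_)
  unfold transportAction
  have : ENNReal.ofReal (2 / ε) = ENNReal.ofReal (1 / ε) + ENNReal.ofReal (1 / ε) := by
    rw [← ENNReal.ofReal_add (by positivity) (by positivity)]
    congr 1; ring
  rw [this]
  ring

/-- Beyond a, convexity and r(0) = 0 give r(s)/s ≥ r(a)/a; below a the additive constant suffices.
-/
theorem le_mul_add_of_convex {r : ℝ → ℝ} (hc : ConvexOn ℝ univ r) (h0 : r 0 = 0)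
    (hnn : ∀ s, 0 ≤ r s) {a : ℝ} (ha : 0 < a) (hra : 0 < r a) (s : ℝ) :
    s ≤ a / r a * r s + a := by
  rcases le_total s a with h | h
  · have := hnn s
    have : 0 ≤ a / r a * r s := by positivity
    linarith
  · have hs' : 0 < s := ha.trans_le h
    have key := hc.2 (mem_univ s) (mem_univ 0) (show 0 ≤ a / s by positivity)
      (show 0 ≤ 1 - a / s by rw [sub_nonneg, div_le_one hs']; exact h) (by ring)
    simp only [smul_eq_mul, mul_zero, add_zero, h0] at key
    rw [div_mul_cancel₀ _ hs'.ne', div_mul_eq_mul_div, le_div_iff₀ hs'] at key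
    have : s ≤ a / r a * r s := by
      rw [div_mul_eq_mul_div, le_div_iff₀ hra]; linarith
    linarith

theorem exists_pos_of_recession_pos {r : ℝ → ℝ} {y : ℝ} (h : 0 < recession r y) :
    ∃ a > 0, 0 < r (a * y) := by
  simp only [recession, lt_iSup_iff] at h
  obtain ⟨s, hs, h⟩ := h
  rw [ENNReal.ofReal_pos] at h
  exact ⟨s, hs, (div_pos_iff_of_pos_right hs).1 h⟩

theorem IsSourcePenalty.exists_growth {r : ℝ → ℝ} (hr : IsSourcePenalty r) :
    ∃ κ C : ℝ, 0 ≤ κ ∧ 0 ≤ C ∧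
      (∀ s, ‖s‖ₑ ≤ ENNReal.ofReal κ * ENNReal.ofReal (r s) + ENNReal.ofReal C) ∧
      ∀ y, ‖y‖ₑ ≤ ENNReal.ofReal κ * recession r y := by
  obtain ⟨a, ha, hra⟩ := exists_pos_of_recession_pos hr.growth_pos.1
  obtain ⟨a', ha', hra'⟩ := exists_pos_of_recession_pos hr.growth_neg.1
  rw [mul_one] at hra
  rw [mul_neg_one] at hra'
  -- The larger inverse slope of the two chords of `r` from the origin to a and to -a'.
  set κ := max (a / r a) (a' / r (-a'))
  have hκ : 0 ≤ κ := (by positivity : 0 ≤ a / r a).trans (le_max_left _ _)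
  have hc' : ConvexOn ℝ univ fun s => r (-s) := by
    simpa [Function.comp_def] using hr.convex.comp_linearMap (-LinearMap.id : ℝ →ₗ[ℝ] ℝ)
  have hbd : ∀ s, |s| ≤ κ * r s + max a a' := by
    intro s
    rcases le_total 0 s with hs | hs
    · have := le_mul_add_of_convex hr.convex hr.zero hr.nonneg ha hra s
      rw [abs_of_nonneg hs]
      have h2 := mul_le_mul_of_nonneg_right (le_max_left (a / r a) (a' / r (-a'))) (hr.nonneg s)
      linarith [le_max_left a a']
    · have := le_mul_add_of_convex hc' (by simpa using hr.zero) (fun s => hr.nonneg _) ha' hra'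
        (-s)
      simp only [neg_neg] at this
      rw [abs_of_nonpos hs]
      have h2 := mul_le_mul_of_nonneg_right (le_max_right (a / r a) (a' / r (-a'))) (hr.nonneg s)
      linarith [le_max_right a a']
  refine ⟨κ, max a a', hκ, ha.le.trans (le_max_left _ _), fun s => ?_, fun y => ?_⟩
  · rw [← ENNReal.ofReal_mul hκ, ← ENNReal.ofReal_add (mul_nonneg hκ (hr.nonneg s))
      (ha.le.trans (le_max_left _ _)), ← ofReal_norm]
    exact ENNReal.ofReal_le_ofReal (hbd s)
  -- Apply the bound at sy and divide by s; as s → ∞ the additive constant disappears.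
  · have hle : ∀ s, 0 < s → ENNReal.ofReal (|y| - max a a' / s) ≤
        ENNReal.ofReal κ * recession r y := by
      intro s hs
      refine le_trans ?_ (mul_le_mul_right (le_iSup₂
        (f := fun (s : ℝ) (_ : 0 < s) => ENNReal.ofReal (r (s * y) / s)) s hs) _)
      rw [← ENNReal.ofReal_mul hκ]
      refine ENNReal.ofReal_le_ofReal ?_
      have := hbd (s * y)
      rw [abs_mul, abs_of_pos hs] at this
      rw [← mul_div_assoc, le_div_iff₀ hs, sub_mul, div_mul_cancel₀ _ hs.ne']
      linarith
    have hlim : Tendsto (fun s : ℝ => |y| - max a a' / s) atTop (𝓝 (|y| - 0)) :=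
      tendsto_const_nhds.sub (tendsto_const_nhds.div_atTop tendsto_id)
    rw [sub_zero] at hlim
    rw [← ofReal_norm]
    refine le_of_tendsto (ENNReal.tendsto_ofReal hlim) ?_
    filter_upwards [eventually_gt_atTop 0] with s hs using hle s hs

theorem le_mul_sq_add {ε : ℝ} (hε : 0 < ε) (s : ℝ≥0∞) :
    s ≤ ENNReal.ofReal ε * s ^ 2 + ENNReal.ofReal (1 / ε) := by
  induction s with
  | top => simp [hε]
  | coe s =>
    rw [← ENNReal.ofReal_coe_nnreal, ← ENNReal.ofReal_pow s.coe_nonneg, ← ENNReal.ofReal_mul hε.le,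
      ← ENNReal.ofReal_add (by positivity) (by positivity)]
    refine ENNReal.ofReal_le_ofReal ?_
    have : ε * (s : ℝ) ^ 2 + 1 / ε - s = ((ε * s - 1 / 2) ^ 2 + 3 / 4) / ε := by
      field_simp
      ring
    have h0 : 0 ≤ ((ε * (s : ℝ) - 1 / 2) ^ 2 + 3 / 4) / ε := by positivity
    linarith

/-- The additive constant is paid only against `l`: the bound by the recession function has none, so
the mass of the measure `perp` never enters. The outer square of the source action, through s ≤ ε s²
+ 1/ε, supplies superlinearity in time even though `r` grows only linearly. -/
theorem IsSourcePenalty.exists_variation_le {r : ℝ → ℝ} (hr : IsSourcePenalty r) :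
    ∃ κ C : ℝ, 0 ≤ κ ∧ 0 ≤ C ∧ ∀ {ε : ℝ}, 0 < ε → ∀ (l : Measure X) [IsFiniteMeasure l]
      (μ : FiniteMeasure X) (ν : VectorMeasure X (Vec d)) (ζ : SignedMeasure X),
      ζ.variation univ ≤ ENNReal.ofReal κ * (ENNReal.ofReal ε * sourceAction r l μ ν ζ
        + ENNReal.ofReal (1 / ε)) + ENNReal.ofReal C * l univ := by
  obtain ⟨κ, C, hκ, hC, h1, h2⟩ := hr.exists_growth
  refine ⟨κ, C, hκ, hC, fun {ε} hε l _ μ ν ζ => ?_⟩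
  have h3 : ζ.variation ≤ (l.withDensityᵥ (ζ.rnDeriv l)).variation
      + (ζ.singularPart l).variation := by
    refine le_trans (le_of_eq ?_) VectorMeasure.variation_add_le
    congr 1
    rw [add_comm, SignedMeasure.singularPart_add_withDensity_rnDeriv_eq]
  rw [← withDensityᵥ_rnDeriv_variation (ζ.singularPart l)
    (Measure.absolutelyContinuous_of_le (variation_singularPart_le_perp l μ ν ζ)),
    Measure.variation_withDensityᵥ (SignedMeasure.integrable_rnDeriv _ _),
    Measure.variation_withDensityᵥ (SignedMeasure.integrable_rnDeriv _ _)] at h3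
  refine (Measure.le_iff'.1 h3 univ).trans ?_
  rw [Measure.add_apply, withDensity_apply _ MeasurableSet.univ,
    withDensity_apply _ MeasurableSet.univ, Measure.restrict_univ, Measure.restrict_univ]
  have a1 : ∫⁻ x, ‖ζ.rnDeriv l x‖ₑ ∂l ≤ ENNReal.ofReal κ *
      ∫⁻ x, ENNReal.ofReal (r (ζ.rnDeriv l x)) ∂l + ENNReal.ofReal C * l univ := by
    refine (lintegral_mono fun x => h1 _).trans ?_
    rw [lintegral_add_right _ measurable_const, lintegral_const,
      lintegral_const_mul' _ _ ENNReal.ofReal_ne_top]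
  have a2 : ∫⁻ x, ‖(ζ.singularPart l).rnDeriv (perp l μ ν ζ) x‖ₑ ∂(perp l μ ν ζ) ≤
      ENNReal.ofReal κ * ∫⁻ x, recession r ((ζ.singularPart l).rnDeriv (perp l μ ν ζ) x)
        ∂(perp l μ ν ζ) := by
    refine (lintegral_mono fun x => h2 _).trans ?_
    rw [lintegral_const_mul' _ _ ENNReal.ofReal_ne_top]
  refine (add_le_add a1 a2).trans ?_
  rw [add_right_comm, ← mul_add]
  exact add_le_add_left (mul_le_mul_right (le_mul_sq_add hε _) _) _

end Bounds

/-! ### Measurable families of signed measures and disintegrations -/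

section Families

variable {K : Type*} [MeasurableSpace K]

theorem signed_integrable_of_bounded {X : Type*} [MeasurableSpace X] (τ : SignedMeasure X)
    {η : X → ℝ} (hη : Measurable η) {C : ℝ} (hC : ∀ x, ‖η x‖ ≤ C) : τ.Integrable η :=
  integrable_of_measurable_bounded hη.stronglyMeasurable hC

theorem integral_indicator_one {X : Type*} [MeasurableSpace X] (τ : SignedMeasure X) {E : Set X}
    (hE : MeasurableSet E) (c : ℝ) : ∫ᵛ x, E.indicator (fun _ => c) x ∂•τ = c * τ E := by
  rw [VectorMeasure.integral_indicator_const c hE]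
  simp

theorem measurable_apply_preimage {s : I → SignedMeasure K}
    (hs : ∀ B, MeasurableSet B → Measurable fun t => s t B) {E : Set (I × K)}
    (hE : MeasurableSet E) : Measurable fun t => s t (Prod.mk t ⁻¹' E) := by
  induction E, hE using MeasurableSpace.induction_on_inter generateFrom_prod.symm
    isPiSystem_prod with
  | empty => simp
  | basic E hE =>
    obtain ⟨A, hA, B, hB, rfl⟩ := hE
    classical
    have : (fun t => s t (Prod.mk t ⁻¹' A ×ˢ B)) = A.indicator fun t => s t B := by
      ext t
      by_cases ht : t ∈ A <;> simp [ht]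
    rw [this]
    exact (hs B hB).indicator hA
  | compl E hE ih =>
    have : (fun t => s t (Prod.mk t ⁻¹' Eᶜ)) = fun t => s t univ - s t (Prod.mk t ⁻¹' E) := by
      ext t
      rw [preimage_compl, VectorMeasure.of_compl (measurable_prodMk_left hE)]
    rw [this]
    exact (hs univ MeasurableSet.univ).sub ih
  | iUnion f hd hf ih =>
    refine measurable_of_tendsto_metrizable
      (f := fun n t => ∑ k ∈ Finset.range n, s t (Prod.mk t ⁻¹' f k))
      (fun n => Finset.measurable_sum _ fun k _ => ih k) (tendsto_pi_nhds.2 fun t => ?_)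
    rw [preimage_iUnion]
    refine (VectorMeasure.hasSum_of_disjoint_iUnion (v := s t)
      (fun k => measurable_prodMk_left (hf k)) fun a b hab => ?_).tendsto_sum_nat
    exact (hd hab).preimage _

theorem measurable_integral_simpleFunc {s : I → SignedMeasure K}
    (hs : ∀ B, MeasurableSet B → Measurable fun t => s t B) (η : SimpleFunc (I × K) ℝ) :
    Measurable fun t => ∫ᵛ x, η (t, x) ∂•(s t) := by
  induction η using SimpleFunc.induction with
  | const c hE =>
    rename_i E
    have : (fun t => ∫ᵛ x, (SimpleFunc.piecewise E hE (SimpleFunc.const _ c)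
        (SimpleFunc.const _ 0)) (t, x) ∂•(s t)) = fun t => c * s t (Prod.mk t ⁻¹' E) := by
      ext t
      rw [← integral_indicator_one _ (measurable_prodMk_left hE)]
      congr 1 with x
    rw [this]
    exact (measurable_apply_preimage hs hE).const_mul c
  | @add f g _ hf hg =>
    have : (fun t => ∫ᵛ x, (f + g) (t, x) ∂•(s t)) =
        fun t => ∫ᵛ x, f (t, x) ∂•(s t) + ∫ᵛ x, g (t, x) ∂•(s t) := by
      ext t
      have hb : ∀ f : SimpleFunc (I × K) ℝ, (s t).Integrable fun x => f (t, x) := fun f => by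
        obtain ⟨C, hC⟩ := f.exists_forall_norm_le
        exact signed_integrable_of_bounded _ (f.measurable.comp measurable_prodMk_left)
          fun x => hC _
      exact VectorMeasure.integral_fun_add (hb f) (hb g)
    rw [this]
    exact hf.add hg

theorem measurable_integral_family {s : I → SignedMeasure K}
    (hs : ∀ B, MeasurableSet B → Measurable fun t => s t B) {η : I × K → ℝ} (hη : Measurable η)
    {C : ℝ} (hC : ∀ p, ‖η p‖ ≤ C) : Measurable fun t => ∫ᵛ x, η (t, x) ∂•(s t) := by
  refine measurable_of_tendsto_metrizable
    (fun n => measurable_integral_simpleFunc hs (hη.stronglyMeasurable.approxBounded C n))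
    (tendsto_pi_nhds.2 fun t => ?_)
  refine VectorMeasure.tendsto_integral_of_dominated_convergence (fun _ => C)
    (fun n => ?_) (integrable_const _) (fun n => ae_of_all _ fun x => ?_)
    (ae_of_all _ fun x => ?_)
  · exact (((hη.stronglyMeasurable.approxBounded C n).measurable.comp
      measurable_prodMk_left)).aestronglyMeasurable
  · exact hη.stronglyMeasurable.norm_approxBounded_le
      ((norm_nonneg _).trans (hC (t, x))) n (t, x)
  · exact hη.stronglyMeasurable.tendsto_approxBounded_of_norm_le (hC (t, x))

theorem enorm_signed_integral_le {X : Type*} [MeasurableSpace X] (τ : SignedMeasure X)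
    {η : X → ℝ} {C : ℝ} (hC : ∀ x, ‖η x‖ ≤ C) :
    ‖∫ᵛ x, η x ∂•τ‖ₑ ≤ ENNReal.ofReal C * τ.variation univ := by
  have h := VectorMeasure.enorm_integral_le_of_enorm_le_const (μ := τ)
    (B := ContinuousLinearMap.lsmul ℝ ℝ) (f := η) (C := ENNReal.ofReal C) (ae_of_all _ fun x => by
      rw [← ofReal_norm]; exact ENNReal.ofReal_le_ofReal (hC x))
  refine h.trans ?_
  have : ‖(ContinuousLinearMap.lsmul ℝ ℝ : ℝ →L[ℝ] ℝ →L[ℝ] ℝ)‖ₑ ≤ 1 := by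
    rw [← ofReal_norm, ← ENNReal.ofReal_one]
    exact ENNReal.ofReal_le_ofReal ContinuousLinearMap.opNorm_lsmul_le
  calc ENNReal.ofReal C * ‖(ContinuousLinearMap.lsmul ℝ ℝ : ℝ →L[ℝ] ℝ →L[ℝ] ℝ)‖ₑ * τ.variation univ
      ≤ ENNReal.ofReal C * 1 * τ.variation univ := by gcongr
    _ = _ := by rw [mul_one]

theorem integrable_integral_family {s : I → SignedMeasure K}
    (hs : ∀ B, MeasurableSet B → Measurable fun t => s t B)
    (hf : ∫⁻ t, (s t).variation univ < ∞) {η : I × K → ℝ} (hη : Measurable η)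
    {C : ℝ} (hC : ∀ p, ‖η p‖ ≤ C) : Integrable fun t => ∫ᵛ x, η (t, x) ∂•(s t) := by
  refine ⟨(measurable_integral_family hs hη hC).aestronglyMeasurable, ?_⟩
  refine (lintegral_mono fun t => enorm_signed_integral_le (s t) fun x => hC (t, x)).trans_lt ?_
  rw [lintegral_const_mul' _ _ ENNReal.ofReal_ne_top]
  exact ENNReal.mul_lt_top ENNReal.ofReal_lt_top hf

/-- `τ = ∫ s_t dt` as measures on `[0,1] × K`. -/
structure IsSignedDisintegration (τ : SignedMeasure (I × K)) (s : I → SignedMeasure K) : Prop where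
  measurable : ∀ B, MeasurableSet B → Measurable fun t => s t B
  finite : ∫⁻ t, (s t).variation univ < ∞
  eq : ∀ η : I × K → ℝ, Measurable η → (∃ C, ∀ p, ‖η p‖ ≤ C) →
    ∫ᵛ p, η p ∂•τ = ∫ t : I, ∫ᵛ x, η (t, x) ∂•(s t)

/-- For a real measure the variation of a set is at most twice the supremum of |τ(E)| over its
measurable subsets E, and |τ(E)| is estimated by disintegrating the indicator of E. The factor 2 is
harmless. -/
theorem IsSignedDisintegration.variation_le {τ : SignedMeasure (I × K)} {s : I → SignedMeasure K}
    (h : IsSignedDisintegration τ s) {J : Set I} (hJ : MeasurableSet J) :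
    τ.variation (J ×ˢ univ) ≤ 2 * ∫⁻ t in J, (s t).variation univ := by
  refine le_of_forall_lt fun a ha => ?_
  obtain ⟨E, hEJ, hE, haE⟩ := τ.exists_subset_lt_enorm_apply_of_lt_variation
    (hJ.prod MeasurableSet.univ) ha
  refine haE.trans_le ?_
  gcongr
  have h1 : τ E = ∫ t : I, ∫ᵛ x, E.indicator (fun _ => (1 : ℝ)) (t, x) ∂•(s t) := by
    rw [← h.eq _ (measurable_const.indicator hE) ⟨1, fun p => ?_⟩, integral_indicator_one _ hE,
      one_mul]
    by_cases hp : p ∈ E <;> simp [hp]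
  rw [h1, ← lintegral_indicator hJ]
  refine (enorm_integral_le_lintegral_enorm _).trans (lintegral_mono fun t => ?_)
  by_cases ht : t ∈ J
  · rw [indicator_of_mem ht]
    have := enorm_signed_integral_le (s t) (η := fun x => E.indicator (fun _ => (1 : ℝ)) (t, x))
      (C := 1) fun x => by by_cases hp : (t, x) ∈ E <;> simp [hp]
    simpa using this
  · rw [indicator_of_notMem ht]
    have : ∀ x, E.indicator (fun _ => (1 : ℝ)) (t, x) = 0 := fun x =>
      indicator_of_notMem (fun hx => ht (hEJ hx).1) _
    simp [this]

variable {d : ℕ} {D : Set (Vec d)}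

theorem IsDisintegration.source_isSignedDisintegration {T : Triple D} {c : Curve D}
    (h : IsDisintegration T c) : IsSignedDisintegration T.source c.source :=
  ⟨h.measurable_source, h.finite_source, fun η hη ⟨_, hC⟩ =>
    h.source_eq η (signed_integrable_of_bounded _ hη hC)⟩

theorem IsDisintegration.component_isSignedDisintegration {T : Triple D} {c : Curve D}
    (h : IsDisintegration T c) (i : Fin d) :
    IsSignedDisintegration (component T.momentum i) fun t => component (c.momentum t) i := by
  have hm : ∀ i, ∀ B : Set (Cl D), MeasurableSet B →
      Measurable fun t => component (c.momentum t) i B := fun i B hB => by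
    simp_rw [component_apply]
    exact (EuclideanSpace.proj (𝕜 := ℝ) i).continuous.measurable.comp (h.measurable_momentum B hB)
  have hfin : ∀ i, ∫⁻ t, (component (c.momentum t) i).variation univ < ∞ := fun i =>
    (lintegral_mono fun t => Measure.le_iff'.1 (variation_component_le _ i) univ).trans_lt
      h.finite_momentum
  refine ⟨hm i, hfin i, fun η hη ⟨C, hC⟩ => ?_⟩
  have hb : T.momentum.Integrable η := integrable_of_measurable_bounded hη.stronglyMeasurable hC
  have hbt : ∀ t, (c.momentum t).Integrable fun x => η (t, x) := fun t =>
    integrable_of_measurable_bounded (hη.comp measurable_prodMk_left).stronglyMeasurable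
      fun x => hC _
  have hint : Integrable fun t => ∫ᵛ x, η (t, x) ∂•(c.momentum t) := by
    refine Integrable.of_eval_piLp fun j => ?_
    simp_rw [integral_component (hbt _)]
    exact integrable_integral_family (hm j) (hfin j) hη hC
  rw [← integral_component hb, h.momentum_eq η hb]
  have := (EuclideanSpace.proj (𝕜 := ℝ) i).integral_comp_comm hint
  refine this.symm.trans ?_
  refine integral_congr_ae (ae_of_all _ fun t => ?_)
  exact integral_component (hbt t) i

end Families

/-! ### Integrating a weak derivative on [0,1] -/

section WeakDerivative

theorem setIntegral_Ici_unitInterval {W : ℝ → ℝ} (s : I) :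
    ∫ t : I in Ici s, W t = ∫ x in (s : ℝ)..1, W x := by
  rw [← integral_indicator measurableSet_Ici]
  have : (Ici s).indicator (fun t : I => W t) = fun t : I => (Ici (s : ℝ)).indicator W t := by
    ext t
    by_cases h : s ≤ t
    · rw [indicator_of_mem (by exact h), indicator_of_mem (by exact h)]
    · rw [indicator_of_notMem (by exact h), indicator_of_notMem (by exact h)]
  rw [this, integral_subtype measurableSet_Icc (f := (Ici (s : ℝ)).indicator W),
    setIntegral_indicator measurableSet_Ici, intervalIntegral.integral_of_le s.2.2,
    ← integral_Icc_eq_integral_Ioc]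
  congr 2
  ext x
  have := s.2.1
  simp only [mem_inter_iff, mem_Icc, mem_Ici]
  constructor
  · rintro ⟨⟨_, h⟩, h'⟩; exact ⟨h', h⟩
  · rintro ⟨h', h⟩; exact ⟨⟨this.trans h', h⟩, h'⟩

theorem continuous_setIntegral_Iic {G : I → ℝ} (hG : Integrable G) :
    Continuous fun t => ∫ s in Iic t, G s := by
  simp_rw [← integral_indicator measurableSet_Iic]
  refine continuous_iff_continuousAt.2 fun t₀ => ?_
  refine continuousAt_of_dominated (bound := fun s => ‖G s‖)
    (Eventually.of_forall fun t => (hG.indicator measurableSet_Iic).aestronglyMeasurable)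
    (Eventually.of_forall fun t => ae_of_all _ fun s => norm_indicator_le_norm_self _ _)
    hG.norm ?_
  have : ∀ᵐ s : I, s ≠ t₀ := by
    rw [ae_iff]; simp
  filter_upwards [this] with s hs
  rcases lt_or_gt_of_ne hs with h | h
  · refine ContinuousAt.congr (f := fun _ => G s) continuousAt_const ?_
    filter_upwards [Ioi_mem_nhds h] with t ht
    rw [indicator_of_mem (by exact (mem_Ioi.1 ht).le)]
  · refine ContinuousAt.congr (f := fun _ => (0 : ℝ)) continuousAt_const ?_
    filter_upwards [Iio_mem_nhds h] with t ht
    rw [indicator_of_notMem (by exact not_le.2 (mem_Iio.1 ht))]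

theorem integral_mul_setIntegral_Iic {w G : I → ℝ} (hw : Continuous w) (hG : Integrable G) :
    ∫ t, w t * ∫ s in Iic t, G s = ∫ s, G s * ∫ t in Ici s, w t := by
  have hwi : Integrable w := integrable_continuousMap ⟨w, hw⟩
  have hS : MeasurableSet {p : I × I | p.2 ≤ p.1} := measurableSet_le measurable_snd measurable_fst
  have hint : Integrable (Function.uncurry fun t s : I =>
      {p : I × I | p.2 ≤ p.1}.indicator (fun p => w p.1 * G p.2) (t, s)) (volume.prod volume) :=
    (hwi.mul_prod hG).indicator hS
  have := integral_integral_swap hint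
  refine Eq.trans (integral_congr_ae (ae_of_all _ fun t => ?_)) (this.trans
    (integral_congr_ae (ae_of_all _ fun s => ?_)))
  · change w t * ∫ s in Iic t, G s = _
    rw [← integral_indicator measurableSet_Iic, ← integral_const_mul]
    refine integral_congr_ae (ae_of_all _ fun s => ?_)
    by_cases h : s ≤ t <;> simp [indicator, h]
  · change _ = G s * ∫ t in Ici s, w t
    rw [← integral_indicator measurableSet_Ici, ← integral_const_mul]
    refine integral_congr_ae (ae_of_all _ fun t => ?_)
    by_cases h : s ≤ t <;> simp [indicator, h, mul_comm]

/-- Let w be the difference of the two sides. Testing with the primitive of w that vanishes at 1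
removes the `B` term, and Fubini turns the identity into ∫ w² = 0; continuity of w then gives w = 0
everywhere. -/
theorem eq_add_setIntegral_of_weak_derivative {F G : I → ℝ} (hF : Continuous F) (hG : Integrable G)
    {A B : ℝ} (h : ∀ ψ : ℝ → ℝ, ContDiff ℝ 1 ψ →
      0 = (∫ t : I, (deriv ψ t * F t + ψ t * G t)) - ψ 1 * B + ψ 0 * A) (t : I) :
    F t = A + ∫ s in Iic t, G s := by
  set w : I → ℝ := fun t => F t - (A + ∫ s in Iic t, G s) with hw
  have hwc : Continuous w := hF.sub (continuous_const.add (continuous_setIntegral_Iic hG))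
  -- Test functions live on ℝ, so w is extended by its endpoint values to make the primitive C^1
  -- there.
  set W : ℝ → ℝ := IccExtend zero_le_one w with hW
  have hWc : Continuous W := hwc.Icc_extend'
  have hWw : ∀ t : I, W t = w t := fun t => IccExtend_val _ _ _
  set ψ : ℝ → ℝ := fun u => ∫ x in (1 : ℝ)..u, W x with hψ
  have hd : ∀ u, HasDerivAt ψ (W u) u := fun u => (hWc.integral_hasStrictDerivAt 1 u).hasDerivAt
  have hderiv : deriv ψ = W := funext fun u => (hd u).deriv
  have hC1 : ContDiff ℝ 1 ψ := contDiff_one_iff_deriv.2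
    ⟨fun u => (hd u).differentiableAt, hderiv ▸ hWc⟩
  have hψI : ∀ s : I, ∫ t in Ici s, w t = - ψ s := fun s => by
    simp_rw [← hWw]
    rw [setIntegral_Ici_unitInterval, hψ, intervalIntegral.integral_symm]
  have key := h ψ hC1
  have hψ1 : ψ 1 = 0 := intervalIntegral.integral_same
  have hwi : Integrable w := integrable_continuousMap ⟨w, hwc⟩
  have hwF : Integrable fun t => w t * F t := integrable_continuousMap ⟨_, hwc.mul hF⟩
  have hψG : Integrable fun t : I => ψ t * G t :=
    integrable_continuousMap_mul hG ⟨fun t : I => ψ t, hC1.continuous.comp continuous_subtype_val⟩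
  have hH : Continuous fun t => ∫ s in Iic t, G s := continuous_setIntegral_Iic hG
  have hwH : Integrable fun t => w t * ∫ s in Iic t, G s :=
    integrable_continuousMap ⟨_, hwc.mul hH⟩
  have h0 : ∫ t : I, w t = - ψ 0 := by
    have := hψI 0
    rwa [show Ici (0 : I) = univ from eq_univ_of_forall fun x => x.2.1, setIntegral_univ] at this
  have hFub : ∫ t, w t * ∫ s in Iic t, G s = - ∫ s : I, ψ s * G s := by
    rw [integral_mul_setIntegral_Iic hwc hG, ← integral_neg]
    congr 1 with s
    rw [hψI]; ring
  have hsq : ∫ t : I, w t ^ 2 = 0 := by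
    have e1 : (fun t : I => w t ^ 2) =
        fun t => w t * F t - (A * w t + w t * ∫ s in Iic t, G s) := by
      ext t; simp only [hw]; ring
    have hadd : Integrable fun t => A * w t + w t * ∫ s in Iic t, G s := (hwi.const_mul A).add hwH
    rw [e1, integral_sub hwF hadd, integral_add (hwi.const_mul A) hwH,
      integral_const_mul, h0, hFub]
    rw [hψ1, hderiv] at key
    simp_rw [hWw] at key
    rw [integral_add hwF hψG] at key
    linarith
  have hsqW : ∫ x in Icc (0 : ℝ) 1, W x ^ 2 = 0 := by
    rw [← integral_subtype measurableSet_Icc (f := fun x => W x ^ 2)]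
    simpa only [hWw] using hsq
  have hae := (integral_eq_zero_iff_of_nonneg (fun x => sq_nonneg (W x))
    ((hWc.pow 2).continuousOn.integrableOn_compact isCompact_Icc)).1 hsqW
  have := Measure.eqOn_Icc_of_ae_eq volume (zero_ne_one (α := ℝ)) hae (hWc.pow 2).continuousOn
    continuousOn_const t.2
  have h2 : w t = 0 := by
    rw [← hWw]
    simpa using this
  exact sub_eq_zero.1 h2

end WeakDerivative

/-! ### The integrated continuity equation -/

section ContinuityEquation

variable {d : ℕ} {D : Set (Vec d)}

theorem IsBoundedConvexDomain.compactSpace (hD : IsBoundedConvexDomain D) : CompactSpace (Cl D) :=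
  isCompact_iff_compactSpace.1 hD.isBounded.isCompact_closure

theorem IsBoundedConvexDomain.isFiniteMeasure_leb (hD : IsBoundedConvexDomain D) :
    IsFiniteMeasure (leb D) := by
  refine ⟨?_⟩
  rw [leb, comap_subtype_coe_apply isClosed_closure.measurableSet]
  simpa using hD.isBounded.isCompact_closure.measure_lt_top

theorem continuous_gradient {g : Vec d → ℝ} (hg : ContDiff ℝ 1 g) : Continuous (gradient g) :=
  (InnerProductSpace.toDual ℝ (Vec d)).symm.continuous.comp (hg.continuous_fderiv one_ne_zero)

theorem gradient_const_mul {g : Vec d → ℝ} (hg : Differentiable ℝ g) (a : ℝ) (x : Vec d) :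
    gradient (fun y => a * g y) x = a • gradient g x := by
  simp only [gradient]
  rw [fderiv_const_mul (hg x)]
  simp

theorem measurable_inner_integral_family {K : Type*} [MeasurableSpace K]
    {ν : I → VectorMeasure K (Vec d)}
    (hν : ∀ B, MeasurableSet B → Measurable fun t => ν t B)
    {η : I × K → Vec d} (hη : Measurable η)
    {C : ℝ} (hC : ∀ p, ‖η p‖ ≤ C) :
    Measurable fun t => ∫ᵛ x, η (t, x) ∂[innerSL ℝ; ν t] := by
  have e : ∀ t, ∫ᵛ x, η (t, x) ∂[innerSL ℝ; ν t] = ∑ i, ∫ᵛ x, η (t, x) i ∂•component (ν t) i :=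
    fun t => integral_inner_eq_sum (integrable_of_measurable_bounded
      (hη.comp measurable_prodMk_left).stronglyMeasurable fun x => hC (t, x))
  simp_rw [e]
  refine Finset.measurable_sum _ fun i _ => measurable_integral_family (C := C)
    (η := fun p => η p i) (fun B hB => ?_) ?_ fun p => ?_
  · simp_rw [component_apply]
    exact (EuclideanSpace.proj (𝕜 := ℝ) i).continuous.measurable.comp (hν B hB)
  · exact (EuclideanSpace.proj (𝕜 := ℝ) i).continuous.measurable.comp hη
  · exact (PiLp.norm_apply_le _ i).trans (hC p)

theorem integrable_inner_integral_family {K : Type*} [MeasurableSpace K]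
    {ν : I → VectorMeasure K (Vec d)}
    (hν : ∀ B, MeasurableSet B → Measurable fun t => ν t B)
    (hf : ∫⁻ t, (ν t).variation univ < ∞) {η : I × K → Vec d} (hη : Measurable η)
    {C : ℝ} (hC : ∀ p, ‖η p‖ ≤ C) :
    Integrable fun t => ∫ᵛ x, η (t, x) ∂[innerSL ℝ; ν t] := by
  have e : ∀ t, ∫ᵛ x, η (t, x) ∂[innerSL ℝ; ν t] = ∑ i, ∫ᵛ x, η (t, x) i ∂•component (ν t) i :=
    fun t => integral_inner_eq_sum (integrable_of_measurable_bounded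
      (hη.comp measurable_prodMk_left).stronglyMeasurable fun x => hC (t, x))
  simp_rw [e]
  refine integrable_finsetSum _ fun i _ => integrable_integral_family (C := C)
    (η := fun p => η p i) (fun B hB => ?_) ?_ ?_ fun p => ?_
  · simp_rw [component_apply]
    exact (EuclideanSpace.proj (𝕜 := ℝ) i).continuous.measurable.comp (hν B hB)
  · exact (lintegral_mono fun t =>
      Measure.le_iff'.1 (variation_component_le (ν t) i) univ).trans_lt hf
  · exact (EuclideanSpace.proj (𝕜 := ℝ) i).continuous.measurable.comp hη
  · exact (PiLp.norm_apply_le _ i).trans (hC p)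

theorem continuous_integral_mass {K : Type*} [MeasurableSpace K] [TopologicalSpace K]
    [OpensMeasurableSpace K] [CompactSpace K] {μ : I → FiniteMeasure K} (hμ : Continuous μ) (g : C(K, ℝ)) :
    Continuous fun t => ∫ x, g x ∂(μ t : Measure K) :=
  continuous_iff_continuousAt.2 fun t => FiniteMeasure.tendsto_iff_forall_integral_tendsto.1
    (hμ.tendsto t) (BoundedContinuousFunction.mkOfCompact g)

/-- The time derivative of `∫ g dμ_t`. -/
def flux (c : Curve D) (g : Vec d → ℝ) (t : I) : ℝ :=
  (∫ᵛ x : Cl D, gradient g (x : Vec d) ∂[innerSL ℝ; c.momentum t])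
    + ∫ᵛ x : Cl D, g (x : Vec d) ∂•(c.source t)

theorem exists_norm_le_continuousMap {K E : Type*} [TopologicalSpace K] [CompactSpace K]
    [NormedAddCommGroup E] {f : K → E} (hf : Continuous f) : ∃ C, ∀ x, ‖f x‖ ≤ C :=
  ⟨_, (ContinuousMap.mk f hf).norm_coe_le_norm⟩

theorem IsDisintegration.integrable_flux [CompactSpace (Cl D)] {T : Triple D} {c : Curve D}
    (h : IsDisintegration T c) {g : Vec d → ℝ} (hg : ContDiff ℝ 1 g) : Integrable (flux c g) := by
  have c1 : Continuous fun p : Cyl D => gradient g p.2 :=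
    (continuous_gradient hg).comp (continuous_subtype_val.comp continuous_snd)
  have c2 : Continuous fun p : Cyl D => g p.2 :=
    hg.continuous.comp (continuous_subtype_val.comp continuous_snd)
  obtain ⟨C1, hC1⟩ := exists_norm_le_continuousMap c1
  obtain ⟨C2, hC2⟩ := exists_norm_le_continuousMap c2
  have i1 := integrable_inner_integral_family h.measurable_momentum h.finite_momentum
    c1.measurable hC1
  have i2 := integrable_integral_family h.measurable_source h.finite_source c2.measurable hC2
  exact i1.add i2

/-- Testing with products ψ(t) g(x) gives the weak derivative of t ↦ ∫ g dμ_t, including its initial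
value. Continuity of the curve makes the identity valid for every t. -/
theorem IsWeakSolution.integral_mass_eq [CompactSpace (Cl D)] {μA μB : FiniteMeasure (Cl D)}
    {T : Triple D} {c : Curve D} (h : IsWeakSolution μA μB T c) {g : Vec d → ℝ}
    (hg : ContDiff ℝ 1 g) (t : I) :
    ∫ x : Cl D, g x ∂(c.mass t : Measure (Cl D)) =
      ∫ x : Cl D, g x ∂(μA : Measure (Cl D)) + ∫ s in Iic t, flux c g s := by
  refine eq_add_setIntegral_of_weak_derivative
    (F := fun t => ∫ x : Cl D, g x ∂(c.mass t : Measure (Cl D)))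
    (B := ∫ x : Cl D, g x ∂(μB : Measure (Cl D)))
    (continuous_integral_mass h.disintegration.continuous_mass
      ⟨fun x : Cl D => g x, hg.continuous.comp continuous_subtype_val⟩)
    (h.disintegration.integrable_flux hg) (fun ψ hψ => ?_) t
  have key := h.equation (fun p => ψ p.1 * g p.2) ((hψ.comp contDiff_fst).mul (hg.comp contDiff_snd))
  have hgd := hg.differentiable one_ne_zero
  have hψd := hψ.differentiable one_ne_zero
  simp only [integral_const_mul, gradient_const_mul hgd, VectorMeasure.integral_fun_smul] at key
  rw [key]
  congr 3
  ext t
  have e1 : ∀ x : Cl D, deriv (fun s : ℝ => ψ s * g x) (t : ℝ) = deriv ψ t * g x := fun x =>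
    deriv_mul_const (hψd _) _
  have e2 : ∫ᵛ x : Cl D, ψ t * g x ∂•(c.source t) = ψ t * ∫ᵛ x : Cl D, g x ∂•(c.source t) :=
    VectorMeasure.integral_fun_smul _ _ (ψ t) _
  simp only [e1, integral_const_mul, e2, flux, smul_eq_mul]
  ring

end ContinuityEquation

/-! ### Uniform absolute continuity in time and weak-* limits -/

section UniformIntegrability

variable {K : Type*} [MeasurableSpace K]

/-- The time marginals of the measures `P i` are uniformly absolutely continuous with respect to
Lebesgue measure. -/
def UniformlyAC {ι : Type*} (P : ι → Measure (I × K)) : Prop :=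
  ∀ ε : ℝ, 0 < ε → ∃ B : NNReal, ∀ i (J : Set I), MeasurableSet J →
    P i (J ×ˢ univ) ≤ ENNReal.ofReal ε + B * volume J

theorem UniformlyAC.mono {ι : Type*} {P Q : ι → Measure (I × K)} (h : UniformlyAC P)
    (hQ : ∀ i, Q i ≤ P i) : UniformlyAC Q := fun ε hε => by
  obtain ⟨B, hB⟩ := h ε hε
  exact ⟨B, fun i J hJ => (Measure.le_iff'.1 (hQ i) _).trans (hB i J hJ)⟩

theorem UniformlyAC.add {ι : Type*} {P Q : ι → Measure (I × K)} (hP : UniformlyAC P)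
    (hQ : UniformlyAC Q) : UniformlyAC fun i => P i + Q i := fun ε hε => by
  obtain ⟨B, hB⟩ := hP (ε / 2) (by positivity)
  obtain ⟨B', hB'⟩ := hQ (ε / 2) (by positivity)
  refine ⟨B + B', fun i J hJ => ?_⟩
  rw [Measure.add_apply]
  refine (add_le_add (hB i J hJ) (hB' i J hJ)).trans (le_of_eq ?_)
  nth_rewrite 3 [← add_halves ε]
  rw [ENNReal.ofReal_add (by positivity) (by positivity), ENNReal.coe_add, add_mul]
  ring

theorem UniformlyAC.exists_mass_le {ι : Type*} {P : ι → Measure (I × K)} (h : UniformlyAC P) :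
    ∃ M : NNReal, ∀ i, P i univ ≤ M := by
  obtain ⟨B, hB⟩ := h 1 one_pos
  refine ⟨1 + B, fun i => ?_⟩
  have := hB i univ MeasurableSet.univ
  simpa using this

theorem exists_ennreal_pos_mul_le (B : NNReal) {ε : ℝ} (hε : 0 < ε) :
    ∃ η : ℝ≥0∞, η ≠ 0 ∧ B * η ≤ ENNReal.ofReal ε := by
  refine ⟨ENNReal.ofReal (ε / (B + 1)), by simp; positivity, ?_⟩
  rw [← ENNReal.ofReal_coe_nnreal, ← ENNReal.ofReal_mul B.coe_nonneg]
  refine ENNReal.ofReal_le_ofReal ?_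
  have : (0 : ℝ) ≤ B := B.coe_nonneg
  rw [mul_div_assoc', div_le_iff₀ (by positivity)]
  nlinarith

theorem enorm_signed_integral_le_of_support {X : Type*} [MeasurableSpace X] (τ : SignedMeasure X)
    {η : X → ℝ} {C : ℝ} {E : Set X} (hE : MeasurableSet E) (hC : ∀ x, ‖η x‖ ≤ C)
    (h0 : ∀ x ∉ E, η x = 0) :
    ‖∫ᵛ x, η x ∂•τ‖ₑ ≤ ENNReal.ofReal C * τ.variation E := by
  have h := VectorMeasure.enorm_integral_le_lintegral_enorm (μ := τ)
    (B := ContinuousLinearMap.lsmul ℝ ℝ) (f := η)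
  have h1 : ‖(ContinuousLinearMap.lsmul ℝ ℝ : ℝ →L[ℝ] ℝ →L[ℝ] ℝ)‖ₑ ≤ 1 := by
    rw [← ofReal_norm, ← ENNReal.ofReal_one]
    exact ENNReal.ofReal_le_ofReal ContinuousLinearMap.opNorm_lsmul_le
  refine h.trans ((mul_le_mul_left h1 _).trans ?_)
  rw [one_mul, ← lintegral_indicator_const hE]
  refine lintegral_mono fun x => ?_
  by_cases hx : x ∈ E
  · rw [indicator_of_mem hx, ← ofReal_norm]
    exact ENNReal.ofReal_le_ofReal (hC x)
  · simp [h0 x hx]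

variable [MetricSpace K] [CompactSpace K] [BorelSpace K]

/-- Squeeze a Urysohn function of time alone between a compact subset of J and an open superset U.
Half of ε comes from the uniform bound, the other half pays for |U| exceeding |J| by at most η. -/
theorem UniformlyAC.of_tendsto {P : ℕ → FiniteMeasure (I × K)} {P' : FiniteMeasure (I × K)}
    (h : UniformlyAC fun n => (P n : Measure (I × K))) (hP : Tendsto P atTop (𝓝 P')) :
    UniformlyAC fun _ : Unit => (P' : Measure (I × K)) := by
  intro ε hε
  obtain ⟨B, hB⟩ := h (ε / 2) (by positivity)
  refine ⟨B, fun _ J hJ => ?_⟩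
  obtain ⟨η, hη, hBη⟩ := exists_ennreal_pos_mul_le B (half_pos hε)
  obtain ⟨U, hJU, hU, hUv⟩ := exists_isOpen_le_add J volume hη
  have e : (P' : Measure (I × K)) (J ×ˢ univ) = ((P' : Measure (I × K)).map Prod.fst) J := by
    rw [Measure.map_apply measurable_fst hJ, prod_univ]
  rw [e]
  refine le_of_forall_lt fun a ha => ?_
  obtain ⟨F, hFJ, hF, haF⟩ := hJ.exists_lt_isCompact ha
  obtain ⟨ψ, hψ0, hψ1, hψ⟩ := exists_continuous_zero_one_of_isClosed hU.isClosed_compl hF.isClosed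
    (disjoint_compl_left.mono_right (hFJ.trans hJU))
  set f : C(I × K, ℝ) := ψ.comp ⟨Prod.fst, continuous_fst⟩ with hf
  have hlim := FiniteMeasure.tendsto_iff_forall_integral_tendsto.1 hP
    (BoundedContinuousFunction.mkOfCompact f)
  have hlim2 := ENNReal.tendsto_ofReal hlim
  have hb : ∀ n, ENNReal.ofReal (∫ p, f p ∂(P n : Measure (I × K))) ≤
      ENNReal.ofReal ε + B * volume J := fun n => by
    have h1 : ∫ p, f p ∂(P n : Measure (I × K)) ≤
        ∫ p, (U ×ˢ univ).indicator (fun _ => (1 : ℝ)) p ∂(P n : Measure (I × K)) := by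
      refine integral_mono (integrable_continuousMap f)
        ((integrable_const _).indicator (hU.measurableSet.prod MeasurableSet.univ)) fun p => ?_
      by_cases hp : p.1 ∈ U
      · rw [indicator_of_mem (by exact ⟨hp, trivial⟩)]
        exact (hψ p.1).2
      · rw [indicator_of_notMem (fun h => hp h.1)]
        exact (hψ0 hp).le
    rw [integral_indicator_const _ (hU.measurableSet.prod MeasurableSet.univ), smul_eq_mul,
      mul_one] at h1
    refine (ENNReal.ofReal_le_ofReal h1).trans ?_
    rw [ofReal_measureReal]
    refine (hB n U hU.measurableSet).trans ?_
    calc ENNReal.ofReal (ε / 2) + B * volume U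
        ≤ ENNReal.ofReal (ε / 2) + B * (volume J + η) := by gcongr
      _ = ENNReal.ofReal (ε / 2) + B * volume J + B * η := by rw [mul_add, add_assoc]
      _ ≤ ENNReal.ofReal (ε / 2) + B * volume J + ENNReal.ofReal (ε / 2) := by gcongr
      _ = ENNReal.ofReal ε + B * volume J := by
        nth_rewrite 3 [← add_halves ε]
        rw [ENNReal.ofReal_add (by positivity) (by positivity)]
        ring
  refine haF.trans_le (le_trans ?_ (le_of_tendsto hlim2 (Eventually.of_forall hb)))
  have h2 : ∫ p, (F ×ˢ univ).indicator (fun _ => (1 : ℝ)) p ∂(P' : Measure (I × K)) ≤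
      ∫ p, f p ∂(P' : Measure (I × K)) := by
    refine integral_mono ((integrable_const _).indicator (hF.measurableSet.prod MeasurableSet.univ))
      (integrable_continuousMap f) fun p => ?_
    by_cases hp : p.1 ∈ F
    · rw [indicator_of_mem (by exact ⟨hp, trivial⟩)]
      exact (hψ1 hp).ge
    · rw [indicator_of_notMem (fun h => hp h.1)]
      exact (hψ p.1).1
  rw [integral_indicator_const _ (hF.measurableSet.prod MeasurableSet.univ), smul_eq_mul,
    mul_one] at h2
  rw [Measure.map_apply measurable_fst hF.measurableSet, ← prod_univ, ← ofReal_measureReal]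
  exact ENNReal.ofReal_le_ofReal h2

/-- Total masses stay in [0, M] and the normalised measures in the compact space of probability
measures. Compactness of the finite product extracts one subsequence for all indices. -/
theorem exists_subseq_tendsto_finiteMeasure {ι Y : Type*} [Finite ι] [MetricSpace Y]
    [CompactSpace Y] [MeasurableSpace Y] [BorelSpace Y] [Nonempty Y]
    (P : ℕ → ι → FiniteMeasure Y) {M : NNReal} (hM : ∀ n i, (P n i).mass ≤ M) :
    ∃ (φ : ℕ → ℕ) (P' : ι → FiniteMeasure Y), StrictMono φ ∧
      ∀ i, Tendsto (fun n => P (φ n) i) atTop (𝓝 (P' i)) := by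
  have : Fintype ι := Fintype.ofFinite ι
  obtain ⟨⟨Q, m⟩, φ, hφ, hlim⟩ := CompactSpace.tendsto_subseq
    (X := (ι → ProbabilityMeasure Y) × (ι → Icc (0 : NNReal) M))
    fun n => (fun i => (P n i).normalize, fun i => ⟨(P n i).mass, zero_le, hM n i⟩)
  have hQ : ∀ i, Tendsto (fun n => (P (φ n) i).normalize) atTop (𝓝 (Q i)) := fun i =>
    ((continuous_apply i).comp continuous_fst).tendsto (Q, m) |>.comp hlim
  have hm : ∀ i, Tendsto (fun n => (P (φ n) i).mass) atTop (𝓝 (m i : NNReal)) := fun i => by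
    have hc : Continuous fun q : (ι → ProbabilityMeasure Y) × (ι → Icc (0 : NNReal) M) =>
      (q.2 i : NNReal) := by fun_prop
    exact (hc.tendsto (Q, m)).comp hlim
  refine ⟨φ, fun i => (m i : NNReal) • (Q i).toFiniteMeasure, hφ, fun i => ?_⟩
  refine FiniteMeasure.tendsto_iff_forall_integral_tendsto.2 fun f => ?_
  have h1 := (NNReal.tendsto_coe.2 (hm i)).mul
    (ProbabilityMeasure.tendsto_iff_forall_integral_tendsto.1 (hQ i) f)
  have e : ∀ (m : NNReal) (Q : ProbabilityMeasure Y),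
      ∫ y, f y ∂((m • Q.toFiniteMeasure : FiniteMeasure Y) : Measure Y) =
        m * ∫ y, f y ∂(Q : Measure Y) := fun m Q => by
    rw [FiniteMeasure.toMeasure_smul]
    exact integral_smul_nnreal_measure _ _
  rw [e]
  refine h1.congr fun n => ?_
  rw [← e, ← FiniteMeasure.self_eq_mass_smul_normalize]

/-- The Jordan parts converge separately. Their limits need not be mutually singular, but their sum
dominates the variation of the limit, so uniform absolute continuity is inherited from positive
measures. -/
theorem exists_subseq_tendsto_signed {ι : Type*} [Finite ι] [Nonempty K]
    (τ : ι → ℕ → SignedMeasure (I × K)) (h : ∀ i, UniformlyAC fun n => (τ i n).variation) :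
    ∃ (φ : ℕ → ℕ) (τ' : ι → SignedMeasure (I × K)), StrictMono φ ∧
      ∀ i, UniformlyAC (fun _ : Unit => (τ' i).variation) ∧ ∀ f : C(I × K, ℝ),
        Tendsto (fun n => ∫ᵛ p, f p ∂•(τ i (φ n))) atTop (𝓝 (∫ᵛ p, f p ∂•(τ' i))) := by
  set P : ℕ → ι × Bool → FiniteMeasure (I × K) := fun n ib =>
    if ib.2 then ⟨(τ ib.1 n).toJordanDecomposition.posPart, inferInstance⟩
    else ⟨(τ ib.1 n).toJordanDecomposition.negPart, inferInstance⟩ with hP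
  have hle : ∀ i b n, (P n (i, b) : Measure (I × K)) ≤ (τ i n).variation := fun i b n => by
    rw [← SignedMeasure.totalVariation_eq_variation, SignedMeasure.totalVariation]
    cases b
    · exact Measure.le_add_left le_rfl
    · exact Measure.le_add_right le_rfl
  choose M hM using fun i => (h i).exists_mass_le
  have : Fintype ι := Fintype.ofFinite ι
  obtain ⟨φ, P', hφ, hlim⟩ := exists_subseq_tendsto_finiteMeasure P (M := ∑ i, M i)
    fun n ib => by
      have h1 : (P n ib : Measure (I × K)) univ ≤ M ib.1 :=
        (Measure.le_iff'.1 (hle ib.1 ib.2 n) univ).trans (hM ib.1 n)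
      rw [← FiniteMeasure.ennreal_mass] at h1
      exact (ENNReal.coe_le_coe.1 h1).trans
        (Finset.single_le_sum (f := M) (fun _ _ => zero_le) (Finset.mem_univ _))
  have hdiff : ∀ (f : C(I × K, ℝ)) (A B : Measure (I × K)) [IsFiniteMeasure A] [IsFiniteMeasure B],
      ∫ᵛ p, f p ∂•(A.toSignedMeasure - B.toSignedMeasure) = ∫ p, f p ∂A - ∫ p, f p ∂B := by
    intro f A B _ _
    have hflip : (ContinuousLinearMap.lsmul ℝ ℝ : ℝ →L[ℝ] ℝ →L[ℝ] ℝ).flip =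
        ContinuousLinearMap.lsmul ℝ ℝ := by ext; simp
    rw [VectorMeasure.integral_sub_vectorMeasure (integrable_continuousMap f)
      (integrable_continuousMap f), ← hflip, VectorMeasure.integral_toSignedMeasure,
      VectorMeasure.integral_toSignedMeasure]
  refine ⟨φ, fun i => (P' (i, true) : Measure (I × K)).toSignedMeasure
    - (P' (i, false) : Measure (I × K)).toSignedMeasure, hφ, fun i => ⟨?_, fun f => ?_⟩⟩
  · have hac : ∀ b, UniformlyAC fun _ : Unit => (P' (i, b) : Measure (I × K)) := fun b =>
      UniformlyAC.of_tendsto (P := fun n => P (φ n) (i, b)) (fun ε hε => by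
        obtain ⟨B, hB⟩ := (h i).mono (fun n => hle i b n) ε hε
        exact ⟨B, fun n => hB (φ n)⟩) (hlim (i, b))
    refine ((hac true).add (hac false)).mono fun _ => ?_
    refine VectorMeasure.variation_sub_le.trans ?_
    rw [Measure.variation_toSignedMeasure, Measure.variation_toSignedMeasure]
  · rw [hdiff]
    have ht := fun b => FiniteMeasure.tendsto_iff_forall_integral_tendsto.1 (hlim (i, b))
      (BoundedContinuousFunction.mkOfCompact f)
    refine ((ht true).sub (ht false)).congr fun n => ?_
    have e := (τ i (φ n)).toSignedMeasure_toJordanDecomposition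
    rw [← e, JordanDecomposition.toSignedMeasure, hdiff]
    rfl

/-- Replacing the indicator of S by a Urysohn function of time changes the integrand only on (U \ S)
× K, a set short in time, where all variations are uniformly small. -/
theorem tendsto_integral_indicator {τ : ℕ → SignedMeasure (I × K)} {τ' : SignedMeasure (I × K)}
    (h : UniformlyAC fun n => (τ n).variation) (h' : UniformlyAC fun _ : Unit => τ'.variation)
    (hlim : ∀ f : C(I × K, ℝ), Tendsto (fun n => ∫ᵛ p, f p ∂•(τ n)) atTop (𝓝 (∫ᵛ p, f p ∂•τ')))
    {S : Set I} (hS : IsClosed S) (f : C(I × K, ℝ)) :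
    Tendsto (fun n => ∫ᵛ p, (S ×ˢ univ).indicator f p ∂•(τ n)) atTop
      (𝓝 (∫ᵛ p, (S ×ˢ univ).indicator f p ∂•τ')) := by
  have hmS : MeasurableSet (S ×ˢ (univ : Set K)) := hS.measurableSet.prod MeasurableSet.univ
  rw [Metric.tendsto_atTop]
  intro ε hε
  set C := ‖f‖ + 1 with hCdef
  have hCpos : 0 < C := by positivity
  -- On U \ S the integrand is at most `C`, and both terms of the uniform bound are at most `e`; the
  -- error is then 2Ce = ε / 3 for each of τ_n and τ'.
  set e := ε / (6 * C) with he
  have hepos : 0 < e := by positivity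
  obtain ⟨B₁, hB₁⟩ := h e hepos
  obtain ⟨B₂, hB₂⟩ := h' e hepos
  obtain ⟨η, hη, hBη⟩ := exists_ennreal_pos_mul_le (B₁ + B₂) hepos
  obtain ⟨U, hSU, hU, hUv⟩ := exists_isOpen_le_add S volume hη
  have hvol : volume (U \ S) ≤ η := by
    rw [measure_sdiff hSU hS.measurableSet.nullMeasurableSet (measure_ne_top _ _)]
    exact tsub_le_iff_left.2 hUv
  have hUS : MeasurableSet (U \ S) := hU.measurableSet.diff hS.measurableSet
  obtain ⟨ψ, hψ0, hψ1, hψ⟩ := exists_continuous_zero_one_of_isClosed hU.isClosed_compl hS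
    (disjoint_compl_left.mono_right hSU)
  set g : C(I × K, ℝ) := ψ.comp ⟨Prod.fst, continuous_fst⟩ * f with hg
  have err : ∀ (θ : SignedMeasure (I × K)) (B : NNReal), B ≤ B₁ + B₂ →
      θ.variation ((U \ S) ×ˢ univ) ≤ ENNReal.ofReal e + B * volume (U \ S) →
      |∫ᵛ p, (S ×ˢ univ).indicator f p ∂•θ - ∫ᵛ p, g p ∂•θ| ≤ ε / 3 := by
    intro θ B hB hθ
    have hCf : ∀ p, ‖f p‖ ≤ C := fun p => (f.norm_coe_le_norm p).trans (by simp [hCdef])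
    rw [← VectorMeasure.integral_fun_sub
      (signed_integrable_of_bounded θ (f.continuous.measurable.indicator hmS)
        fun p => (norm_indicator_le_norm_self _ _).trans (hCf p))
      (integrable_continuousMap g)]
    have := enorm_signed_integral_le_of_support θ (hUS.prod MeasurableSet.univ) (C := C)
      (η := fun p => (S ×ˢ univ).indicator f p - g p) (fun p => ?_) fun p hp => ?_
    · have h2 : ‖∫ᵛ p, (S ×ˢ univ).indicator f p - g p ∂•θ‖ₑ ≤ ENNReal.ofReal (ε / 3) := by
        refine this.trans ?_
        calc ENNReal.ofReal C * θ.variation ((U \ S) ×ˢ univ)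
            ≤ ENNReal.ofReal C * (ENNReal.ofReal e + B * volume (U \ S)) := by gcongr
          _ ≤ ENNReal.ofReal C * (ENNReal.ofReal e + (B₁ + B₂ : NNReal) * η) := by gcongr
          _ ≤ ENNReal.ofReal C * (ENNReal.ofReal e + ENNReal.ofReal e) := by gcongr
          _ = ENNReal.ofReal (ε / 3) := by
            rw [← ENNReal.ofReal_add hepos.le hepos.le, ← ENNReal.ofReal_mul hCpos.le]
            congr 1
            rw [he]; field_simp; norm_num
      rw [← ofReal_norm, ENNReal.ofReal_le_ofReal_iff (by positivity)] at h2
      exact h2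
    · by_cases hp : p.1 ∈ S
      · rw [indicator_of_mem (by exact ⟨hp, trivial⟩)]
        have : g p = f p := by simp [hg, hψ1 hp]
        rw [this, sub_self, norm_zero]; exact hCpos.le
      · rw [indicator_of_notMem (fun h => hp h.1), zero_sub, norm_neg]
        have : g p = ψ p.1 * f p := rfl
        rw [this, norm_mul, Real.norm_of_nonneg (hψ p.1).1]
        exact (mul_le_of_le_one_left (norm_nonneg _) (hψ p.1).2).trans (hCf p)
    · by_cases hp1 : p.1 ∈ S
      · rw [indicator_of_mem (by exact ⟨hp1, trivial⟩)]
        have : g p = f p := by simp [hg, hψ1 hp1]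
        rw [this, sub_self]
      · have hpU : p.1 ∉ U := fun hU => hp ⟨⟨hU, hp1⟩, trivial⟩
        rw [indicator_of_notMem (fun h => hp1 h.1)]
        have : g p = ψ p.1 * f p := rfl
        rw [this, hψ0 hpU]; simp
  obtain ⟨N, hN⟩ := Metric.tendsto_atTop.1 (hlim g) (ε / 3) (by positivity)
  refine ⟨N, fun n hn => ?_⟩
  have h1 := err (τ n) B₁ (le_add_of_nonneg_right zero_le) (hB₁ n _ hUS)
  have h2 := err τ' B₂ (le_add_of_nonneg_left zero_le) (hB₂ () _ hUS)
  have h3 := hN n hn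
  rw [Real.dist_eq] at h3 ⊢
  rw [abs_lt] at *
  rw [abs_le] at h1 h2
  constructor <;> linarith [h1.1, h1.2, h2.1, h2.2, h3.1, h3.2]

end UniformIntegrability

/-! ### Uniform bounds along a sequence of bounded energy -/

section Bounds

variable {d : ℕ} {X : Type*} [MeasurableSpace X]

theorem IsSourcePenalty.exists_variation_le_energyDensity (d : ℕ) {r : ℝ → ℝ}
    (hr : IsSourcePenalty r) {δ : ℝ} (hδ : 0 < δ) (l : Measure X) [IsFiniteMeasure l] {ε : ℝ}
    (hε : 0 < ε) : ∃ b : NNReal, ∀ (μ : FiniteMeasure X) (ν : VectorMeasure X (Vec d))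
      (ζ : SignedMeasure X), ζ.variation univ ≤ ENNReal.ofReal ε * energyDensity δ r l μ ν ζ + b := by
  obtain ⟨κ, C, hκ, hC, h⟩ := hr.exists_variation_le (X := X) (d := d)
  -- Chosen so that κ e δ ≤ ε; the summand 1 covers κ = 0.
  set e := ε / (κ * δ + 1) with he
  have hepos : 0 < e := by positivity
  set b : ℝ≥0∞ := ENNReal.ofReal κ * ENNReal.ofReal (1 / e) + ENNReal.ofReal C * l univ with hb
  have hbt : b ≠ ∞ := by finiteness
  refine ⟨b.toNNReal, fun μ ν ζ => ?_⟩
  rw [ENNReal.coe_toNNReal hbt]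
  refine (h hepos l μ ν ζ).trans ?_
  rw [mul_add, add_assoc]
  refine add_le_add_left ?_ b
  have hS : sourceAction r l μ ν ζ ≤ ENNReal.ofReal δ * energyDensity δ r l μ ν ζ := by
    calc sourceAction r l μ ν ζ
        = ENNReal.ofReal δ * (ENNReal.ofReal (1 / δ) * sourceAction r l μ ν ζ) := by
          rw [← mul_assoc, ← ENNReal.ofReal_mul hδ.le, mul_one_div_cancel hδ.ne',
            ENNReal.ofReal_one, one_mul]
      _ ≤ _ := by
          gcongr
          exact le_add_self
  calc ENNReal.ofReal κ * (ENNReal.ofReal e * sourceAction r l μ ν ζ)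
      ≤ ENNReal.ofReal κ * (ENNReal.ofReal e * (ENNReal.ofReal δ * energyDensity δ r l μ ν ζ)) := by
        gcongr
    _ = ENNReal.ofReal (κ * e * δ) * energyDensity δ r l μ ν ζ := by
        rw [ENNReal.ofReal_mul (by positivity), ENNReal.ofReal_mul hκ]; ring
    _ ≤ ENNReal.ofReal ε * energyDensity δ r l μ ν ζ := by
        gcongr
        rw [he]
        have : κ * (ε / (κ * δ + 1)) * δ = ε * (κ * δ) / (κ * δ + 1) := by ring
        rw [this, div_le_iff₀ (by positivity)]
        nlinarith

theorem setLIntegral_le_mul_add {f E : I → ℝ≥0∞} {ε : ℝ} {b : ℝ≥0∞}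
    (h : ∀ t, f t ≤ ENNReal.ofReal ε * E t + b) (J : Set I) :
    ∫⁻ t in J, f t ≤ ENNReal.ofReal ε * (∫⁻ t, E t) + b * volume J := by
  refine (lintegral_mono fun t => h t).trans ?_
  rw [lintegral_add_right _ measurable_const, lintegral_const_mul' _ _ ENNReal.ofReal_ne_top,
    setLIntegral_const]
  gcongr
  exact Measure.restrict_le_self

variable {D : Set (Vec d)}

/-- A de la Vallée-Poussin argument: over J the energy contributes at most its small coefficient
times C, and the constant contributes b |J|. -/
theorem IsSignedDisintegration.uniformlyAC {K : Type*} [MeasurableSpace K] {ι : Type*}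
    {τ : ι → SignedMeasure (I × K)} {s : ι → I → SignedMeasure K}
    (h : ∀ n, IsSignedDisintegration (τ n) (s n)) {E : ι → I → ℝ≥0∞} {C : ℝ}
    (hE : ∀ n, ∫⁻ t, E n t ≤ ENNReal.ofReal C)
    (hs : ∀ ε > 0, ∃ b : NNReal, ∀ n t, (s n t).variation univ ≤ ENNReal.ofReal ε * E n t + b) :
    UniformlyAC fun n => (τ n).variation := by
  intro ε hε
  set e := ε / (2 * (|C| + 1)) with he
  obtain ⟨b, hb⟩ := hs e (by positivity)
  refine ⟨2 * b, fun n J hJ => ((h n).variation_le hJ).trans ?_⟩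
  calc 2 * ∫⁻ t in J, (s n t).variation univ
      ≤ 2 * (ENNReal.ofReal e * (∫⁻ t, E n t) + b * volume J) := by
        gcongr; exact setLIntegral_le_mul_add (hb n) J
    _ ≤ 2 * (ENNReal.ofReal e * ENNReal.ofReal |C| + b * volume J) := by
        gcongr; exact (hE n).trans (ENNReal.ofReal_le_ofReal (le_abs_self C))
    _ = ENNReal.ofReal (2 * (e * |C|)) + (2 * b : NNReal) * volume J := by
        rw [ENNReal.ofReal_mul (by norm_num), ENNReal.ofReal_mul (by positivity)]
        push_cast
        rw [ENNReal.ofReal_ofNat]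
        ring
    _ ≤ _ := by
        gcongr
        rw [he]
        have : 2 * (ε / (2 * (|C| + 1)) * |C|) = ε * |C| / (|C| + 1) := by field_simp
        rw [this, div_le_iff₀ (by positivity)]
        nlinarith

variable {r : ℝ → ℝ} {δ : ℝ} {μA μB : FiniteMeasure (Cl D)} {T : ℕ → Triple D} {c : ℕ → Curve D}
  {C : ℝ}

theorem uniformlyAC_source [IsFiniteMeasure (leb D)] (hr : IsSourcePenalty r) (hδ : 0 < δ)
    (hT : ∀ n, IsDisintegration (T n) (c n)) (hC : ∀ n, pathEnergy δ r (c n) ≤ ENNReal.ofReal C) :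
    UniformlyAC fun n => (T n).source.variation := by
  refine IsSignedDisintegration.uniformlyAC (fun n => (hT n).source_isSignedDisintegration) hC
    fun ε hε => ?_
  obtain ⟨b, hb⟩ := hr.exists_variation_le_energyDensity d hδ (leb D) hε
  exact ⟨b, fun n t => hb _ _ _⟩

/-- With g = 1 the momentum drops out of the integrated equation, so the mass changes only by the
source, which the energy controls. -/
theorem exists_mass_le [CompactSpace (Cl D)] [IsFiniteMeasure (leb D)] (hr : IsSourcePenalty r)
    (hδ : 0 < δ) (hT : ∀ n, IsWeakSolution μA μB (T n) (c n))
    (hC : ∀ n, pathEnergy δ r (c n) ≤ ENNReal.ofReal C) :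
    ∃ M : NNReal, ∀ n t, ((c n).mass t).mass ≤ M := by
  obtain ⟨b, hb⟩ := hr.exists_variation_le_energyDensity d hδ (leb D) one_pos
  refine ⟨μA.mass + (C.toNNReal + b), fun n t => ?_⟩
  have h1 := (hT n).integral_mass_eq (g := fun _ => 1) contDiff_const t
  have h2 : ∀ μ : FiniteMeasure (Cl D), ∫ _ : Cl D, (1 : ℝ) ∂(μ : Measure (Cl D)) = μ.mass :=
    fun μ => by simp [measureReal_def, FiniteMeasure.mass]; rfl
  rw [h2, h2] at h1
  have h3 : ‖∫ s in Iic t, flux (c n) (fun _ => 1) s‖ₑ ≤ (C.toNNReal + b : NNReal) := by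
    refine (enorm_integral_le_lintegral_enorm _).trans ?_
    refine (lintegral_mono' Measure.restrict_le_self le_rfl).trans ?_
    have h4 : ∀ s, ‖flux (c n) (fun _ => 1) s‖ₑ ≤ ENNReal.ofReal 1 *
        energyDensity δ r (leb D) ((c n).mass s) ((c n).momentum s) ((c n).source s) + b := by
      intro s
      refine le_trans ?_ (hb _ _ _)
      have : flux (c n) (fun _ => 1) s = ∫ᵛ _ : Cl D, (1 : ℝ) ∂•((c n).source s) := by
        simp [flux, gradient_fun_const]
      rw [this]
      simpa using enorm_signed_integral_le ((c n).source s) (η := fun _ => (1 : ℝ)) (C := 1)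
        fun _ => by simp
    have h5 := setLIntegral_le_mul_add h4 univ
    rw [setLIntegral_univ] at h5
    refine h5.trans ?_
    simp only [ENNReal.ofReal_one, one_mul, measure_univ, mul_one, ENNReal.coe_add]
    gcongr
    exact hC n
  have h6 : ∫ s in Iic t, flux (c n) (fun _ => 1) s ≤ (C.toNNReal + b : NNReal) := by
    refine (le_abs_self _).trans ?_
    rw [← ofReal_norm] at h3
    rw [← Real.norm_eq_abs]
    exact ENNReal.ofReal_le_coe.1 h3 |>.trans le_rfl
  have : (((c n).mass t).mass : ℝ) ≤ (μA.mass + (C.toNNReal + b) : NNReal) := by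
    rw [h1, NNReal.coe_add]
    gcongr
  exact_mod_cast this

theorem uniformlyAC_momentum [CompactSpace (Cl D)] [IsFiniteMeasure (leb D)]
    (hT : ∀ n, IsDisintegration (T n) (c n)) (hC : ∀ n, pathEnergy δ r (c n) ≤ ENNReal.ofReal C)
    {M : NNReal} (hM : ∀ n t, ((c n).mass t).mass ≤ M) (i : Fin d) :
    UniformlyAC fun n => (component (T n).momentum i).variation := by
  refine IsSignedDisintegration.uniformlyAC
    (fun n => (hT n).component_isSignedDisintegration i) hC fun ε hε => ?_
  -- The term (2/ε) μ_t(D̄) is a constant only thanks to the uniform mass bound `M`.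
  refine ⟨(2 / ε).toNNReal * M, fun n t => ?_⟩
  refine (Measure.le_iff'.1 (variation_component_le _ i) univ).trans
    ((variation_le_transportAction hε (leb D) ((c n).mass t) _ ((c n).source t)).trans ?_)
  rw [ENNReal.coe_mul, ← FiniteMeasure.ennreal_mass]
  gcongr
  · exact le_self_add
  · exact le_rfl
  · exact hM n t

end Bounds

/-! ### Disintegration with respect to Lebesgue measure in time -/

section Disintegration

open ProbabilityTheory

variable {K : Type*} [MeasurableSpace K]

theorem exists_kernel_of_fst_absolutelyContinuous [StandardBorelSpace K] [Nonempty K]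
    (l : Measure (I × K)) [IsFiniteMeasure l] (hl : l.fst ≪ volume) :
    ∃ κ : Kernel I K, IsSFiniteKernel κ ∧ (∀ t, IsFiniteMeasure (κ t)) ∧ l = volume ⊗ₘ κ := by
  -- The conditional kernel is rescaled by the density of the time marginal. Truncating the value ∞
  -- to 0 changes a null set only and makes the kernel finite at every t.
  set ρ : I → NNReal := fun t => (l.fst.rnDeriv volume t).toNNReal with hρ
  have hρm : Measurable ρ := (Measure.measurable_rnDeriv _ _).ennreal_toNNReal
  have hfst : l.fst = volume.withDensity fun t => (ρ t : ℝ≥0∞) := by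
    conv_lhs => rw [← Measure.withDensity_rnDeriv_eq _ _ hl]
    refine withDensity_congr_ae ?_
    filter_upwards [Measure.rnDeriv_lt_top l.fst volume] with t ht
    exact (ENNReal.coe_toNNReal ht.ne).symm
  set κ : Kernel I K := l.condKernel.withDensity fun t _ => (ρ t : ℝ≥0∞) with hκ
  have hum : Measurable (Function.uncurry fun (t : I) (_ : K) => (ρ t : ℝ≥0∞)) :=
    (hρm.comp measurable_fst).coe_nnreal_ennreal
  have hκa : ∀ t, κ t = (ρ t : ℝ≥0∞) • l.condKernel t := fun t => by
    rw [hκ, Kernel.withDensity_apply _ hum, withDensity_const]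
  have hsf : IsSFiniteKernel κ := Kernel.IsSFiniteKernel.withDensity _ fun _ _ => ENNReal.coe_ne_top
  refine ⟨κ, hsf, fun t => ⟨?_⟩, ?_⟩
  · rw [hκa, Measure.smul_apply, smul_eq_mul]
    exact ENNReal.mul_lt_top ENNReal.coe_lt_top (measure_lt_top _ _)
  · refine Measure.ext_of_lintegral _ fun f hf => ?_
    conv_lhs => rw [← Measure.disintegrate l l.condKernel]
    rw [Measure.lintegral_compProd hf, Measure.lintegral_compProd hf, hfst,
      lintegral_withDensity_eq_lintegral_mul _ hρm.coe_nnreal_ennreal hf.lintegral_kernel_prod_right']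
    refine lintegral_congr fun t => ?_
    rw [hκa, lintegral_smul_measure]
    rfl

theorem exists_disintegration_withDensityᵥ {E : Type*} [NormedAddCommGroup E] [NormedSpace ℝ E]
    [CompleteSpace E] [MeasurableSpace E] [BorelSpace E] [SecondCountableTopology E]
    [StandardBorelSpace K] [Nonempty K] (l : Measure (I × K)) [IsFiniteMeasure l]
    (hl : l.fst ≪ volume) {h : I × K → E} (hm : Measurable h) (hb : ∀ p, ‖h p‖ ≤ 1) :
    ∃ s : I → VectorMeasure K E, (∀ B, MeasurableSet B → Measurable fun t => s t B) ∧
      ∫⁻ t, (s t).variation univ < ∞ ∧ ∀ η : I × K → ℝ, Integrable η l →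
        ∫ᵛ p, η p ∂•(l.withDensityᵥ h) = ∫ t : I, ∫ᵛ x, η (t, x) ∂•(s t) := by
  obtain ⟨κ, hsf, hfin, hlκ⟩ := exists_kernel_of_fst_absolutelyContinuous l hl
  have hmt : ∀ t, Measurable fun x => h (t, x) := fun t => hm.comp measurable_prodMk_left
  have hi : ∀ t, Integrable (fun x => h (t, x)) (κ t) := fun t =>
    integrable_of_measurable_bounded (hmt t).stronglyMeasurable fun x => hb (t, x)
  have hil : Integrable h l := integrable_of_measurable_bounded hm.stronglyMeasurable hb
  have hvle : ∀ {Y : Type _} [MeasurableSpace Y] (p : Measure Y) (k : Y → E), Integrable k p →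
      (∀ y, ‖k y‖ ≤ 1) → (p.withDensityᵥ k).variation ≤ p := by
    intro Y _ p k hk hk1
    rw [Measure.variation_withDensityᵥ hk]
    conv_rhs => rw [← withDensity_one (μ := p)]
    refine withDensity_mono (ae_of_all _ fun y => ?_)
    change ‖k y‖ₑ ≤ 1
    rw [← ofReal_norm, ← ENNReal.ofReal_one]
    exact ENNReal.ofReal_le_ofReal (hk1 y)
  refine ⟨fun t => (κ t).withDensityᵥ fun x => h (t, x), fun B hB => ?_, ?_, fun η hη => ?_⟩
  · have : ∀ t, ((κ t).withDensityᵥ fun x => h (t, x)) B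
        = ∫ x, (univ ×ˢ B).indicator h (t, x) ∂(κ t) := fun t => by
      rw [withDensityᵥ_apply (hi t) hB, ← integral_indicator hB]
      congr 1 with x
      by_cases hx : x ∈ B <;> simp [hx, indicator]
    simp_rw [this]
    exact (StronglyMeasurable.integral_kernel_prod_right' (κ := κ)
      (hm.indicator (MeasurableSet.univ.prod hB)).stronglyMeasurable).measurable
  · refine (lintegral_mono fun t => Measure.le_iff'.1
      (hvle (κ t) _ (hi t) fun x => hb (t, x)) univ).trans_lt ?_
    have := Measure.lintegral_compProd (μ := volume) (κ := κ) (f := fun _ => 1) measurable_const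
    rw [← hlκ] at this
    simp only [lintegral_const, one_mul] at this
    rw [← this]
    exact measure_lt_top _ _
  · have hη' : (l.withDensityᵥ h).Integrable η := hη.mono_measure (hvle l h hil hb)
    rw [integral_withDensityᵥ hil _ hη']
    have hηh : Integrable (fun p => (ContinuousLinearMap.lsmul ℝ ℝ : ℝ →L[ℝ] E →L[ℝ] E) (η p) (h p))
        l := by
      refine hη.smul_of_top_left ?_
      exact memLp_top_of_bound hm.aestronglyMeasurable 1 (ae_of_all _ hb)
    rw [hlκ] at hηh hη
    conv_lhs => rw [hlκ, Measure.integral_compProd hηh]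
    refine integral_congr_ae ?_
    filter_upwards [((Measure.integrable_compProd_iff hη.1).1 hη).1] with t ht
    rw [integral_withDensityᵥ (hi t) _ (ht.mono_measure (hvle (κ t) _ (hi t) fun x => hb (t, x)))]

/-- The hypothesis on the variation forces ‖k‖ = 1 almost everywhere. The bound is arranged at every
point so that all time slices of the density are integrable, not just almost all. -/
theorem exists_bounded_withDensityᵥ_eq {X E : Type*} [MeasurableSpace X] [NormedAddCommGroup E]
    [NormedSpace ℝ E] [CompleteSpace E] [MeasurableSpace E] [BorelSpace E]
    [SecondCountableTopology E] {l : Measure X} [SigmaFinite l] {k : X → E} (hk : Integrable k l)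
    (hkm : Measurable k) (hv : (l.withDensityᵥ k).variation = l) :
    ∃ h : X → E, Measurable h ∧ (∀ x, ‖h x‖ ≤ 1) ∧ l.withDensityᵥ h = l.withDensityᵥ k := by
  have hS : MeasurableSet {x | ‖k x‖ ≤ 1} := measurableSet_le hkm.norm measurable_const
  have h1 : l.withDensity (fun x => ‖k x‖ₑ) = l.withDensity 1 := by
    rw [← Measure.variation_withDensityᵥ hk, hv, withDensity_one]
  have hae := (withDensity_eq_iff_of_sigmaFinite hkm.enorm.aemeasurable
    measurable_one.aemeasurable).1 h1
  refine ⟨{x | ‖k x‖ ≤ 1}.indicator k, hkm.indicator hS, fun x => ?_, ?_⟩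
  · by_cases hx : x ∈ {x | ‖k x‖ ≤ 1}
    · rw [indicator_of_mem hx]; exact hx
    · rw [indicator_of_notMem hx]; simp
  · refine WithDensityᵥEq.congr_ae ?_
    filter_upwards [hae] with x hx
    refine indicator_of_mem ?_ _
    rw [← ofReal_norm] at hx
    exact (ENNReal.ofReal_eq_one.1 hx).le

theorem exists_bounded_density {d : ℕ} {X : Type*} [MeasurableSpace X]
    (ν : VectorMeasure X (Vec d)) :
    ∃ h : X → Vec d, Measurable h ∧ (∀ x, ‖h x‖ ≤ 1) ∧ ν.variation.withDensityᵥ h = ν := by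
  have hν := withDensityᵥ_vecDensity ν (Measure.AbsolutelyContinuous.refl ν.variation)
  obtain ⟨h, hm, hb, he⟩ := exists_bounded_withDensityᵥ_eq (integrable_vecDensity ν ν.variation)
    (measurable_vecDensity ν ν.variation) (by rw [hν])
  exact ⟨h, hm, hb, he.trans hν⟩

theorem exists_bounded_density_signed {X : Type*} [MeasurableSpace X] (τ : SignedMeasure X) :
    ∃ h : X → ℝ, Measurable h ∧ (∀ x, ‖h x‖ ≤ 1) ∧ τ.variation.withDensityᵥ h = τ := by
  have hτ := withDensityᵥ_rnDeriv_variation τ (Measure.AbsolutelyContinuous.refl τ.variation)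
  obtain ⟨h, hm, hb, he⟩ := exists_bounded_withDensityᵥ_eq
    (SignedMeasure.integrable_rnDeriv τ τ.variation)
    (SignedMeasure.measurable_rnDeriv τ τ.variation) (by rw [hτ])
  exact ⟨h, hm, hb, he.trans hτ⟩

theorem UniformlyAC.fst_absolutelyContinuous {l : Measure (I × K)}
    (h : UniformlyAC fun _ : Unit => l) : l.fst ≪ volume := by
  refine Measure.AbsolutelyContinuous.mk fun J hJ h0 => ?_
  rw [Measure.fst_apply hJ, ← prod_univ]
  refine le_antisymm (ENNReal.le_of_forall_pos_le_add fun ε hε _ => ?_) zero_le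
  obtain ⟨B, hB⟩ := h ε hε
  simpa [h0] using hB () J hJ

/-- On closed sets, t ↦ μ_t(F) is a pointwise limit of the continuous functions obtained by
integrating approximations of the indicator; closed sets form a generating π-system. -/
theorem exists_kernel_of_continuous [TopologicalSpace K] [BorelSpace K] [HasOuterApproxClosed K]
    {μ : I → FiniteMeasure K} (hμ : Continuous μ) :
    ∃ κ : Kernel I K, IsFiniteKernel κ ∧ ∀ t, κ t = (μ t : Measure K) := by
  have hcont : ∀ f : BoundedContinuousFunction K NNReal,
      Continuous fun t => ∫⁻ x, f x ∂(μ t : Measure K) := fun f => by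
    have := (FiniteMeasure.continuous_testAgainstNN_eval f).comp hμ
    simp_rw [← FiniteMeasure.testAgainstNN_coe_eq]
    exact ENNReal.continuous_coe.comp this
  have huniv : Continuous fun t => (μ t : Measure K) univ := by
    simpa using hcont 1
  have hmeas : Measurable fun t => (μ t : Measure K) := by
    refine Measurable.measure_of_isPiSystem (S := {F | IsClosed F})
      ((BorelSpace.measurable_eq (α := K)).trans borel_eq_generateFrom_isClosed)
      isPiSystem_isClosed (fun F hF => ?_) huniv.measurable
    refine measurable_of_tendsto_metrizable (fun n => (hcont (hF.apprSeq n)).measurable)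
      (tendsto_pi_nhds.2 fun t => ?_)
    exact HasOuterApproxClosed.tendsto_lintegral_apprSeq hF (μ t : Measure K)
  obtain ⟨M, hM⟩ := exists_norm_le_continuousMap (K := I)
    (f := fun t => (((μ t).mass : NNReal) : ℝ))
    (NNReal.continuous_coe.comp (FiniteMeasure.continuous_mass.comp hμ))
  refine ⟨⟨fun t => (μ t : Measure K), hmeas⟩,
    ⟨ENNReal.ofReal M, ENNReal.ofReal_lt_top, fun t => ?_⟩, fun t => rfl⟩
  have := hM t
  rw [Real.norm_of_nonneg (NNReal.coe_nonneg _)] at this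
  change (μ t : Measure K) univ ≤ _
  rw [← FiniteMeasure.ennreal_mass, ← ENNReal.ofReal_coe_nnreal]
  exact ENNReal.ofReal_le_ofReal this

/-- The space-time measure `∫ μ_t dt` of a weakly continuous curve of measures. -/
theorem exists_mass_of_continuous [TopologicalSpace K] [BorelSpace K] [HasOuterApproxClosed K]
    {μ : I → FiniteMeasure K} (hμ : Continuous μ) :
    ∃ m : FiniteMeasure (I × K), ∀ η : I × K → ℝ, Integrable η (m : Measure (I × K)) →
      ∫ p, η p ∂(m : Measure (I × K)) = ∫ t : I, ∫ x, η (t, x) ∂(μ t : Measure K) := by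
  obtain ⟨κ, hκ, h⟩ := exists_kernel_of_continuous hμ
  refine ⟨⟨volume ⊗ₘ κ, inferInstance⟩, fun η hη => ?_⟩
  simp_rw [← h]
  exact Measure.integral_compProd hη

theorem measurable_integral_mass [TopologicalSpace K] [BorelSpace K] [HasOuterApproxClosed K]
    {μ : I → FiniteMeasure K} (hμ : Continuous μ) {η : I × K → ℝ} (hη : Measurable η) :
    Measurable fun t => ∫ x, η (t, x) ∂(μ t : Measure K) := by
  obtain ⟨κ, hκ, h⟩ := exists_kernel_of_continuous hμ
  simp_rw [← h]
  exact (StronglyMeasurable.integral_kernel_prod_right' hη.stronglyMeasurable).measurable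

end Disintegration

/-! ### C^1 test functions determine weak-* limits -/

section Limit

variable {d : ℕ} {D : Set (Vec d)}

/-- Stone–Weierstrass: restrictions of C^1 functions form a subalgebra that contains the
coordinates. -/
theorem exists_contDiff_near [CompactSpace (Cl D)] (f : C(Cl D, ℝ)) {ε : ℝ} (hε : 0 < ε) :
    ∃ g : Vec d → ℝ, ContDiff ℝ 1 g ∧ ∀ x : Cl D, |f x - g x| ≤ ε := by
  let A : Subalgebra ℝ C(Cl D, ℝ) :=
    { carrier := {f | ∃ g : Vec d → ℝ, ContDiff ℝ 1 g ∧ ∀ x : Cl D, f x = g x}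
      mul_mem' := by
        rintro _ _ ⟨g, hg, h⟩ ⟨g', hg', h'⟩
        exact ⟨fun x => g x * g' x, hg.mul hg', fun x => by simp [h, h']⟩
      add_mem' := by
        rintro _ _ ⟨g, hg, h⟩ ⟨g', hg', h'⟩
        exact ⟨fun x => g x + g' x, hg.add hg', fun x => by simp [h, h']⟩
      algebraMap_mem' := fun r => ⟨fun _ => r, contDiff_const, fun x => rfl⟩ }
  have hA : A.SeparatesPoints := by
    intro x y hxy
    have : ∃ i, (x : Vec d) i ≠ (y : Vec d) i := by
      by_contra! h
      exact hxy (Subtype.ext (PiLp.ext h))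
    obtain ⟨i, hi⟩ := this
    refine ⟨_, ⟨⟨fun x : Cl D => (x : Vec d) i, by fun_prop⟩, ⟨fun x => x i, ?_, fun x => rfl⟩, rfl⟩,
      hi⟩
    exact (EuclideanSpace.proj (𝕜 := ℝ) i).contDiff
  obtain ⟨⟨k, g, hg, hk⟩, hkf⟩ :=
    ContinuousMap.exists_mem_subalgebra_near_continuousMap_of_separatesPoints A hA f ε hε
  refine ⟨g, hg, fun x => ?_⟩
  rw [← hk, abs_sub_comm]
  exact ((k - f).norm_coe_le_norm x).trans hkf.le

theorem abs_integral_sub_le {K : Type*} [MeasurableSpace K] (μ : FiniteMeasure K) {M : NNReal}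
    (hM : μ.mass ≤ M) {f g : K → ℝ} (hf : Integrable f (μ : Measure K))
    (hg : Integrable g (μ : Measure K)) {ε : ℝ} (hε : 0 ≤ ε) (h : ∀ x, |f x - g x| ≤ ε) :
    |∫ x, f x ∂(μ : Measure K) - ∫ x, g x ∂(μ : Measure K)| ≤ ε * M := by
  rw [← integral_sub hf hg]
  have := norm_integral_le_of_norm_le_const (μ := (μ : Measure K))
    (f := fun x => f x - g x) (C := ε) (ae_of_all _ h)
  refine this.trans ?_
  have h2 : (μ : Measure K).real univ = μ.mass := rfl
  rw [h2]
  gcongr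

/-- The filter is arbitrary so that the same statement serves limits along the sequence and
continuity in time. -/
theorem tendsto_of_forall_contDiff [CompactSpace (Cl D)] {γ : Type*} {F : Filter γ}
    {μs : γ → FiniteMeasure (Cl D)} {μ : FiniteMeasure (Cl D)} {M : NNReal}
    (hM : ∀ i, (μs i).mass ≤ M) (hM' : μ.mass ≤ M)
    (h : ∀ g : Vec d → ℝ, ContDiff ℝ 1 g →
      Tendsto (fun i => ∫ x : Cl D, g x ∂(μs i : Measure (Cl D))) F
        (𝓝 (∫ x : Cl D, g x ∂(μ : Measure (Cl D))))) : Tendsto μs F (𝓝 μ) := by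
  refine FiniteMeasure.tendsto_iff_forall_integral_tendsto.2 fun f => ?_
  rw [Metric.tendsto_nhds]
  intro ε hε
  set e := ε / (3 * (M + 1)) with he
  have hMpos : (0 : ℝ) ≤ M := M.coe_nonneg
  have hepos : 0 < e := by positivity
  have heM : e * M < ε / 3 := by
    rw [he, div_mul_eq_mul_div, div_lt_div_iff₀ (by positivity) (by norm_num)]
    nlinarith
  obtain ⟨g, hg, hfg⟩ := exists_contDiff_near f.toContinuousMap hepos
  have hgi : ∀ μ : FiniteMeasure (Cl D), Integrable (fun x : Cl D => g x) (μ : Measure (Cl D)) :=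
    fun μ => integrable_continuousMap ⟨_, hg.continuous.comp continuous_subtype_val⟩
  have hfi : ∀ μ : FiniteMeasure (Cl D), Integrable f (μ : Measure (Cl D)) :=
    fun μ => integrable_continuousMap f.toContinuousMap
  filter_upwards [Metric.tendsto_nhds.1 (h g hg) (ε / 3) (by positivity)] with i hi
  have h1 := abs_integral_sub_le (μs i) (hM i) (hfi _) (hgi _) hepos.le hfg
  have h2 := abs_integral_sub_le μ hM' (hfi _) (hgi _) hepos.le hfg
  rw [Real.dist_eq, abs_lt] at *
  rw [abs_le] at h1 h2
  constructor <;> linarith [h1.1, h1.2, h2.1, h2.2, hi.1, hi.2]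

/-- A cluster point is identified by its pairings with C^1 functions, hence the whole sequence
converges. No further extraction is made, which is essential since uncountably many times share one
subsequence. -/
theorem exists_tendsto_of_forall_contDiff [CompactSpace (Cl D)] [Nonempty (Cl D)]
    {μs : ℕ → FiniteMeasure (Cl D)} {M : NNReal} (hM : ∀ n, (μs n).mass ≤ M)
    (h : ∀ g : Vec d → ℝ, ContDiff ℝ 1 g → ∃ L,
      Tendsto (fun n => ∫ x : Cl D, g x ∂(μs n : Measure (Cl D))) atTop (𝓝 L)) :
    ∃ μ : FiniteMeasure (Cl D), μ.mass ≤ M ∧ Tendsto μs atTop (𝓝 μ) := by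
  obtain ⟨φ, P, hφ, hP⟩ := exists_subseq_tendsto_finiteMeasure (ι := Unit) (fun n _ => μs n)
    fun n _ => hM n
  have hm : (P ()).mass ≤ M := le_of_tendsto
    ((FiniteMeasure.continuous_mass.tendsto _).comp (hP ())) (Eventually.of_forall fun n => hM _)
  refine ⟨P (), hm, tendsto_of_forall_contDiff hM hm fun g hg => ?_⟩
  obtain ⟨L, hL⟩ := h g hg
  have h1 := FiniteMeasure.tendsto_iff_forall_integral_tendsto.1 (hP ())
    (BoundedContinuousFunction.mkOfCompact
      ⟨fun x : Cl D => g x, hg.continuous.comp continuous_subtype_val⟩)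
  have h2 := tendsto_nhds_unique h1 (hL.comp hφ.tendsto_atTop)
  rw [← h2] at hL
  exact hL

theorem exists_component_eq {X : Type*} [MeasurableSpace X] (τ : Fin d → SignedMeasure X) :
    ∃ ν : VectorMeasure X (Vec d), ∀ i, component ν i = τ i := by
  refine ⟨⟨fun s => WithLp.toLp 2 fun i => τ i s, ?_, fun s hs => ?_, fun f hf hd => ?_⟩,
    fun i => ?_⟩
  · ext i; simp
  · ext i; simp [VectorMeasure.not_measurable _ hs]
  · have : HasSum (fun k i => τ i (f k)) fun i => τ i (⋃ k, f k) :=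
      Pi.hasSum.2 fun i => VectorMeasure.hasSum_of_disjoint_iUnion hf hd
    exact this.map (WithLp.linearEquiv 2 ℝ (Fin d → ℝ)).symm.toAddMonoidHom
      (PiLp.continuous_toLp 2 _)
  · ext s _
    rfl

theorem IsDisintegration.integral_inner_eq {T : Triple D} {c : Curve D} (h : IsDisintegration T c)
    {F : Cyl D → Vec d} (hF : Measurable F) {C : ℝ} (hC : ∀ p, ‖F p‖ ≤ C) :
    ∫ t : I, ∫ᵛ x, F (t, x) ∂[innerSL ℝ; c.momentum t] =
      ∑ i, ∫ᵛ p, F p i ∂•(component T.momentum i) := by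
  have e : ∀ t, ∫ᵛ x, F (t, x) ∂[innerSL ℝ; c.momentum t] =
      ∑ i, ∫ᵛ x, F (t, x) i ∂•component (c.momentum t) i :=
    fun t => integral_inner_eq_sum (integrable_of_measurable_bounded
      (hF.comp measurable_prodMk_left).stronglyMeasurable fun x => hC (t, x))
  have hFi : ∀ i, Measurable fun p => F p i := fun i =>
    (EuclideanSpace.proj (𝕜 := ℝ) i).continuous.measurable.comp hF
  have hCi : ∀ i p, ‖F p i‖ ≤ C := fun i p => (PiLp.norm_apply_le _ i).trans (hC p)
  have hd := h.component_isSignedDisintegration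
  simp_rw [e]
  rw [integral_finsetSum _ fun i _ =>
    integrable_integral_family (hd i).measurable (hd i).finite (hFi i) (hCi i)]
  exact Finset.sum_congr rfl fun i _ => ((hd i).eq _ (hFi i) ⟨C, hCi i⟩).symm

/-- Expresses the time-integrated flux through the space-time measures, the level at which weak-*
convergence is available. -/
theorem IsDisintegration.setIntegral_flux [CompactSpace (Cl D)] {T : Triple D} {c : Curve D}
    (h : IsDisintegration T c) {g : Vec d → ℝ} (hg : ContDiff ℝ 1 g) (S : Set I)
    (hS : MeasurableSet S) :
    ∫ s in S, flux c g s =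
      ∑ i, ∫ᵛ p, (S ×ˢ univ).indicator (fun p : Cyl D => gradient g p.2 i) p
          ∂•(component T.momentum i)
        + ∫ᵛ p, (S ×ˢ univ).indicator (fun p : Cyl D => g p.2) p ∂•T.source := by
  have c1 : Continuous fun p : Cyl D => gradient g p.2 :=
    (continuous_gradient hg).comp (continuous_subtype_val.comp continuous_snd)
  have c2 : Continuous fun p : Cyl D => g p.2 :=
    hg.continuous.comp (continuous_subtype_val.comp continuous_snd)
  obtain ⟨C1, hC1⟩ := exists_norm_le_continuousMap c1
  obtain ⟨C2, hC2⟩ := exists_norm_le_continuousMap c2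
  have hSu : MeasurableSet (S ×ˢ (univ : Set (Cl D))) := hS.prod MeasurableSet.univ
  have m1 := c1.measurable.indicator hSu
  have m2 := c2.measurable.indicator hSu
  have b1 : ∀ p, ‖(S ×ˢ univ).indicator (fun p : Cyl D => gradient g p.2) p‖ ≤ C1 := fun p =>
    (norm_indicator_le_norm_self _ _).trans (hC1 p)
  have b2 : ∀ p, ‖(S ×ˢ univ).indicator (fun p : Cyl D => g p.2) p‖ ≤ C2 := fun p =>
    (norm_indicator_le_norm_self _ _).trans (hC2 p)
  have e1 := h.integral_inner_eq m1 b1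
  have e2 := h.source_isSignedDisintegration.eq _ m2 ⟨C2, b2⟩
  have i1 := integrable_inner_integral_family h.measurable_momentum h.finite_momentum m1 b1
  have i2 := integrable_integral_family h.measurable_source h.finite_source m2 b2
  have e3 : ∀ i, (fun p => (S ×ˢ univ).indicator (fun p : Cyl D => gradient g p.2 i) p) =
      fun p => (S ×ˢ univ).indicator (fun p : Cyl D => gradient g p.2) p i := fun i => by
    ext p
    by_cases hp : p ∈ S ×ˢ (univ : Set (Cl D))
    · rw [indicator_of_mem hp, indicator_of_mem hp]
    · rw [indicator_of_notMem hp, indicator_of_notMem hp]; rfl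
  simp_rw [e3]
  rw [e2, ← e1, ← integral_add i1 i2, ← integral_indicator hS]
  congr 1 with t
  by_cases ht : t ∈ S
  · have hp : ∀ x : Cl D, (t, x) ∈ S ×ˢ (univ : Set (Cl D)) := fun x => ⟨ht, trivial⟩
    simp only [indicator_of_mem ht, indicator_of_mem (hp _)]
    rfl
  · have hp : ∀ x : Cl D, (t, x) ∉ S ×ˢ (univ : Set (Cl D)) := fun x h => ht h.1
    simp only [indicator_of_notMem ht, indicator_of_notMem (hp _)]
    simp

end Limit

/-! ### Extraction of the limit and convergence of pairings -/

section Compactness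

variable {d : ℕ} {D : Set (Vec d)}

/-- The zero mass is a placeholder: the flux only involves momentum and source, and the true mass
curve is built from it afterwards. -/
theorem exists_disintegration_of_uniformlyAC [CompactSpace (Cl D)] [Nonempty (Cl D)]
    (ν : VectorMeasure (Cyl D) (Vec d)) (ζ : SignedMeasure (Cyl D))
    (hν : ∀ i, UniformlyAC fun _ : Unit => (component ν i).variation)
    (hζ : UniformlyAC fun _ : Unit => ζ.variation) :
    ∃ (s : I → VectorMeasure (Cl D) (Vec d)) (z : I → SignedMeasure (Cl D)),
      IsDisintegration (⟨0, ν, ζ⟩ : Triple D) ⟨fun _ => 0, s, z⟩ := by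
  have hν' : ν.variation.fst ≪ volume := by
    refine Measure.AbsolutelyContinuous.mk fun J hJ h0 => ?_
    have h1 : ∀ i, (component ν i).variation (Prod.fst ⁻¹' J) = 0 := fun i => by
      rw [← Measure.fst_apply hJ]
      exact (hν i).fst_absolutelyContinuous h0
    rw [Measure.fst_apply hJ]
    refine le_antisymm ((Measure.le_iff'.1 (variation_le_sum_component ν) _).trans ?_) zero_le
    rw [Measure.finsetSum_apply]
    simp [h1]
  obtain ⟨h, hm, hb, he⟩ := exists_bounded_density ν
  obtain ⟨k, km, kb, ke⟩ := exists_bounded_density_signed ζ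
  obtain ⟨s, hs1, hs2, hs3⟩ := exists_disintegration_withDensityᵥ ν.variation hν' hm hb
  obtain ⟨z, hz1, hz2, hz3⟩ := exists_disintegration_withDensityᵥ ζ.variation
    hζ.fst_absolutelyContinuous km kb
  rw [he] at hs3
  rw [ke] at hz3
  exact ⟨s, z, continuous_const, hs1, hs2, hz1, hz2, fun η _ => by simp, hs3, hz3⟩

variable {μA μB : FiniteMeasure (Cl D)} {T : ℕ → Triple D} {c : ℕ → Curve D}

/-- Curves of masses converge for all times, momenta and sources converge in space-time. -/
structure ConvergesTo (T : ℕ → Triple D) (c : ℕ → Curve D) (T' : Triple D) (c' : Curve D) :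
    Prop where
  mass : ∀ t, Tendsto (fun n => (c n).mass t) atTop (𝓝 (c'.mass t))
  momentum : ∀ i (f : C(Cyl D, ℝ)), Tendsto (fun n => ∫ᵛ p, f p ∂•(component (T n).momentum i))
    atTop (𝓝 (∫ᵛ p, f p ∂•(component T'.momentum i)))
  source : ∀ f : C(Cyl D, ℝ), Tendsto (fun n => ∫ᵛ p, f p ∂•(T n).source)
    atTop (𝓝 (∫ᵛ p, f p ∂•T'.source))

theorem exists_subseq_convergesTo [CompactSpace (Cl D)] [Nonempty (Cl D)]
    (hT : ∀ n, IsWeakSolution μA μB (T n) (c n)) {M : NNReal}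
    (hM : ∀ n t, ((c n).mass t).mass ≤ M)
    (hν : ∀ i, UniformlyAC fun n => (component (T n).momentum i).variation)
    (hζ : UniformlyAC fun n => (T n).source.variation) :
    ∃ (φ : ℕ → ℕ) (T' : Triple D) (c' : Curve D), StrictMono φ ∧ IsDisintegration T' c' ∧
      (∀ t, (c'.mass t).mass ≤ M) ∧
      ConvergesTo (fun n => T (φ n)) (fun n => c (φ n)) T' c' := by
  -- A joint extraction: `none` indexes the source, `some i` the i-th momentum coordinate.
  obtain ⟨φ, τ, hφ, hτ⟩ := exists_subseq_tendsto_signed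
    (fun o : Option (Fin d) => Option.elim o (fun n => (T n).source)
      fun i n => component (T n).momentum i)
    (fun o => by cases o with
      | none => exact hζ
      | some i => exact hν i)
  obtain ⟨ν, hcomp⟩ := exists_component_eq fun i => τ (some i)
  have hνac : ∀ i, UniformlyAC fun _ : Unit => (component ν i).variation := fun i => by
    rw [hcomp]; exact (hτ (some i)).1
  have hζac : UniformlyAC fun _ : Unit => (τ none).variation := (hτ none).1
  have hνlim : ∀ i (f : C(Cyl D, ℝ)), Tendsto
      (fun n => ∫ᵛ p, f p ∂•(component (T (φ n)).momentum i)) atTop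
      (𝓝 (∫ᵛ p, f p ∂•(component ν i))) := fun i => by
    rw [hcomp]; exact (hτ (some i)).2
  have hζlim : ∀ f : C(Cyl D, ℝ), Tendsto (fun n => ∫ᵛ p, f p ∂•(T (φ n)).source) atTop
      (𝓝 (∫ᵛ p, f p ∂•(τ none))) := (hτ none).2
  obtain ⟨s, z, hdis⟩ := exists_disintegration_of_uniformlyAC ν (τ none) hνac hζac
  have hsub : ∀ {θ : ℕ → SignedMeasure (Cyl D)}, (UniformlyAC fun n => (θ n).variation) →
      UniformlyAC fun n => (θ (φ n)).variation := fun h ε hε => by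
    obtain ⟨B, hB⟩ := h ε hε
    exact ⟨B, fun n => hB (φ n)⟩
  have hconv : ∀ (g : Vec d → ℝ), ContDiff ℝ 1 g → ∀ t : I,
      Tendsto (fun n => ∫ x : Cl D, g x ∂((c (φ n)).mass t : Measure (Cl D))) atTop
        (𝓝 (∫ x : Cl D, g x ∂(μA : Measure (Cl D))
          + ∫ u in Iic t, flux (⟨fun _ => 0, s, z⟩ : Curve D) g u)) := by
    intro g hg t
    simp_rw [fun n => (hT (φ n)).integral_mass_eq hg t,
      fun n => (hT (φ n)).disintegration.setIntegral_flux hg (Iic t) measurableSet_Iic,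
      hdis.setIntegral_flux hg (Iic t) measurableSet_Iic]
    refine tendsto_const_nhds.add ((tendsto_finsetSum _ fun i _ => ?_).add ?_)
    · exact tendsto_integral_indicator (hsub (hν i)) (hνac i) (hνlim i) isClosed_Iic
        ⟨fun p : Cyl D => gradient g p.2 i, (EuclideanSpace.proj (𝕜 := ℝ) i).continuous.comp
          ((continuous_gradient hg).comp (continuous_subtype_val.comp continuous_snd))⟩
    · exact tendsto_integral_indicator (hsub hζ) hζac hζlim isClosed_Iic
        ⟨fun p : Cyl D => g p.2, hg.continuous.comp (continuous_subtype_val.comp continuous_snd)⟩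
  choose μ hμM hμ using fun t => exists_tendsto_of_forall_contDiff
    (μs := fun n => (c (φ n)).mass t) (fun n => hM (φ n) t) fun g hg => ⟨_, hconv g hg t⟩
  have hμeq : ∀ (g : Vec d → ℝ), ContDiff ℝ 1 g → ∀ t,
      ∫ x : Cl D, g x ∂(μ t : Measure (Cl D)) = ∫ x : Cl D, g x ∂(μA : Measure (Cl D))
        + ∫ u in Iic t, flux (⟨fun _ => 0, s, z⟩ : Curve D) g u := fun g hg t =>
    tendsto_nhds_unique (FiniteMeasure.tendsto_iff_forall_integral_tendsto.1 (hμ t)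
      (BoundedContinuousFunction.mkOfCompact
        ⟨fun x : Cl D => g x, hg.continuous.comp continuous_subtype_val⟩)) (hconv g hg t)
  -- Continuity comes from the limit formula, whose right-hand side is the primitive of an
  -- integrable function; pointwise convergence of the curves alone would not give it.
  have hcont : Continuous μ := continuous_iff_continuousAt.2 fun t =>
    tendsto_of_forall_contDiff hμM (hμM t) fun g hg => by
      simp_rw [hμeq g hg]
      exact (continuous_const.add (continuous_setIntegral_Iic (hdis.integrable_flux hg))).tendsto t
  obtain ⟨m, hm⟩ := exists_mass_of_continuous hcont
  exact ⟨φ, ⟨m, ν, τ none⟩, ⟨μ, s, z⟩, hφ, ⟨hcont, hdis.measurable_momentum, hdis.finite_momentum,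
    hdis.measurable_source, hdis.finite_source, hm, hdis.momentum_eq, hdis.source_eq⟩, hμM,
    hμ, hνlim, hζlim⟩

theorem IsDisintegration.integrable_inner {T : Triple D} {c : Curve D} [CompactSpace (Cl D)]
    (h : IsDisintegration T c) (F : C(Cyl D, Vec d)) :
    Integrable fun t => ∫ᵛ x, F (t, x) ∂[innerSL ℝ; c.momentum t] :=
  integrable_inner_integral_family h.measurable_momentum h.finite_momentum F.continuous.measurable
    F.norm_coe_le_norm

theorem IsDisintegration.integrable_source {T : Triple D} {c : Curve D} [CompactSpace (Cl D)]
    (h : IsDisintegration T c) (G : C(Cyl D, ℝ)) :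
    Integrable fun t => ∫ᵛ x, G (t, x) ∂•(c.source t) :=
  integrable_integral_family h.measurable_source h.finite_source G.continuous.measurable
    G.norm_coe_le_norm

theorem norm_integral_mass_le {K : Type*} [MeasurableSpace K] {μ : FiniteMeasure K} {M : NNReal}
    (hM : μ.mass ≤ M) {f : K → ℝ} {C : ℝ} (hC0 : 0 ≤ C) (hC : ∀ x, ‖f x‖ ≤ C) :
    ‖∫ x, f x ∂(μ : Measure K)‖ ≤ C * M := by
  refine (norm_integral_le_of_norm_le_const (ae_of_all _ hC)).trans ?_
  have h2 : (μ : Measure K).real univ = μ.mass := rfl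
  rw [h2]
  gcongr

theorem IsDisintegration.integrable_mass {T : Triple D} {c : Curve D} [CompactSpace (Cl D)]
    (h : IsDisintegration T c) {M : NNReal} (hM : ∀ t, (c.mass t).mass ≤ M) (H : C(Cyl D, ℝ)) :
    Integrable fun t => ∫ x, H (t, x) ∂(c.mass t : Measure (Cl D)) :=
  integrable_of_measurable_bounded
    (measurable_integral_mass h.continuous_mass H.continuous.measurable).stronglyMeasurable
    fun t => norm_integral_mass_le (hM t) (norm_nonneg H) fun x => H.norm_coe_le_norm (t, x)

/-- The pairing of `(ν_t, μ_t, ζ_t)` with continuous functions on the cylinder. -/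
def pairing (c : Curve D) (F : C(Cyl D, Vec d)) (H G : C(Cyl D, ℝ)) (t : I) : ℝ :=
  ∫ x, H (t, x) ∂(c.mass t : Measure (Cl D)) + ∫ᵛ x, F (t, x) ∂[innerSL ℝ; c.momentum t]
    + ∫ᵛ x, G (t, x) ∂•(c.source t)

theorem IsDisintegration.integrable_pairing {T : Triple D} {c : Curve D} [CompactSpace (Cl D)]
    (h : IsDisintegration T c) {M : NNReal} (hM : ∀ t, (c.mass t).mass ≤ M)
    (F : C(Cyl D, Vec d)) (H G : C(Cyl D, ℝ)) : Integrable (pairing c F H G) :=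
  ((h.integrable_mass hM H).add (h.integrable_inner F)).add (h.integrable_source G)

theorem IsDisintegration.integral_pairing {T : Triple D} {c : Curve D} [CompactSpace (Cl D)]
    (h : IsDisintegration T c) {M : NNReal} (hM : ∀ t, (c.mass t).mass ≤ M)
    (F : C(Cyl D, Vec d)) (H G : C(Cyl D, ℝ)) :
    ∫ t, pairing c F H G t = (∫ t : I, ∫ x, H (t, x) ∂(c.mass t : Measure (Cl D)))
      + ∑ i, ∫ᵛ p, F p i ∂•(component T.momentum i) + ∫ᵛ p, G p ∂•T.source := by
  rw [← h.integral_inner_eq F.continuous.measurable F.norm_coe_le_norm,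
    h.source_isSignedDisintegration.eq G G.continuous.measurable ⟨_, G.norm_coe_le_norm⟩,
    ← integral_add (h.integrable_mass hM H) (h.integrable_inner F)]
  exact integral_add ((h.integrable_mass hM H).add (h.integrable_inner F)) (h.integrable_source G)

/-- The mass term converges by dominated convergence in time, the other two directly by weak-*
convergence on the cylinder. -/
theorem ConvergesTo.tendsto_integral_pairing [CompactSpace (Cl D)] {T' : Triple D} {c' : Curve D}
    (hc : ConvergesTo T c T' c') (hT : ∀ n, IsDisintegration (T n) (c n))
    (hT' : IsDisintegration T' c') {M : NNReal} (hM : ∀ n t, ((c n).mass t).mass ≤ M)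
    (hM' : ∀ t, (c'.mass t).mass ≤ M) (F : C(Cyl D, Vec d)) (H G : C(Cyl D, ℝ)) :
    Tendsto (fun n => ∫ t, pairing (c n) F H G t) atTop (𝓝 (∫ t, pairing c' F H G t)) := by
  simp_rw [fun n => (hT n).integral_pairing (hM n) F H G, hT'.integral_pairing hM' F H G]
  refine (Tendsto.add ?_ (tendsto_finsetSum _ fun i _ => ?_)).add (hc.source G)
  · refine tendsto_integral_of_dominated_convergence (fun _ => ‖H‖ * M)
      (fun n => ((hT n).integrable_mass (hM n) H).aestronglyMeasurable) (integrable_const _)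
      (fun n => ae_of_all _ fun t => norm_integral_mass_le (hM n t) (norm_nonneg H)
        fun x => H.norm_coe_le_norm (t, x)) (ae_of_all _ fun t => ?_)
    exact FiniteMeasure.tendsto_iff_forall_integral_tendsto.1 (hc.mass t)
      (BoundedContinuousFunction.mkOfCompact ⟨fun x : Cl D => H (t, x), by fun_prop⟩)
  · exact hc.momentum i ⟨fun p => F p i, by fun_prop⟩

end Compactness

/-! ### Passing to the limit in the equation and in the energy -/

section MainResult

variable {d : ℕ} {D : Set (Vec d)}

/-- Through the full derivative, the partial derivative is seen to be jointly continuous and hence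
admissible as a test function on the cylinder. -/
theorem deriv_slice_eq {η : ℝ × Vec d → ℝ} (hη : ContDiff ℝ 1 η) (t : ℝ) (x : Vec d) :
    deriv (fun s : ℝ => η (s, x)) t = fderiv ℝ η (t, x) (1, 0) := by
  have h1 : HasFDerivAt η (fderiv ℝ η (t, x)) (t, x) :=
    (hη.differentiable one_ne_zero _).hasFDerivAt
  have h2 : HasDerivAt (fun s : ℝ => (s, x)) (1, 0) t :=
    (hasDerivAt_id t).prodMk (hasDerivAt_const t x)
  exact (h1.comp_hasDerivAt t h2).deriv

theorem gradient_slice_eq {η : ℝ × Vec d → ℝ} (hη : ContDiff ℝ 1 η) (t : ℝ) (x : Vec d) :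
    gradient (fun y : Vec d => η (t, y)) x = (InnerProductSpace.toDual ℝ (Vec d)).symm
      ((fderiv ℝ η (t, x)).comp (ContinuousLinearMap.inr ℝ ℝ (Vec d))) := by
  have h1 : HasFDerivAt η (fderiv ℝ η (t, x)) (t, x) :=
    (hη.differentiable one_ne_zero _).hasFDerivAt
  have h2 : HasFDerivAt (fun y : Vec d => (t, y)) (ContinuousLinearMap.inr ℝ ℝ (Vec d)) x :=
    hasFDerivAt_prodMk_right t x
  rw [gradient]
  congr 1
  exact (h1.comp x h2).fderiv

theorem ConvergesTo.isWeakSolution [CompactSpace (Cl D)] {μA μB : FiniteMeasure (Cl D)}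
    {T : ℕ → Triple D} {c : ℕ → Curve D} {T' : Triple D} {c' : Curve D}
    (hc : ConvergesTo T c T' c') (hT : ∀ n, IsWeakSolution μA μB (T n) (c n))
    (hT' : IsDisintegration T' c') {M : NNReal} (hM : ∀ n t, ((c n).mass t).mass ≤ M)
    (hM' : ∀ t, (c'.mass t).mass ≤ M) : IsWeakSolution μA μB T' c' := by
  refine ⟨hT', fun η hη => ?_⟩
  have hval : Continuous fun p : Cyl D => ((p.1 : ℝ), (p.2 : Vec d)) := by fun_prop
  have hfd := (hη.continuous_fderiv one_ne_zero).comp hval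
  set H : C(Cyl D, ℝ) := ⟨fun p => deriv (fun s : ℝ => η (s, (p.2 : Vec d))) (p.1 : ℝ), by
    simp_rw [deriv_slice_eq hη]
    exact hfd.clm_apply continuous_const⟩ with hH
  set F : C(Cyl D, Vec d) := ⟨fun p => gradient (fun y : Vec d => η ((p.1 : ℝ), y)) (p.2 : Vec d), by
    simp_rw [gradient_slice_eq hη]
    exact (InnerProductSpace.toDual ℝ (Vec d)).symm.continuous.comp
      (hfd.clm_comp continuous_const)⟩ with hF
  set G : C(Cyl D, ℝ) := ⟨fun p => η ((p.1 : ℝ), (p.2 : Vec d)), hη.continuous.comp hval⟩ with hG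
  have key := ((hc.tendsto_integral_pairing (fun n => (hT n).disintegration) hT' hM hM'
    F H G).sub_const (∫ x : Cl D, η (1, (x : Vec d)) ∂(μB : Measure (Cl D)))).add_const
      (∫ x : Cl D, η (0, (x : Vec d)) ∂(μA : Measure (Cl D)))
  -- The expression in the equation vanishes for every n, so its limit, the same expression for the
  -- limit curve, is 0.
  exact tendsto_nhds_unique (tendsto_const_nhds.congr fun n => (hT n).equation η hη) key

theorem ConvergesTo.pathEnergy_le_liminf [CompactSpace (Cl D)] [IsFiniteMeasure (leb D)]
    {r : ℝ → ℝ} (hr : IsSourcePenalty r) {δ : ℝ} (hδ : 0 < δ)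
    {T : ℕ → Triple D} {c : ℕ → Curve D} {T' : Triple D} {c' : Curve D}
    (hc : ConvergesTo T c T' c') (hT : ∀ n, IsDisintegration (T n) (c n))
    (hT' : IsDisintegration T' c') {M : NNReal} (hM : ∀ n t, ((c n).mass t).mass ≤ M)
    (hM' : ∀ t, (c'.mass t).mass ≤ M) :
    pathEnergy δ r c' ≤ liminf (fun n => pathEnergy δ r (c n)) atTop := by
  obtain ⟨b, a, g, q, hE⟩ := exists_energyDensity_eq_iSup d hr hδ (leb D)
  set L : Curve D → ℕ → I → ℝ := fun c k t => ∫ᵛ x, b k x ∂[innerSL ℝ; c.momentum t]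
    - ∫ x, a k x ∂(c.mass t : Measure (Cl D)) + ∫ᵛ x, g k x ∂•(c.source t) - q k with hL
  have hpath : ∀ c : Curve D, pathEnergy δ r c = ∫⁻ t, ⨆ k, ENNReal.ofReal (L c k t) := fun c =>
    lintegral_congr fun t => hE _ _ _
  set F : C(I, ℝ) → ℕ → C(Cyl D, Vec d) := fun w k => ⟨fun p => w p.1 • b k p.2, by fun_prop⟩ with hF
  set H : C(I, ℝ) → ℕ → C(Cyl D, ℝ) := fun w k => ⟨fun p => w p.1 * -a k p.2, by fun_prop⟩ with hH
  set G : C(I, ℝ) → ℕ → C(Cyl D, ℝ) := fun w k => ⟨fun p => w p.1 * g k p.2, by fun_prop⟩ with hG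
  have hpair : ∀ (c : Curve D) (w : C(I, ℝ)) k t,
      w t * L c k t = pairing c (F w k) (H w k) (G w k) t - w t * q k := by
    intro c w k t
    have e1 : ∫ x, H w k (t, x) ∂(c.mass t : Measure (Cl D)) =
        w t * -∫ x, a k x ∂(c.mass t : Measure (Cl D)) := by
      rw [← integral_neg, ← integral_const_mul]; rfl
    have e2 : ∫ᵛ x, F w k (t, x) ∂[innerSL ℝ; c.momentum t] =
        w t * ∫ᵛ x, b k x ∂[innerSL ℝ; c.momentum t] :=
      VectorMeasure.integral_fun_smul _ _ (w t) _
    have e3 : ∫ᵛ x, G w k (t, x) ∂•(c.source t) = w t * ∫ᵛ x, g k x ∂•(c.source t) :=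
      VectorMeasure.integral_fun_smul _ _ (w t) _
    rw [pairing, e1, e2, e3, hL]
    ring
  have hint : ∀ {T : Triple D} {c : Curve D}, IsDisintegration T c → (∀ t, (c.mass t).mass ≤ M) →
      ∀ (w : C(I, ℝ)) k, Integrable (pairing c (F w k) (H w k) (G w k)) :=
    fun h hM w k => h.integrable_pairing hM _ _ _
  have hwq : ∀ (w : C(I, ℝ)) k, Integrable fun t : I => w t * q k := fun w k =>
    integrable_continuousMap ⟨fun t => w t * q k, by fun_prop⟩
  have hLint : ∀ {T : Triple D} {c : Curve D}, IsDisintegration T c →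
      (∀ t, (c.mass t).mass ≤ M) → ∀ k, Integrable (L c k) := by
    intro T c h hM k
    have := (hint h hM 1 k).sub (hwq 1 k)
    refine this.congr (ae_of_all _ fun t => ?_)
    have h2 := hpair c 1 k t
    simpa using h2.symm
  have hLmeas : ∀ k, Measurable (L c' k) := fun k => by
    refine Measurable.sub_const (Measurable.add (Measurable.sub ?_ ?_) ?_) _
    · exact measurable_inner_integral_family hT'.measurable_momentum
        (η := fun p => b k p.2) (by fun_prop) fun p => (b k).norm_coe_le_norm p.2
    · exact measurable_integral_mass hT'.continuous_mass (η := fun p => a k p.2) (by fun_prop)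
    · exact measurable_integral_family hT'.measurable_source
        (η := fun p => g k p.2) (by fun_prop) fun p => (g k).norm_coe_le_norm p.2
  rw [hpath]
  -- Duality in time: for fixed continuous weights the functional converges along the sequence, and
  -- for each n it is bounded by the energy of the n-th curve.
  refine lintegral_iSup_le_of_weights hLmeas (hLint hT' hM') fun N w => ?_
  have hlim : Tendsto (fun n => ENNReal.ofReal (∑ k : Fin N, ∫ t, w.1 k t * L (c n) k t)) atTop
      (𝓝 (ENNReal.ofReal (∑ k : Fin N, ∫ t, w.1 k t * L c' k t))) := by
    refine ENNReal.tendsto_ofReal (tendsto_finsetSum _ fun k _ => ?_)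
    have e : ∀ {T : Triple D} {c : Curve D}, IsDisintegration T c → (∀ t, (c.mass t).mass ≤ M) →
        ∫ t, w.1 k t * L c k t =
          (∫ t, pairing c (F (w.1 k) k) (H (w.1 k) k) (G (w.1 k) k) t) - ∫ t : I, w.1 k t * q k := by
      intro T c h hM
      rw [← integral_sub (hint h hM _ _) (hwq _ _)]
      exact integral_congr_ae (ae_of_all _ fun t => hpair c _ _ t)
    rw [e hT' hM']
    simp_rw [fun n => e (hT n) (hM n)]
    exact (hc.tendsto_integral_pairing hT hT' hM hM' _ _ _).sub_const _
  rw [← hlim.liminf_eq]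
  refine liminf_le_liminf (Eventually.of_forall fun n => ?_)
  rw [hpath]
  exact sum_integral_weights_le (hLint (hT n) (hM n)) w

end MainResult

end
end SourceTransport

open SourceTransport in
theorem mainTheorem2 {d : ℕ} {D : Set (Vec d)} (hD : IsBoundedConvexDomain D)
    {r : ℝ → ℝ} (hr : IsSourcePenalty r) {δ : ℝ} (hδ : 0 < δ)
    (μA μB : FiniteMeasure (Cl D))
    (T : ℕ → Triple D) (c : ℕ → Curve D)
    (hT : ∀ n, IsWeakSolution μA μB (T n) (c n))
    (C : ℝ) (hC : ∀ n, pathEnergy δ r (c n) ≤ ENNReal.ofReal C) :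
    ∃ (φ : ℕ → ℕ) (T' : Triple D) (c' : Curve D),
      StrictMono φ ∧
      IsWeakSolution μA μB T' c' ∧
      (∀ t : I, Tendsto (fun n => (c (φ n)).mass t) atTop (𝓝 (c'.mass t))) ∧
      (∀ f : C(Cyl D, Vec d),
        Tendsto (fun n => ∫ᵛ p, f p ∂[innerSL ℝ; (T (φ n)).momentum]) atTop
          (𝓝 (∫ᵛ p, f p ∂[innerSL ℝ; T'.momentum]))) ∧
      (∀ f : C(Cyl D, ℝ),
        Tendsto (fun n => ∫ᵛ p, f p ∂•(T (φ n)).source) atTop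
          (𝓝 (∫ᵛ p, f p ∂•T'.source))) ∧
      pathEnergy δ r c' ≤ liminf (fun n => pathEnergy δ r (c (φ n))) atTop := by
  have := hD.compactSpace
  have := hD.isFiniteMeasure_leb
  have : Nonempty (Cl D) := hD.nonempty.closure.to_subtype
  have hTd := fun n => (hT n).disintegration
  -- The mass bound rests on the source estimate alone and must precede the momentum estimate, which
  -- depends on `M`.
  obtain ⟨M, hM⟩ := exists_mass_le hr hδ hT hC
  obtain ⟨φ, T', c', hφ, hdis, hM', hconv⟩ := exists_subseq_convergesTo hT hM
    (uniformlyAC_momentum hTd hC hM) (uniformlyAC_source hr hδ hTd hC)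
  refine ⟨φ, T', c', hφ, hconv.isWeakSolution (fun n => hT (φ n)) hdis (fun n => hM (φ n)) hM',
    hconv.mass, fun f => ?_, hconv.source, hconv.pathEnergy_le_liminf hr hδ (fun n => hTd (φ n)) hdis
      (fun n => hM (φ n)) hM'⟩
  have e : ∀ ν : VectorMeasure (Cyl D) (Vec d), ∫ᵛ p, f p ∂[innerSL ℝ; ν] =
      ∑ i, ∫ᵛ p, f p i ∂•(component ν i) := fun ν =>
    integral_inner_eq_sum (integrable_continuousMap f)
  simp_rw [e]
  exact tendsto_finsetSum _ fun i _ => hconv.momentum i ⟨fun p => f p i, by fun_prop⟩
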